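/- **Setting.** Let $k\ge 1$, $n_1,\dots,n_k\ge 1$, $N=n_1+\dots+n_k$, let $\Omega_1\subset\mathbb R^{n_1}$ and $\Omega_2\subset\mathbb R^{n_2+\dots+n_k}$ be bounded open sets such that $\Omega=\Omega_1\times\Omega_2\subset\mathbb R^N$ has Lipschitz boundary, and write points of $\Omega$ as $x=(x_1,\dots,x_k)$ with $x_i\in\mathbb R^{n_i}$. Let $p_1=1$ and $1<p_i<\infty$ for $i=2,\dots,k$. Denote by $\nabla_{x_i}u$ the (weak) gradient and by $D_{x_i}u$ the distributional gradient in the variables $x_i$, and put $$BV^{(p_i)}(\Omega)=\{u\in BV(\Omega):\ \nabla_{x_i}u\in L^{p_i}(\Omega;\mathbb R^{n_i})\ \text{for } i=2,\dots,k\},$$ $$W^{1,(p_i)}(\Omega)=\{u\in W^{1,1}(\Omega):\ \nabla_{x_i}u\in L^{p_i}(\Omega;\mathbb R^{n_i})\ \text{for } i=1,\dots,k\},$$ $$\int_\Omega|D_{x_1}u|=\sup\Big\{\int_\Omega u\,\mathrm{div}_{x_1}\varphi\,dx:\ \varphi\in C_c^\infty(\Omega;\mathbb R^{n_1}),\ |\varphi|\le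 1\Big\}.$$ The trace of $u\in BV(\Omega)$ on $\partial\Omega_1\times\Omega_2$ is the function $T$ such that $\lim_{r\to0^+}r^{-N}\int_{\Omega\cap B(x,r)}|u(y)-T(x)|\,dy=0$ for $\mathcal H^{N-1}$-a.e. $x\in\partial\Omega_1\times\Omega_2$. **Proposition (anisotropic Meyers–Serrin).** Let $q\in[1,\infty]$ and $u\in BV^{(p_i)}(\Omega)\cap L^q(\Omega)$. Then $\int_\Omega|D_{x_1}u|<\infty$, and there is a sequence $u_m\in W^{1,1}(\Omega)\cap C^\infty(\Omega)\cap L^q(\Omega)$ such that 1. $u_m\to u$ in $L^q(\Omega)$ if $q<\infty$, and $u_m\rightharpoonup u$ weakly* in $L^\infty(\Omega)$ if $q=\infty$; 2. $\int_\Omega|\nabla_{x_1}u_m|\,dx\to\int_\Omega|D_{x_1}u|$; 3. $\nabla_{x_i}u_m\to\nabla_{x_i}u$ in $L^{p_i}(\Omega;\mathbb R^{n_i})$ for all $i=2,\dots,k$; 4. $u$ and all the $u_m$ have a trace on $\partial\Omega_1\times\Omega_2$, and $u_m|_{\partial\Omega_1\times\Omega_2}=u|_{\partial\Omega_1\times\Omega_2}$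 $\mathcal H^{N-1}$-a.e. for every $m$. If moreover $u\in W^{1,(p_i)}(\Omega)$, then for the same sequence also $\nabla_{x_1}u_m\to\nabla_{x_1}u$ in $L^1(\Omega;\mathbb R^{n_1})$. -/

import Mathlib

open MeasureTheory Set Filter Topology
open scoped ENNReal NNReal ContDiff

noncomputable section

/-! Points of `ℝ^N`, `N = n 0 + ⋯ + n (k-1)`, are split into `k` blocks, the `i`-th one having
`n i` coordinates. The block called `x₁` in the mathematical text has index `0 : Fin k`. -/

/-- The space `ℝ^N = ℝ^{n 0} × ⋯ × ℝ^{n (k-1)}` with its Euclidean norm. -/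
abbrev Space {k : ℕ} (n : Fin k → ℕ) : Type :=
  EuclideanSpace ℝ (Σ i : Fin k, Fin (n i))

/-- The space of the values of the `i`-th block of the variables, `ℝ^{n i}`. -/
abbrev Block {k : ℕ} (n : Fin k → ℕ) (i : Fin k) : Type :=
  EuclideanSpace ℝ (Fin (n i))

/-- The space of all blocks of variables except for the first one. -/
abbrev OtherBlocks {k : ℕ} [NeZero k] (n : Fin k → ℕ) : Type :=
  EuclideanSpace ℝ (Σ i : {i : Fin k // i ≠ 0}, Fin (n i.1))

section Domains

variable {k : ℕ} {n : Fin k → ℕ}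

/-- The first block `x₁` of a point. -/
def firstBlock [NeZero k] (x : Space n) : Block n 0 :=
  WithLp.toLp 2 fun j => x ⟨0, j⟩

/-- The remaining blocks `(x₂, …, x_k)` of a point. -/
def restBlocks [NeZero k] (x : Space n) : OtherBlocks n :=
  WithLp.toLp 2 fun c => x ⟨c.1.1, c.2⟩

/-- The product `A × B`, where `A` is a set of first blocks and `B` a set of the other blocks. -/
def blockProd [NeZero k] (A : Set (Block n 0)) (B : Set (OtherBlocks n)) : Set (Space n) :=
  {x | firstBlock x ∈ A ∧ restBlocks x ∈ B}

end Domains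

section General

variable {ι : Type} [Fintype ι] [DecidableEq ι]

/-- `Ω` has Lipschitz boundary: near each boundary point, and after a rotation of the coordinates
which makes the unit vector `e` vertical, `Ω` is the part above the graph of a Lipschitz function
of the coordinates orthogonal to `e`. -/
def HasLipschitzBoundary (Ω : Set (EuclideanSpace ℝ ι)) : Prop :=
  ∀ x ∈ frontier Ω, ∃ (e : EuclideanSpace ℝ ι) (γ : (Submodule.span ℝ {e})ᗮ → ℝ) (K : ℝ≥0) (r : ℝ),
    ‖e‖ = 1 ∧ LipschitzWith K γ ∧ 0 < r ∧
      ∀ y ∈ Metric.ball x r,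
        y ∈ Ω ↔ γ ((Submodule.span ℝ {e})ᗮ.orthogonalProjectionOnto y) < inner ℝ e y

/-- `φ` is of class `C_c^∞(Ω; F)`. -/
structure IsTestFunction {F : Type*} [NormedAddCommGroup F] [NormedSpace ℝ F]
    (Ω : Set (EuclideanSpace ℝ ι)) (φ : EuclideanSpace ℝ ι → F) : Prop where
  contDiff : ContDiff ℝ ∞ φ
  hasCompactSupport : HasCompactSupport φ
  tsupport_subset : tsupport φ ⊆ Ω

/-- The partial derivative `∂_c φ(x)`. -/
def partialDeriv {F : Type*} [NormedAddCommGroup F] [NormedSpace ℝ F]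
    (c : ι) (φ : EuclideanSpace ℝ ι → F) (x : EuclideanSpace ℝ ι) : F :=
  fderiv ℝ φ x (EuclideanSpace.single c 1)

/-- The full divergence of a vector field. -/
def divergence (φ : EuclideanSpace ℝ ι → EuclideanSpace ℝ ι) (x : EuclideanSpace ℝ ι) : ℝ :=
  ∑ c, partialDeriv c φ x c

/-- `u` is a function of bounded variation: it is integrable on `Ω` and its distributional
gradient on `Ω` is a finite vector-valued measure `D`, that is
`∫_Ω u div φ dx = - ∫ φ · dD` for all `φ ∈ C_c^∞(Ω; ℝ^N)`. -/
def MemBV (Ω : Set (EuclideanSpace ℝ ι)) (u : EuclideanSpace ℝ ι → ℝ) : Prop :=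
  IntegrableOn u Ω ∧
    ∃ D : VectorMeasure (EuclideanSpace ℝ ι) (EuclideanSpace ℝ ι),
      IsFiniteMeasure D.variation ∧
        ∀ φ : EuclideanSpace ℝ ι → EuclideanSpace ℝ ι, IsTestFunction Ω φ →
          ∫ x in Ω, u x * divergence φ x = -(D.integral φ (innerSL ℝ))

/-- `a` is the boundary value of `u` at `x ∈ ∂Ω`:
`r^{-N} ∫_{Ω ∩ B(x, r)} |u(y) - a| dy → 0` as `r → 0⁺`. -/
def HasBoundaryValue (Ω : Set (EuclideanSpace ℝ ι)) (u : EuclideanSpace ℝ ι → ℝ)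
    (x : EuclideanSpace ℝ ι) (a : ℝ) : Prop :=
  Tendsto
    (fun r : ℝ => (∫⁻ y in Ω ∩ Metric.ball x r, ‖u y - a‖ₑ) / ENNReal.ofReal (r ^ Fintype.card ι))
    (𝓝[>] 0) (𝓝 0)

/-- `T` is the trace of `u` on the part `S` of the boundary of `Ω`: for almost every point of `S`
with respect to the `(N-1)`-dimensional Hausdorff measure, `T x` is the boundary value of `u`
at `x`. -/
def IsTraceOn (Ω S : Set (EuclideanSpace ℝ ι)) (u T : EuclideanSpace ℝ ι → ℝ) : Prop :=
  ∀ᵐ x ∂(Measure.hausdorffMeasure ((Fintype.card ι : ℝ) - 1) : Measure (EuclideanSpace ℝ ι)),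
    x ∈ S → HasBoundaryValue Ω u x (T x)

end General

section Anisotropic

variable {k : ℕ} {n : Fin k → ℕ}

/-- The classical partial gradient `∇_{x_i} u`. -/
def blockGrad (i : Fin k) (u : Space n → ℝ) (x : Space n) : Block n i :=
  WithLp.toLp 2 fun j => partialDeriv ⟨i, j⟩ u x

/-- The partial divergence `div_{x_i} φ` of a field with values in `ℝ^{n i}`. -/
def blockDiv (i : Fin k) (φ : Space n → Block n i) (x : Space n) : ℝ :=
  ∑ j, partialDeriv ⟨i, j⟩ φ x j

/-- The locally integrable field `g` is the weak partial gradient `∇_{x_i} u` on `Ω`. -/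
def IsWeakBlockGrad (Ω : Set (Space n)) (i : Fin k) (u : Space n → ℝ)
    (g : Space n → Block n i) : Prop :=
  LocallyIntegrableOn g Ω ∧
    ∀ φ : Space n → ℝ, IsTestFunction Ω φ → ∀ j : Fin (n i),
      ∫ x in Ω, u x * partialDeriv ⟨i, j⟩ φ x = -∫ x in Ω, g x j * φ x

/-- The total variation on `Ω` of the distributional partial gradient,
`∫_Ω |D_{x_i} u| = sup {∫_Ω u div_{x_i} φ dx : φ ∈ C_c^∞(Ω; ℝ^{n i}), |φ| ≤ 1 on Ω}`. -/
def blockVariation (Ω : Set (Space n)) (i : Fin k) (u : Space n → ℝ) : ℝ≥0∞ :=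
  ⨆ (φ : Space n → Block n i) (_ : IsTestFunction Ω φ) (_ : ∀ x ∈ Ω, ‖φ x‖ ≤ 1),
    ENNReal.ofReal (∫ x in Ω, u x * blockDiv i φ x)

/-- The Sobolev space `W^{1,1}(Ω)`. -/
def MemW11 (Ω : Set (Space n)) (u : Space n → ℝ) : Prop :=
  IntegrableOn u Ω ∧
    ∀ i, ∃ g : Space n → Block n i, IsWeakBlockGrad Ω i u g ∧ IntegrableOn g Ω

/-- The anisotropic Sobolev space `W^{1,(p_i)}(Ω)`: functions in `W^{1,1}(Ω)` such that
`∇_{x_i} u ∈ L^{p_i}(Ω; ℝ^{n i})` for all `i`. -/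
def MemAnisoW (Ω : Set (Space n)) (p : Fin k → ℝ) (u : Space n → ℝ) : Prop :=
  MemW11 Ω u ∧
    ∀ i, ∃ g : Space n → Block n i, IsWeakBlockGrad Ω i u g ∧
      MemLp g (ENNReal.ofReal (p i)) (volume.restrict Ω)

/-- The anisotropic space `BV^{(p_i)}(Ω)`: functions in `BV(Ω)` such that
`∇_{x_i} u ∈ L^{p_i}(Ω; ℝ^{n i})` for all blocks except for the first one. (That `D_{x₁} u` is a
finite measure is contained in `u ∈ BV(Ω)`.) -/
def MemAnisoBV [NeZero k] (Ω : Set (Space n)) (p : Fin k → ℝ) (u : Space n → ℝ) : Prop :=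
  MemBV Ω u ∧
    ∀ i, i ≠ 0 → ∃ g : Space n → Block n i, IsWeakBlockGrad Ω i u g ∧
      MemLp g (ENNReal.ofReal (p i)) (volume.restrict Ω)

/-- `u_n → u` in `L^q(Ω)` if `q < ∞`, and `u_n → u` weakly* in `L^∞(Ω)` (tested against all
functions in `L^1(Ω)`) if `q = ∞`. -/
def ConvergesLq (Ω : Set (Space n)) (q : ℝ≥0∞) (v : ℕ → Space n → ℝ) (u : Space n → ℝ) : Prop :=
  (∀ m, MemLp (v m) q (volume.restrict Ω)) ∧
    (q ≠ ⊤ → Tendsto (fun m => eLpNorm (v m - u) q (volume.restrict Ω)) atTop (𝓝 0)) ∧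
    (q = ⊤ → ∀ f : Space n → ℝ, IntegrableOn f Ω →
      Tendsto (fun m => ∫ x in Ω, v m x * f x) atTop (𝓝 (∫ x in Ω, u x * f x)))

end Anisotropic

end

/-! The approximation is v = Σ_{j,l} Z_j(x₁) B_l(x₂,…,x_k) θ_{M_j}(ρ_{m_{jl}} * u). Here (Z_j) and
(B_l) are partitions of unity of Ω₁ and Ω₂ by compactly supported smooth functions, ρ_m is a
mollifier, and θ_M(s) = (M+1) arctan(s/(M+1)) is a smooth bounded truncation with 0 ≤ θ_M' ≤ 1.

The truncation handles the main difficulty of the anisotropic setting. Differentiating the partition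
of unity produces terms ∂_c(Z_j B_l)(ρ*u − u), which must be small in L^{p_i}, while u itself is
only known to lie in L¹ and L^q. After truncation these differences are bounded, so they tend to
zero in every finite L^p on the compact support of the bump. Undoing the truncation costs Σ_j ∂_c
Z_j (θ_{M_j}(u) − u): the level depends on j alone, so the derivatives of the B_l cancel. This error
vanishes for c in a block i ≥ 2, because Z_j depends only on x₁; for c in the first block only the
exponent 1 occurs, and u ∈ L¹ is enough. This gives `eventually_partialDeriv_layerSum` and
`eLpNorm_partialDeriv_layerSum_sub_le`.

For the variation in x₁, the main part of the gradient is at most Σ_a ψ_a |∇_{x₁}(ρ_a * u)| with ψ_a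
= Z_j B_l. Its integral is estimated by duality in `sum_lintegral_blockGrad_mollify_le`: the fields
−ψ_a ∇w_a/|∇w_a|, regularised and mollified, add up to an admissible test field of norm at most 1 +
ε. Lower semicontinuity of the variation gives the opposite inequality.

For the traces, each Z_j vanishes in a neighbourhood of ∂Ω₁ × Ω₂, so the errors can be chosen small
against dist^{-N} on its support. Hence |v − u| |y − x₀|^{-N} is integrable for every x₀ ∈ ∂Ω₁ × Ω₂,
and u and v have the same boundary values at x₀ (`HasBoundaryValue.of_lintegral_weight`). Existence
needs to be proved only for a smooth W^{1,1} function on a Lipschitz domain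
(`ae_exists_hasBoundaryValue`): in graph coordinates, integrate the gradient along vertical lines
and use Lebesgue points. The trace of u is then inherited from one of its approximations.

If q = ∞, v is a convex combination of truncated mollifications, so ‖v‖_∞ ≤ ‖u‖_∞; with L¹
convergence this yields weak* convergence. If u has an integrable weak gradient in x₁, the first
block simply joins the controlled directions, with exponent 1. -/

open scoped Convolution Manifold

noncomputable section

set_option linter.unusedSectionVars false

/-! ### Mollification and its convergence in L^p. -/

section Mollify

variable {ι : Type} [Fintype ι] {F : Type*} [NormedAddCommGroup F] [NormedSpace ℝ F]

/-- The bump functions at the origin of radius `1 / (m + 1)`. -/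
def shrinkingBump (ι : Type) [Fintype ι] (m : ℕ) : ContDiffBump (0 : EuclideanSpace ℝ ι) where
  rIn := 1 / (2 * (m + 1))
  rOut := 1 / (m + 1)
  rIn_pos := by positivity
  rIn_lt_rOut := by
    apply one_div_lt_one_div_of_lt <;> nlinarith [(Nat.cast_nonneg m : (0 : ℝ) ≤ m)]

/-- The kernel of the mollifier at scale `1 / (m + 1)`. -/
def mollKernel (ι : Type) [Fintype ι] (m : ℕ) : EuclideanSpace ℝ ι → ℝ :=
  (shrinkingBump ι m).normed volume

/-- The mollification of `f` at scale `1 / (m + 1)`. -/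
def mollify (m : ℕ) (f : EuclideanSpace ℝ ι → F) : EuclideanSpace ℝ ι → F :=
  mollKernel ι m ⋆[ContinuousLinearMap.lsmul ℝ ℝ, volume] f

lemma shrinkingBump_rOut_tendsto :
    Tendsto (fun m => (shrinkingBump ι m).rOut) atTop (𝓝 0) :=
  tendsto_one_div_add_atTop_nhds_zero_nat

lemma mollKernel_nonneg (m : ℕ) (x : EuclideanSpace ℝ ι) : 0 ≤ mollKernel ι m x :=
  (shrinkingBump ι m).nonneg_normed x

lemma mollKernel_contDiff (m : ℕ) : ContDiff ℝ ∞ (mollKernel ι m) :=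
  (shrinkingBump ι m).contDiff_normed (n := ⊤)

lemma mollKernel_continuous (m : ℕ) : Continuous (mollKernel ι m) :=
  (mollKernel_contDiff m).continuous

lemma mollKernel_hasCompactSupport (m : ℕ) : HasCompactSupport (mollKernel ι m) :=
  (shrinkingBump ι m).hasCompactSupport_normed

lemma mollKernel_neg (m : ℕ) (x : EuclideanSpace ℝ ι) : mollKernel ι m (-x) = mollKernel ι m x :=
  (shrinkingBump ι m).normed_neg x

lemma mollKernel_sub_comm (m : ℕ) (x y : EuclideanSpace ℝ ι) :
    mollKernel ι m (x - y) = mollKernel ι m (y - x) := by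
  rw [← mollKernel_neg, neg_sub]

lemma integral_mollKernel (m : ℕ) : ∫ x, mollKernel ι m x = 1 :=
  (shrinkingBump ι m).integral_normed

lemma support_mollKernel (m : ℕ) :
    Function.support (mollKernel ι m) = Metric.ball 0 (1 / (m + 1)) :=
  (shrinkingBump ι m).support_normed_eq

lemma mollKernel_eq_zero {m : ℕ} {x : EuclideanSpace ℝ ι} (hx : 1 / ((m : ℝ) + 1) ≤ ‖x‖) :
    mollKernel ι m x = 0 := by
  have : x ∉ Function.support (mollKernel ι m) := by
    rw [support_mollKernel]; simpa using hx
  simpa using this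

lemma mollify_apply (m : ℕ) (f : EuclideanSpace ℝ ι → F) (x : EuclideanSpace ℝ ι) :
    mollify m f x = ∫ t, mollKernel ι m t • f (x - t) := rfl

lemma mollify_apply_swap (m : ℕ) (f : EuclideanSpace ℝ ι → F) (x : EuclideanSpace ℝ ι) :
    mollify m f x = ∫ t, mollKernel ι m (x - t) • f t := by
  rw [mollify, convolution_eq_swap]; rfl

lemma mollify_congr (m : ℕ) {f g : EuclideanSpace ℝ ι → F} (h : f =ᵐ[volume] g) :
    mollify m f = mollify m g :=
  convolution_congr _ (ae_eq_refl _) h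

lemma mollify_contDiff (m : ℕ) {f : EuclideanSpace ℝ ι → F} (hf : LocallyIntegrable f) :
    ContDiff ℝ ∞ (mollify m f) :=
  (mollKernel_hasCompactSupport m).contDiff_convolution_left _ (n := ⊤) (mollKernel_contDiff m) hf

lemma mollify_exists (m : ℕ) {f : EuclideanSpace ℝ ι → F} (hf : LocallyIntegrable f) :
    ConvolutionExists (mollKernel ι m) f (ContinuousLinearMap.lsmul ℝ ℝ) volume :=
  (mollKernel_hasCompactSupport m).convolutionExists_left _ (mollKernel_continuous m) hf

lemma mollify_integrable_kernel (m : ℕ) {f : EuclideanSpace ℝ ι → F} (hf : LocallyIntegrable f)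
    (x : EuclideanSpace ℝ ι) : Integrable fun t => mollKernel ι m t • f (x - t) :=
  mollify_exists m hf x

lemma mollify_sub (m : ℕ) {f g : EuclideanSpace ℝ ι → F} (hf : LocallyIntegrable f)
    (hg : LocallyIntegrable g) : mollify m (f - g) = mollify m f - mollify m g := by
  ext x
  simp only [mollify_apply, Pi.sub_apply, smul_sub]
  exact integral_sub (mollify_integrable_kernel m hf x) (mollify_integrable_kernel m hg x)

lemma norm_mollify_le (m : ℕ) {f : EuclideanSpace ℝ ι → F} {h : EuclideanSpace ℝ ι → ℝ}
    (hh : LocallyIntegrable h) (hfh : ∀ x, ‖f x‖ ≤ h x) (x : EuclideanSpace ℝ ι) :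
    ‖mollify m f x‖ ≤ mollify m h x := by
  rw [mollify_apply, mollify_apply]
  refine norm_integral_le_of_norm_le (mollify_integrable_kernel m hh x) (ae_of_all _ fun t => ?_)
  rw [norm_smul, Real.norm_of_nonneg (mollKernel_nonneg m t), smul_eq_mul]
  exact mul_le_mul_of_nonneg_left (hfh _) (mollKernel_nonneg m t)

lemma mollify_eq_zero (m : ℕ) {f : EuclideanSpace ℝ ι → F} {x : EuclideanSpace ℝ ι}
    (hx : ∀ y ∈ Metric.ball x (1 / (m + 1)), f y = 0) : mollify m f x = 0 := by
  rw [mollify_apply]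
  refine integral_eq_zero_of_ae (ae_of_all _ fun t => ?_)
  by_cases ht : ‖t‖ < 1 / ((m : ℝ) + 1)
  · simp [hx (x - t) (by simpa using ht)]
  · simp [mollKernel_eq_zero (not_lt.1 ht)]

lemma tsupport_mollify_subset (m : ℕ) {f : EuclideanSpace ℝ ι → F} {K : Set (EuclideanSpace ℝ ι)}
    (hK : Function.support f ⊆ K) :
    tsupport (mollify m f) ⊆ Metric.cthickening (1 / (m + 1)) K := by
  refine closure_minimal (fun x hx => ?_) Metric.isClosed_cthickening
  by_contra hxK
  refine hx (mollify_eq_zero m fun y hy => ?_)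
  by_contra hy0
  refine hxK (Metric.mem_cthickening_of_dist_le x y _ _ (hK hy0) ?_)
  rw [dist_comm]; exact (Metric.mem_ball.1 hy).le

lemma mollify_hasCompactSupport (m : ℕ) {f : EuclideanSpace ℝ ι → F} (hf : HasCompactSupport f) :
    HasCompactSupport (mollify m f) :=
  HasCompactSupport.convolution _ (mollKernel_hasCompactSupport m) hf

lemma mollify_ae_tendsto [CompleteSpace F] {f : EuclideanSpace ℝ ι → F} (hf : LocallyIntegrable f) :
    ∀ᵐ x, Tendsto (fun m => mollify m f x) atTop (𝓝 (f x)) := by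
  refine ContDiffBump.ae_convolution_tendsto_right_of_locallyIntegrable (K := 2)
    shrinkingBump_rOut_tendsto (Eventually.of_forall fun m => ?_) hf
  change (1 : ℝ) / (m + 1) ≤ 2 * (1 / (2 * (m + 1)))
  apply le_of_eq; field_simp

/-- The probability measure with the mollifying kernel as density. -/
def mollMeasure (ι : Type) [Fintype ι] (m : ℕ) : Measure (EuclideanSpace ℝ ι) :=
  volume.withDensity fun t => ENNReal.ofReal (mollKernel ι m t)

instance (m : ℕ) : IsProbabilityMeasure (mollMeasure ι m) where
  measure_univ := by
    rw [mollMeasure, withDensity_apply _ MeasurableSet.univ, Measure.restrict_univ,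
      ← ofReal_integral_eq_lintegral_ofReal
        ((mollKernel_continuous m).integrable_of_hasCompactSupport (mollKernel_hasCompactSupport m))
        (ae_of_all _ (mollKernel_nonneg m)), integral_mollKernel]
    simp

/-- Jensen's inequality: with respect to a probability measure the L^p norms increase with p, so the
triangle inequality for the integral, which is the case of exponent 1, suffices. -/
lemma enorm_mollify_le (m : ℕ) {f : EuclideanSpace ℝ ι → F} (hf : StronglyMeasurable f)
    (x : EuclideanSpace ℝ ι) {p : ℝ≥0∞} (hp : 1 ≤ p) :
    ‖mollify m f x‖ₑ ≤ eLpNorm (fun t => f (x - t)) p (mollMeasure ι m) := by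
  have hf' : StronglyMeasurable fun t => f (x - t) :=
    hf.comp_measurable (measurable_const.sub measurable_id)
  refine le_trans ?_ (eLpNorm_le_eLpNorm_of_exponent_le hp hf'.aestronglyMeasurable)
  rw [mollify_apply, eLpNorm_one_eq_lintegral_enorm, mollMeasure,
    lintegral_withDensity_eq_lintegral_mul _ (by
      exact (mollKernel_continuous m).measurable.ennreal_ofReal) hf'.enorm]
  refine (enorm_integral_le_lintegral_enorm _).trans_eq ?_
  congr 1; ext t
  rw [enorm_smul, Pi.mul_apply, Real.enorm_eq_ofReal (mollKernel_nonneg m t)]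

/-- Young's inequality for a kernel of mass one: Jensen pointwise, then Tonelli and translation
invariance. The exponent ∞ instead uses that `mollMeasure` is absolutely continuous. -/
lemma eLpNorm_mollify_le (m : ℕ) {f : EuclideanSpace ℝ ι → F} (hf : AEStronglyMeasurable f)
    {p : ℝ≥0∞} (hp : 1 ≤ p) : eLpNorm (mollify m f) p ≤ eLpNorm f p := by
  -- A strongly measurable representative makes (x, t) ↦ g (x - t) jointly measurable, as Tonelli
  -- requires.
  rw [mollify_congr m hf.ae_eq_mk, eLpNorm_congr_ae hf.ae_eq_mk]
  have hg := hf.stronglyMeasurable_mk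
  set g := hf.mk f
  rcases eq_or_ne p ⊤ with rfl | hp'
  · rw [eLpNorm_exponent_top, eLpNorm_exponent_top]
    refine essSup_le_of_ae_le _ (ae_of_all _ fun x => ?_)
    refine (enorm_mollify_le m hg x le_top).trans ?_
    rw [eLpNorm_exponent_top]
    refine (essSup_mono_measure (withDensity_absolutelyContinuous _ _)).trans_eq ?_
    have := eLpNorm_comp_measurePreserving (p := ⊤) hg.aestronglyMeasurable
      (Measure.measurePreserving_sub_left (volume : Measure (EuclideanSpace ℝ ι)) x)
    simpa only [eLpNorm_exponent_top, eLpNormEssSup, Function.comp_def] using this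
  · have hp0 : p ≠ 0 := (zero_lt_one.trans_le hp).ne'
    have hpr : 0 < p.toReal := ENNReal.toReal_pos hp0 hp'
    rw [eLpNorm_eq_lintegral_rpow_enorm_toReal hp0 hp',
      eLpNorm_eq_lintegral_rpow_enorm_toReal hp0 hp']
    refine ENNReal.rpow_le_rpow ?_ (by positivity)
    calc ∫⁻ x, ‖mollify m g x‖ₑ ^ p.toReal
        ≤ ∫⁻ x, ∫⁻ t, ‖g (x - t)‖ₑ ^ p.toReal ∂(mollMeasure ι m) := by
          refine lintegral_mono fun x => ?_
          have := ENNReal.rpow_le_rpow (enorm_mollify_le m hg x hp) hpr.le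
          rwa [eLpNorm_eq_lintegral_rpow_enorm_toReal hp0 hp', one_div,
            ENNReal.rpow_inv_rpow hpr.ne'] at this
      _ = ∫⁻ t, ∫⁻ x, ‖g (x - t)‖ₑ ^ p.toReal ∂volume ∂(mollMeasure ι m) := by
          refine lintegral_lintegral_swap (Measurable.aemeasurable ?_)
          exact ((StronglyMeasurable.enorm hg).comp (measurable_fst.sub measurable_snd)).pow_const _
      _ = ∫⁻ x, ‖g x‖ₑ ^ p.toReal := by
          simp_rw [lintegral_sub_right_eq_self (fun x => ‖g x‖ₑ ^ p.toReal)]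
          simp

lemma dist_mollify_le [CompleteSpace F] (m : ℕ) {f : EuclideanSpace ℝ ι → F} (hf : Continuous f)
    {τ : ℝ} {x : EuclideanSpace ℝ ι} (h : ∀ y ∈ Metric.ball x (1 / (m + 1)), dist (f y) (f x) ≤ τ) :
    dist (mollify m f x) (f x) ≤ τ :=
  ContDiffBump.dist_normed_convolution_le (φ := shrinkingBump ι m) hf.aestronglyMeasurable h

lemma eventually_dist_mollify_le [CompleteSpace F] {f : EuclideanSpace ℝ ι → F} (hf : Continuous f)
    (hfc : HasCompactSupport f) {τ : ℝ} (hτ : 0 < τ) :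
    ∀ᶠ m in atTop, ∀ x, dist (mollify m f x) (f x) ≤ τ := by
  obtain ⟨δ, hδ, h⟩ := Metric.uniformContinuous_iff.1
    (hfc.uniformContinuous_of_continuous hf) τ hτ
  filter_upwards [shrinkingBump_rOut_tendsto (ι := ι) |>.eventually_lt_const hδ] with m hm x
  exact dist_mollify_le m hf fun y hy => (h ((Metric.mem_ball.1 hy).trans hm)).le

lemma eventually_cthickening_subset {K U : Set (EuclideanSpace ℝ ι)} (hK : IsCompact K)
    (hU : IsOpen U) (hKU : K ⊆ U) :
    ∀ᶠ m : ℕ in atTop, Metric.cthickening (1 / ((m : ℝ) + 1)) K ⊆ U := by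
  obtain ⟨δ, hδ, h⟩ := hK.exists_cthickening_subset_open hU hKU
  filter_upwards [shrinkingBump_rOut_tendsto (ι := ι) |>.eventually_lt_const hδ] with m hm
  exact (Metric.cthickening_mono hm.le K).trans h

/-- All the mollifications are supported in the closed 1-neighbourhood of the support, a fixed
compact set, on which uniform convergence controls every L^p norm. -/
lemma tendsto_eLpNorm_mollify_sub_of_continuous [CompleteSpace F] {f : EuclideanSpace ℝ ι → F}
    (hf : Continuous f) (hfc : HasCompactSupport f) (p : ℝ≥0∞) :
    Tendsto (fun m => eLpNorm (mollify m f - f) p) atTop (𝓝 0) := by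
  set K := Metric.cthickening 1 (tsupport f) with hK
  have hKc : IsCompact K := hfc.isCompact.cthickening
  have hsupp : ∀ m, ∀ x ∉ K, (mollify m f - f) x = 0 := by
    intro m x hx
    have h1 : x ∉ tsupport f := fun h => hx (Metric.self_subset_cthickening _ h)
    have h2 : x ∉ tsupport (mollify m f) := fun h => by
      refine hx (Metric.cthickening_mono ?_ _ (tsupport_mollify_subset m (subset_tsupport f) h))
      rw [div_le_one (by positivity)]; linarith [(Nat.cast_nonneg m : (0 : ℝ) ≤ m)]
    rw [Pi.sub_apply, image_eq_zero_of_notMem_tsupport h1, image_eq_zero_of_notMem_tsupport h2,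
      sub_zero]
  rw [ENNReal.tendsto_nhds_zero]
  intro ε hε
  have hKfin : volume K ^ (1 / p.toReal) ≠ ⊤ :=
    ENNReal.rpow_ne_top_of_nonneg (by positivity) hKc.measure_lt_top.ne
  obtain ⟨τ, hτ0, hτ⟩ : ∃ τ : ℝ, 0 < τ ∧ ENNReal.ofReal τ * volume K ^ (1 / p.toReal) ≤ ε := by
    have ht : Tendsto (fun τ : ℝ => ENNReal.ofReal τ * volume K ^ (1 / p.toReal)) (𝓝[>] 0) (𝓝 0) := by
      have := (ENNReal.tendsto_ofReal (tendsto_nhdsWithin_of_tendsto_nhds (s := Ioi 0)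
        (tendsto_id (α := ℝ) (x := 𝓝 0))))
      have := ENNReal.Tendsto.mul_const this (Or.inr hKfin)
      simpa using this
    obtain ⟨τ, h1, h2⟩ := ((ht.eventually_le_const hε).and self_mem_nhdsWithin).exists
    exact ⟨τ, h2, h1⟩
  filter_upwards [eventually_dist_mollify_le hf hfc hτ0] with m hm
  have : mollify m f - f = K.indicator (mollify m f - f) := by
    ext x
    by_cases hx : x ∈ K
    · rw [indicator_of_mem hx]
    · rw [indicator_of_notMem hx, hsupp m x hx]
  rw [this, eLpNorm_indicator_eq_eLpNorm_restrict hKc.measurableSet]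
  refine (eLpNorm_le_of_ae_bound (C := τ) (ae_of_all _ fun x => ?_)).trans ?_
  · simpa [dist_eq_norm] using hm x
  · rw [Measure.restrict_apply_univ, ← one_div, mul_comm]; exact hτ

/-- Density of compactly supported continuous functions; mollification contracts L^p, so the
approximation error is not enlarged. -/
lemma tendsto_eLpNorm_mollify_sub [CompleteSpace F] {f : EuclideanSpace ℝ ι → F}
    {p : ℝ≥0∞} (hp : 1 ≤ p) (hp' : p ≠ ⊤) (hf : MemLp f p) :
    Tendsto (fun m => eLpNorm (mollify m f - f) p) atTop (𝓝 0) := by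
  rw [ENNReal.tendsto_nhds_zero]
  intro ε hε
  have hε3 : ε / 3 ≠ 0 := by simp [hε.ne']
  obtain ⟨g, hgc, hfg, hg, hgp⟩ := hf.exists_hasCompactSupport_eLpNorm_sub_le hp' hε3
  filter_upwards [ENNReal.tendsto_nhds_zero.1
    (tendsto_eLpNorm_mollify_sub_of_continuous hg hgc p) (ε / 3) (pos_iff_ne_zero.2 hε3)]
    with m hm
  have hfl := hf.locallyIntegrable hp
  have hgl := hgp.locallyIntegrable hp
  have e : mollify m f - f = mollify m (f - g) + ((mollify m g - g) + (g - f)) := by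
    rw [mollify_sub m hfl hgl]; abel
  have a1 : AEStronglyMeasurable (mollify m (f - g)) volume :=
    (mollify_contDiff m (hfl.sub hgl)).continuous.aestronglyMeasurable
  have a2 : AEStronglyMeasurable (mollify m g) volume :=
    (mollify_contDiff m hgl).continuous.aestronglyMeasurable
  rw [e]
  calc _ ≤ eLpNorm (mollify m (f - g)) p volume
        + (eLpNorm (mollify m g - g) p volume + eLpNorm (g - f) p volume) :=
        (eLpNorm_add_le a1 ((a2.sub hgp.1).add (hgp.1.sub hf.1)) hp).trans
          (add_le_add le_rfl (eLpNorm_add_le (a2.sub hgp.1) (hgp.1.sub hf.1) hp))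
    _ ≤ ε / 3 + (ε / 3 + ε / 3) := by
        refine add_le_add ((eLpNorm_mollify_le m (hf.1.sub hgp.1) hp).trans hfg)
          (add_le_add hm ?_)
        rw [eLpNorm_sub_comm]; exact hfg
    _ = ε := by rw [← add_assoc, ENNReal.add_thirds]

end Mollify

/-! ### Mollification, classical and weak derivatives, and duality. -/

section MollifyDeriv

variable {ι : Type} [Fintype ι] [DecidableEq ι] {F : Type*} [NormedAddCommGroup F] [NormedSpace ℝ F]

lemma IsTestFunction.continuous {Ω : Set (EuclideanSpace ℝ ι)} {φ : EuclideanSpace ℝ ι → F}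
    (h : IsTestFunction Ω φ) : Continuous φ := h.contDiff.continuous

lemma IsTestFunction.mono {Ω Ω' : Set (EuclideanSpace ℝ ι)} {φ : EuclideanSpace ℝ ι → F}
    (h : IsTestFunction Ω φ) (hΩ : Ω ⊆ Ω') : IsTestFunction Ω' φ :=
  ⟨h.1, h.2, h.3.trans hΩ⟩

lemma IsTestFunction.eq_zero {Ω : Set (EuclideanSpace ℝ ι)} {φ : EuclideanSpace ℝ ι → F}
    (h : IsTestFunction Ω φ) {x : EuclideanSpace ℝ ι} (hx : x ∉ Ω) : φ x = 0 :=
  image_eq_zero_of_notMem_tsupport fun h' => hx (h.3 h')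

lemma contDiff_partialDeriv {φ : EuclideanSpace ℝ ι → F} (hφ : ContDiff ℝ ∞ φ) (c : ι) :
    ContDiff ℝ ∞ (partialDeriv c φ) :=
  (hφ.fderiv_right (m := ∞) (by simp)).clm_apply contDiff_const

lemma tsupport_partialDeriv_subset (φ : EuclideanSpace ℝ ι → F) (c : ι) :
    tsupport (partialDeriv c φ) ⊆ tsupport φ :=
  tsupport_fderiv_apply_subset ℝ _

lemma IsTestFunction.partialDeriv {Ω : Set (EuclideanSpace ℝ ι)} {φ : EuclideanSpace ℝ ι → F}
    (h : IsTestFunction Ω φ) (c : ι) : IsTestFunction Ω (partialDeriv c φ) :=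
  ⟨contDiff_partialDeriv h.1 c, h.2.fderiv_apply ℝ _,
    (tsupport_partialDeriv_subset φ c).trans h.3⟩

lemma IsTestFunction.mollify {Ω K : Set (EuclideanSpace ℝ ι)} {φ : EuclideanSpace ℝ ι → F} {m : ℕ}
    (hφ : Continuous φ) (hφc : HasCompactSupport φ) (hK : Function.support φ ⊆ K)
    (hm : Metric.cthickening (1 / ((m : ℝ) + 1)) K ⊆ Ω) : IsTestFunction Ω (mollify m φ) :=
  ⟨mollify_contDiff m hφ.locallyIntegrable, mollify_hasCompactSupport m hφc,
    (tsupport_mollify_subset m hK).trans hm⟩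

lemma partialDeriv_mollify (m : ℕ) {φ : EuclideanSpace ℝ ι → F} (hφ : ContDiff ℝ ∞ φ)
    (hφc : HasCompactSupport φ) (c : ι) :
    partialDeriv c (mollify m φ) = mollify m (partialDeriv c φ) := by
  ext x
  have h1 : ContDiff ℝ 1 φ := hφ.of_le (by simp)
  have hl : LocallyIntegrable (mollKernel ι m) := (mollKernel_continuous m).locallyIntegrable
  have := (hφc.hasFDerivAt_convolution_right (ContinuousLinearMap.lsmul ℝ ℝ) hl h1 x).fderiv
  rw [partialDeriv, mollify, this, convolution_precompR_apply _ hl (hφc.fderiv ℝ)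
    (h1.continuous_fderiv one_ne_zero)]
  rfl

lemma partialDeriv_mollify_eq_integral (m : ℕ) {f : EuclideanSpace ℝ ι → ℝ}
    (hf : LocallyIntegrable f) (c : ι) (x : EuclideanSpace ℝ ι) :
    partialDeriv c (mollify m f) x = ∫ t, partialDeriv c (mollKernel ι m) (x - t) * f t := by
  have h1 : ContDiff ℝ 1 (mollKernel ι m) := (mollKernel_contDiff m).of_le (by simp)
  have hl : LocallyIntegrable (mollKernel ι m) := (mollKernel_continuous m).locallyIntegrable
  have hc := mollKernel_hasCompactSupport (ι := ι) m
  have := (hc.hasFDerivAt_convolution_right (ContinuousLinearMap.lsmul ℝ ℝ).flip hf h1 x).fderiv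
  rw [convolution_flip] at this
  rw [partialDeriv, mollify, this, convolution_precompR_apply _ hf (hc.fderiv ℝ)
    (h1.continuous_fderiv one_ne_zero)]
  rfl

/-- `g` is the weak partial derivative `∂_c u` on `Ω`. -/
def IsWeakPartial (Ω : Set (EuclideanSpace ℝ ι)) (c : ι) (u g : EuclideanSpace ℝ ι → ℝ) : Prop :=
  ∀ φ : EuclideanSpace ℝ ι → ℝ, IsTestFunction Ω φ →
    ∫ x in Ω, u x * partialDeriv c φ x = -∫ x in Ω, g x * φ x

/-- As soon as the closed ball fits into Ω, the reflected kernel t ↦ ρ (x - t) is an admissible test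
function. The sign from the reflection cancels the one in the definition of the weak derivative. -/
lemma partialDeriv_mollify_of_weak (m : ℕ) {Ω : Set (EuclideanSpace ℝ ι)} (hΩ : MeasurableSet Ω)
    {u g : EuclideanSpace ℝ ι → ℝ} (hu : IntegrableOn u Ω) {c : ι} (hg : IsWeakPartial Ω c u g)
    {x : EuclideanSpace ℝ ι} (hx : Metric.closedBall x (1 / ((m : ℝ) + 1)) ⊆ Ω) :
    partialDeriv c (mollify m (Ω.indicator u)) x = mollify m (Ω.indicator g) x := by
  have hK := mollKernel_contDiff (ι := ι) m
  set φ : EuclideanSpace ℝ ι → ℝ := fun t => mollKernel ι m (x - t) with hφ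
  have hsub : ∀ t, HasFDerivAt (fun t : EuclideanSpace ℝ ι => x - t)
      (-ContinuousLinearMap.id ℝ (EuclideanSpace ℝ ι)) t := fun t => (hasFDerivAt_id t).const_sub x
  have hderiv : ∀ t, _root_.partialDeriv c φ t = - _root_.partialDeriv c (mollKernel ι m) (x - t) := by
    intro t
    have := ((hK.differentiable (by simp)) (x - t)).hasFDerivAt.comp t (hsub t)
    rw [_root_.partialDeriv, show fderiv ℝ φ t = _ from this.fderiv]
    simp [_root_.partialDeriv]
  have hts : tsupport φ ⊆ Metric.closedBall x (1 / ((m : ℝ) + 1)) := by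
    refine closure_minimal (fun t ht => ?_) Metric.isClosed_closedBall
    by_contra h
    refine ht (mollKernel_eq_zero ?_)
    rw [Metric.mem_closedBall, dist_comm, dist_eq_norm, not_le] at h
    exact h.le
  have hφt : IsTestFunction Ω φ :=
    ⟨hK.comp (contDiff_const.sub contDiff_id),
      (isCompact_closedBall x _).of_isClosed_subset (isClosed_tsupport _) hts, hts.trans hx⟩
  have e := hg φ hφt
  rw [partialDeriv_mollify_eq_integral m ((integrable_indicator_iff hΩ).2 hu).locallyIntegrable,
    mollify_apply_swap]
  have e1 : ∀ t, _root_.partialDeriv c (mollKernel ι m) (x - t) * Ω.indicator u t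
      = Ω.indicator (fun t => -(u t * _root_.partialDeriv c φ t)) t := by
    intro t
    by_cases ht : t ∈ Ω
    · simp only [indicator_of_mem ht, hderiv]; ring
    · simp [indicator_of_notMem ht]
  have e2 : ∀ t, mollKernel ι m (x - t) • Ω.indicator g t
      = Ω.indicator (fun t => g t * φ t) t := by
    intro t
    by_cases ht : t ∈ Ω
    · simp only [indicator_of_mem ht, hφ, smul_eq_mul]; ring
    · simp [indicator_of_notMem ht]
  simp_rw [e1, e2]
  rw [integral_indicator hΩ, integral_indicator hΩ, integral_neg, e, neg_neg]

/-- Fubini and evenness of the kernel: mollification is self-adjoint. This moves the mollification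
from u onto the test field in the duality estimate. -/
lemma integral_mollify_mul (m : ℕ) {f h : EuclideanSpace ℝ ι → ℝ} (hf : Integrable f)
    (hh : Continuous h) (hhc : HasCompactSupport h) :
    ∫ x, mollify m f x * h x = ∫ x, f x * mollify m h x := by
  obtain ⟨C, hC⟩ := (mollKernel_hasCompactSupport (ι := ι) m).exists_bound_of_continuous
    (mollKernel_continuous m)
  have hint : Integrable (Function.uncurry fun x t => mollKernel ι m (x - t) * (h x * f t))
      (volume.prod volume) := by
    refine Integrable.bdd_mul (c := C)
      ((hh.integrable_of_hasCompactSupport hhc).mul_prod hf) ?_ (ae_of_all _ fun z => hC _)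
    exact ((mollKernel_continuous m).comp (continuous_fst.sub continuous_snd)).aestronglyMeasurable
  calc ∫ x, mollify m f x * h x
      = ∫ x, ∫ t, mollKernel ι m (x - t) * (h x * f t) := by
        congr 1; ext x
        rw [mollify_apply_swap, ← integral_mul_const]
        congr 1; ext t
        simp only [smul_eq_mul]; ring
    _ = ∫ t, ∫ x, mollKernel ι m (x - t) * (h x * f t) := integral_integral_swap hint
    _ = ∫ x, f x * mollify m h x := by
        congr 1; ext t
        rw [mollify_apply_swap, ← integral_const_mul]
        congr 1; ext x
        rw [mollKernel_sub_comm, smul_eq_mul]; ring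

lemma mollify_eval {κ : Type} [Fintype κ] (m : ℕ) {φ : EuclideanSpace ℝ ι → EuclideanSpace ℝ κ}
    (hφ : LocallyIntegrable φ) (j : κ) (x : EuclideanSpace ℝ ι) :
    mollify m φ x j = mollify m (fun y => φ y j) x := by
  rw [mollify_apply, mollify_apply]
  have := (EuclideanSpace.proj (𝕜 := ℝ) j).integral_comp_comm (mollify_integrable_kernel m hφ x)
  simpa using this.symm

lemma partialDeriv_eval {κ : Type} [Fintype κ] {φ : EuclideanSpace ℝ ι → EuclideanSpace ℝ κ}
    {x : EuclideanSpace ℝ ι} (hφ : DifferentiableAt ℝ φ x) (c : ι) (j : κ) :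
    partialDeriv c φ x j = partialDeriv c (fun y => φ y j) x := by
  have := ((EuclideanSpace.proj j : EuclideanSpace ℝ κ →L[ℝ] ℝ).hasFDerivAt.comp x hφ.hasFDerivAt).fderiv
  rw [partialDeriv, partialDeriv, show fderiv ℝ (fun y => φ y j) x = _ from this]
  simp

end MollifyDeriv

/-! ### The partial divergence of test fields. -/

section BlockDiv

variable {k : ℕ} {n : Fin k → ℕ}

lemma blockDiv_mollify (m : ℕ) {i : Fin k} {φ : Space n → Block n i} (hφ : ContDiff ℝ ∞ φ)
    (hφc : HasCompactSupport φ) : blockDiv i (mollify m φ) = mollify m (blockDiv i φ) := by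
  ext x
  have hc : ∀ j : Fin (n i), Continuous (partialDeriv (⟨i, j⟩ : Σ i, Fin (n i)) φ) := fun j =>
    (contDiff_partialDeriv hφ _).continuous
  have hcj : ∀ j : Fin (n i), Continuous fun y => partialDeriv (⟨i, j⟩ : Σ i, Fin (n i)) φ y j :=
    fun j => (EuclideanSpace.proj j : Block n i →L[ℝ] ℝ).continuous.comp (hc j)
  have e : ∀ j : Fin (n i), partialDeriv (⟨i, j⟩ : Σ i, Fin (n i)) (mollify m φ) x j
      = mollify m (fun y => partialDeriv (⟨i, j⟩ : Σ i, Fin (n i)) φ y j) x := fun j => by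
    rw [partialDeriv_mollify m hφ hφc, mollify_eval m (hc j).locallyIntegrable]
  simp only [blockDiv, e]
  rw [mollify_apply]
  simp only [mollify_apply, blockDiv, Finset.smul_sum]
  exact (integral_finsetSum _ fun j _ =>
    mollify_integrable_kernel m (hcj j).locallyIntegrable x).symm

lemma IsTestFunction.blockDiv {Ω : Set (Space n)} {i : Fin k} {φ : Space n → Block n i}
    (h : IsTestFunction Ω φ) : IsTestFunction Ω (blockDiv i φ) := by
  have hs : ∀ x, x ∉ tsupport φ → _root_.blockDiv i φ x = 0 := fun x hx => by
    refine Finset.sum_eq_zero fun j _ => ?_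
    rw [image_eq_zero_of_notMem_tsupport
      (fun h' => hx (tsupport_partialDeriv_subset φ ⟨i, j⟩ h'))]
    rfl
  have hts : tsupport (_root_.blockDiv i φ) ⊆ tsupport φ :=
    closure_minimal (fun x hx => by_contra fun h' => hx (hs x h')) (isClosed_tsupport _)
  refine ⟨ContDiff.sum fun j _ => ?_, h.2.isCompact.of_isClosed_subset (isClosed_tsupport _) hts,
    hts.trans h.3⟩
  exact (EuclideanSpace.proj j : Block n i →L[ℝ] ℝ).contDiff.comp
    (contDiff_partialDeriv h.1 _)

lemma blockDiv_sum {i : Fin k} {α : Type*} (s : Finset α) {φ : α → Space n → Block n i}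
    (hφ : ∀ a ∈ s, Differentiable ℝ (φ a)) (x : Space n) :
    blockDiv i (fun x => ∑ a ∈ s, φ a x) x = ∑ a ∈ s, blockDiv i (φ a) x := by
  simp only [blockDiv, partialDeriv]
  rw [Finset.sum_comm]
  refine Finset.sum_congr rfl fun j _ => ?_
  rw [fderiv_fun_sum fun a ha => hφ a ha x]
  simp

lemma blockDiv_const_smul {i : Fin k} {φ : Space n → Block n i} (hφ : Differentiable ℝ φ)
    (r : ℝ) (x : Space n) : blockDiv i (fun x => r • φ x) x = r * blockDiv i φ x := by
  simp only [blockDiv, partialDeriv, Finset.mul_sum]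
  refine Finset.sum_congr rfl fun j _ => ?_
  rw [fderiv_fun_const_smul (hφ x)]
  simp

end BlockDiv

/-! ### Integration by parts for functions that are smooth on Ω only. -/

section IntegrationByParts

variable {ι : Type} [Fintype ι] [DecidableEq ι] {F : Type*} [NormedAddCommGroup F] [NormedSpace ℝ F]

lemma ContinuousOn.continuous_smul_of_tsupport_subset {X : Type*} [TopologicalSpace X]
    {Ω : Set X} (hΩ : IsOpen Ω) {f : X → ℝ} {g : X → F}
    (hf : ContinuousOn f Ω) (hg : Continuous g) (hgΩ : tsupport g ⊆ Ω) :
    Continuous fun x => f x • g x := by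
  refine continuous_iff_continuousAt.2 fun x => ?_
  by_cases hx : x ∈ Ω
  · exact (hf.continuousAt (hΩ.mem_nhds hx)).smul hg.continuousAt
  · have h0 : (fun x => f x • g x) =ᶠ[𝓝 x] fun _ => 0 := by
      filter_upwards [notMem_tsupport_iff_eventuallyEq.1 fun h => hx (hgΩ h)] with y hy
      simp [hy]
    exact continuousAt_const.congr h0.symm

lemma ContinuousOn.integrable_mul_of_tsupport_subset {Ω : Set (EuclideanSpace ℝ ι)} (hΩ : IsOpen Ω)
    {f g : EuclideanSpace ℝ ι → ℝ} (hf : ContinuousOn f Ω) (hg : Continuous g)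
    (hgc : HasCompactSupport g) (hgΩ : tsupport g ⊆ Ω) :
    Integrable fun x => f x * g x :=
  (hf.continuous_smul_of_tsupport_subset hΩ hg hgΩ).integrable_of_hasCompactSupport hgc.mul_left

lemma contDiffOn_partialDeriv {Ω : Set (EuclideanSpace ℝ ι)} (hΩ : IsOpen Ω)
    {v : EuclideanSpace ℝ ι → F} (hv : ContDiffOn ℝ ∞ v Ω) (c : ι) :
    ContDiffOn ℝ ∞ (partialDeriv c v) Ω :=
  (hv.fderiv_of_isOpen hΩ (m := ∞) (by simp)).clm_apply contDiffOn_const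

lemma integral_mul_partialDeriv_of_contDiffOn {Ω : Set (EuclideanSpace ℝ ι)} (hΩ : IsOpen Ω)
    {v φ : EuclideanSpace ℝ ι → ℝ} (hv : ContDiffOn ℝ ∞ v Ω) (hφ : IsTestFunction Ω φ) (c : ι) :
    ∫ x in Ω, v x * partialDeriv c φ x = -∫ x in Ω, partialDeriv c v x * φ x := by
  have hφ' := hφ.partialDeriv c
  have hvc := (contDiffOn_partialDeriv hΩ hv c).continuousOn
  have h1 : ∀ x ∉ Ω, v x * partialDeriv c φ x = 0 := fun x hx => by simp [hφ'.eq_zero hx]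
  have h2 : ∀ x ∉ Ω, partialDeriv c v x * φ x = 0 := fun x hx => by simp [hφ.eq_zero hx]
  rw [setIntegral_eq_integral_of_forall_compl_eq_zero h1,
    setIntegral_eq_integral_of_forall_compl_eq_zero h2]
  refine integral_mul_fderiv_eq_neg_fderiv_mul_of_integrable ?_ ?_ ?_ ?_ ?_
  · exact hvc.integrable_mul_of_tsupport_subset hΩ hφ.continuous hφ.2 hφ.3
  · exact hv.continuousOn.integrable_mul_of_tsupport_subset hΩ hφ'.continuous hφ'.2 hφ'.3
  · exact hv.continuousOn.integrable_mul_of_tsupport_subset hΩ hφ.continuous hφ.2 hφ.3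
  · exact fun x hx => (hv.contDiffAt (hΩ.mem_nhds (hφ.3 hx))).differentiableAt (by simp)
  · exact fun x _ => hφ.1.differentiable (by simp) x

end IntegrationByParts

/-! ### The partial variation: semicontinuity, finiteness, and the duality estimate for
mollifications. -/

section Variation

variable {k : ℕ} {n : Fin k → ℕ} {Ω : Set (Space n)} {i : Fin k}

lemma IsTestFunction.eval {φ : Space n → Block n i} (h : IsTestFunction Ω φ) (j : Fin (n i)) :
    IsTestFunction Ω fun x => φ x j :=
  ⟨(EuclideanSpace.proj j : Block n i →L[ℝ] ℝ).contDiff.comp h.1,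
    h.2.comp_left (g := (EuclideanSpace.proj j : Block n i →L[ℝ] ℝ)) (map_zero _),
    (tsupport_comp_subset (g := (EuclideanSpace.proj j : Block n i →L[ℝ] ℝ)) (map_zero _) φ).trans
      h.3⟩

lemma contDiffOn_blockGrad (hΩ : IsOpen Ω) {v : Space n → ℝ} (hv : ContDiffOn ℝ ∞ v Ω) :
    ContDiffOn ℝ ∞ (blockGrad i v) Ω :=
  contDiffOn_euclidean.2 fun _ => contDiffOn_partialDeriv hΩ hv _

lemma inner_blockGrad (v : Space n → ℝ) (x : Space n) (y : Block n i) :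
    inner ℝ (blockGrad i v x) y = ∑ j, partialDeriv (⟨i, j⟩ : Σ i, Fin (n i)) v x * y j := by
  simp [PiLp.inner_apply, blockGrad, mul_comm]

lemma integral_mul_blockDiv_of_contDiffOn (hΩ : IsOpen Ω) {v : Space n → ℝ}
    (hv : ContDiffOn ℝ ∞ v Ω) {φ : Space n → Block n i} (hφ : IsTestFunction Ω φ) :
    ∫ x in Ω, v x * blockDiv i φ x = -∫ x in Ω, inner ℝ (blockGrad i v x) (φ x) := by
  have e : ∀ x (j : Fin (n i)), partialDeriv (⟨i, j⟩ : Σ i, Fin (n i)) φ x j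
      = partialDeriv (⟨i, j⟩ : Σ i, Fin (n i)) (fun y => φ y j) x :=
    fun x j => partialDeriv_eval (hφ.1.differentiable (by simp) x) _ _
  simp only [blockDiv, e, inner_blockGrad, Finset.mul_sum]
  rw [integral_finsetSum, integral_finsetSum, ← Finset.sum_neg_distrib]
  · exact Finset.sum_congr rfl fun j _ =>
      integral_mul_partialDeriv_of_contDiffOn hΩ hv (hφ.eval j) _
  · exact fun j _ => ((contDiffOn_partialDeriv hΩ hv _).continuousOn.integrable_mul_of_tsupport_subset
      hΩ (hφ.eval j).continuous (hφ.eval j).2 (hφ.eval j).3).integrableOn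
  · intro j _
    have h := (hφ.eval j).partialDeriv (⟨i, j⟩ : Σ i, Fin (n i))
    exact (hv.continuousOn.integrable_mul_of_tsupport_subset hΩ h.continuous h.2 h.3).integrableOn

lemma ofReal_integral_mul_blockDiv_le {u : Space n → ℝ} {φ : Space n → Block n i}
    (hφ : IsTestFunction Ω φ) {C : ℝ} (hC : 0 < C) (hφC : ∀ x ∈ Ω, ‖φ x‖ ≤ C) :
    ENNReal.ofReal (∫ x in Ω, u x * blockDiv i φ x) ≤ ENNReal.ofReal C * blockVariation Ω i u := by
  have hd := hφ.1.differentiable (by simp)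
  have h1 : IsTestFunction Ω fun x => C⁻¹ • φ x :=
    ⟨hφ.1.const_smul _, hφ.2.smul_left (f := fun _ => C⁻¹),
      (tsupport_smul_subset_right (fun _ => C⁻¹) φ).trans hφ.3⟩
  have h2 : ∀ x ∈ Ω, ‖C⁻¹ • φ x‖ ≤ 1 := fun x hx => by
    rw [norm_smul, norm_inv, Real.norm_of_nonneg hC.le, inv_mul_le_iff₀ hC, mul_one]
    exact hφC x hx
  have h3 : ENNReal.ofReal (∫ x in Ω, u x * blockDiv i (fun x => C⁻¹ • φ x) x)
      ≤ blockVariation Ω i u :=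
    le_iSup_of_le _ (le_iSup_of_le h1 (le_iSup_of_le h2 le_rfl))
  have h4 : ∫ x in Ω, u x * blockDiv i φ x
      = C * ∫ x in Ω, u x * blockDiv i (fun x => C⁻¹ • φ x) x := by
    rw [← integral_const_mul]
    congr 1; ext x
    rw [blockDiv_const_smul hd]; field_simp
  rw [h4, ENNReal.ofReal_mul hC.le]
  gcongr

lemma blockVariation_le_lintegral (hΩ : IsOpen Ω) {v : Space n → ℝ} (hv : ContDiffOn ℝ ∞ v Ω) :
    blockVariation Ω i v ≤ ∫⁻ x in Ω, ‖blockGrad i v x‖ₑ := by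
  refine iSup_le fun φ => iSup_le fun hφ => iSup_le fun h1 => ?_
  rw [integral_mul_blockDiv_of_contDiffOn hΩ hv hφ]
  refine (ENNReal.ofReal_le_ofReal (le_abs_self _)).trans ?_
  rw [abs_neg, ← Real.norm_eq_abs, ofReal_norm]
  refine (enorm_integral_le_lintegral_enorm _).trans (setLIntegral_mono' hΩ.measurableSet ?_)
  intro x hx
  rw [← ofReal_norm, ← ofReal_norm]
  refine ENNReal.ofReal_le_ofReal ((norm_inner_le_norm _ _).trans ?_)
  exact mul_le_of_le_one_right (norm_nonneg _) (h1 x hx)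

/-- A supremum of functionals that are continuous for L¹ convergence is lower semicontinuous; here
they are integrals against bounded functions. -/
lemma blockVariation_le_liminf {u : Space n → ℝ} {v : ℕ → Space n → ℝ} (hu : IntegrableOn u Ω)
    (hv : ∀ m, IntegrableOn (v m) Ω)
    (h : Tendsto (fun m => eLpNorm (v m - u) 1 (volume.restrict Ω)) atTop (𝓝 0)) :
    blockVariation Ω i u ≤ liminf (fun m => blockVariation Ω i (v m)) atTop := by
  refine iSup_le fun φ => iSup_le fun hφ => iSup_le fun h1 => ?_
  have hd := hφ.blockDiv
  obtain ⟨C, hC⟩ := hd.2.exists_bound_of_continuous hd.continuous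
  have hm : AEStronglyMeasurable (blockDiv i φ) (volume.restrict Ω) :=
    hd.continuous.aestronglyMeasurable
  have hlim : Tendsto (fun m => ∫ x in Ω, v m x * blockDiv i φ x) atTop
      (𝓝 (∫ x in Ω, u x * blockDiv i φ x)) := by
    refine tendsto_integral_of_L1 _ (hu.mul_bdd hm (ae_of_all _ hC)).aestronglyMeasurable
      (Eventually.of_forall fun m => (hv m).mul_bdd hm (ae_of_all _ hC)) ?_
    have h' := ENNReal.Tendsto.const_mul (a := ENNReal.ofReal C) h (Or.inr ENNReal.ofReal_ne_top)
    rw [mul_zero] at h'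
    refine tendsto_of_tendsto_of_tendsto_of_le_of_le tendsto_const_nhds h' (fun _ => zero_le)
      fun m => ?_
    simp only [eLpNorm_one_eq_lintegral_enorm]
    rw [← lintegral_const_mul' _ _ ENNReal.ofReal_ne_top]
    refine lintegral_mono fun x => ?_
    rw [← sub_mul, enorm_mul, mul_comm, Pi.sub_apply]
    gcongr
    rw [← ofReal_norm]
    exact ENNReal.ofReal_le_ofReal (hC x)
  rw [← ((ENNReal.continuous_ofReal.tendsto _).comp hlim).liminf_eq]
  exact liminf_le_liminf (Eventually.of_forall fun m =>
    le_iSup_of_le φ (le_iSup_of_le hφ (le_iSup_of_le h1 le_rfl)))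

/-- The field of full dimension whose `i`-th block is `φ` and whose other blocks vanish. -/
def extendBlock (i : Fin k) : Block n i →L[ℝ] Space n :=
  ∑ j, (EuclideanSpace.proj j : Block n i →L[ℝ] ℝ).smulRight
    (EuclideanSpace.single (⟨i, j⟩ : Σ i, Fin (n i)) (1 : ℝ))

lemma extendBlock_apply_same (y : Block n i) (j : Fin (n i)) :
    extendBlock i y ⟨i, j⟩ = y j := by
  simp [extendBlock, Finset.sum_apply, Pi.single_apply]

lemma extendBlock_apply_ne (y : Block n i) {i' : Fin k} (h : i' ≠ i) (j : Fin (n i')) :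
    extendBlock i y ⟨i', j⟩ = 0 := by
  have : ∀ j' : Fin (n i), (⟨i', j⟩ : Σ i, Fin (n i)) ≠ ⟨i, j'⟩ := fun j' h' => h (by
    simpa using congrArg Sigma.fst h')
  simp [extendBlock, Finset.sum_apply, this]

lemma norm_extendBlock (y : Block n i) : ‖extendBlock i y‖ = ‖y‖ := by
  rw [EuclideanSpace.norm_eq, EuclideanSpace.norm_eq, Fintype.sum_sigma,
    Finset.sum_eq_single i (fun i' _ h => by simp [extendBlock_apply_ne y h]) (by simp)]
  simp [extendBlock_apply_same]

/-- A field in one block, padded with zeros, is admissible in the definition of BV with the same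
norm and divergence. The total mass of D then bounds all the competitors. -/
lemma blockVariation_ne_top_of_memBV {u : Space n → ℝ} (hu : MemBV Ω u) :
    blockVariation Ω i u ≠ ⊤ := by
  obtain ⟨-, D, hD, h⟩ := hu
  refine ne_top_of_le_ne_top (b := ENNReal.ofReal (1 * ‖innerSL ℝ (E := Space n)‖ *
    D.variation.real univ)) ENNReal.ofReal_ne_top ?_
  refine iSup_le fun φ => iSup_le fun hφ => iSup_le fun h1 => ENNReal.ofReal_le_ofReal ?_
  have ht : IsTestFunction Ω fun x => extendBlock i (φ x) :=
    ⟨(extendBlock i).contDiff.comp hφ.1, hφ.2.comp_left (map_zero _),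
      (tsupport_comp_subset (map_zero (extendBlock (n := n) i)) φ).trans hφ.3⟩
  have hd : ∀ x, divergence (fun x => extendBlock i (φ x)) x = blockDiv i φ x := by
    intro x
    have hf : ∀ c, partialDeriv c (fun x => extendBlock i (φ x)) x
        = extendBlock i (partialDeriv c φ x) := by
      intro c
      have := (((extendBlock (n := n) i).hasFDerivAt.comp x
        (hφ.1.differentiable (by simp) x).hasFDerivAt)).fderiv
      rw [partialDeriv, show fderiv ℝ (fun x => extendBlock i (φ x)) x = _ from this]
      rfl
    simp only [divergence, hf]
    rw [Fintype.sum_sigma, Finset.sum_eq_single i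
      (fun i' _ h => by simp [extendBlock_apply_ne _ h]) (by simp)]
    simp [extendBlock_apply_same, blockDiv]
  have e := h _ ht
  simp only [hd] at e
  rw [e]
  refine (neg_le_abs _).trans ?_
  rw [← Real.norm_eq_abs]
  refine VectorMeasure.norm_integral_le_of_norm_le_const (ae_of_all _ fun x => ?_)
  rw [norm_extendBlock]
  by_cases hx : x ∈ Ω
  · exact h1 x hx
  · simp [hφ.eq_zero hx]

/-- Replacing the singular field ∇w/|∇w| by the smooth ∇w/√(κ² + |∇w|²) loses at most κ in the
pairing with ∇w. -/
lemma sq_div_sqrt_ge {κ t : ℝ} (hκ : 0 < κ) (ht : 0 ≤ t) : t - κ ≤ t ^ 2 / √(κ ^ 2 + t ^ 2) := by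
  have hs : 0 < √(κ ^ 2 + t ^ 2) := by positivity
  have h2 : √(κ ^ 2 + t ^ 2) ≤ κ + t := by
    rw [Real.sqrt_le_left (by positivity)]; nlinarith
  rw [le_div_iff₀ hs]
  rcases le_total t κ with h | h
  · nlinarith
  · nlinarith

/-- The weighted gradients of mollifications of `u` are controlled by the variation of `u`. -/
lemma sum_lintegral_blockGrad_mollify_le (hΩ : IsOpen Ω) {u : Space n → ℝ} (hu : IntegrableOn u Ω)
    {α : Type*} (s : Finset α) (m : α → ℕ) (ψ : α → Space n → ℝ) (hψ0 : ∀ a x, 0 ≤ ψ a x)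
    (hψ : ∀ a ∈ s, IsTestFunction Ω (ψ a))
    (hm : ∀ a ∈ s, Metric.cthickening (1 / ((m a : ℝ) + 1)) (tsupport (ψ a)) ⊆ Ω)
    {C : ℝ} (hC : 0 < C) (hsum : ∀ x, ∑ a ∈ s, mollify (m a) (ψ a) x ≤ C) :
    ∑ a ∈ s, ∫⁻ x, ENNReal.ofReal (ψ a x) * ‖blockGrad i (mollify (m a) (Ω.indicator u)) x‖ₑ
      ≤ ENNReal.ofReal C * blockVariation Ω i u := by
  have hui : Integrable (Ω.indicator u) := (integrable_indicator_iff hΩ.measurableSet).2 hu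
  set w : α → Space n → ℝ := fun a => mollify (m a) (Ω.indicator u) with hw
  have hwd : ∀ a, ContDiff ℝ ∞ (w a) := fun a => mollify_contDiff _ hui.locallyIntegrable
  have hG : ∀ a, ContDiff ℝ ∞ (blockGrad i (w a)) := fun a =>
    contDiff_euclidean.2 fun _ => contDiff_partialDeriv (hwd a) _
  have hint : ∀ a ∈ s, Integrable fun x => ψ a x * ‖blockGrad i (w a) x‖ := fun a ha =>
    ((hψ a ha).continuous.mul (hG a).continuous.norm).integrable_of_hasCompactSupport
      (hψ a ha).2.mul_right
  have hψi : ∀ a ∈ s, Integrable (ψ a) := fun a ha =>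
    (hψ a ha).continuous.integrable_of_hasCompactSupport (hψ a ha).2
  have e1 : ∀ a ∈ s, ∫⁻ x, ENNReal.ofReal (ψ a x) * ‖blockGrad i (w a) x‖ₑ
      = ENNReal.ofReal (∫ x, ψ a x * ‖blockGrad i (w a) x‖) := by
    intro a ha
    rw [ofReal_integral_eq_lintegral_ofReal (hint a ha)
      (ae_of_all _ fun x => mul_nonneg (hψ0 a x) (norm_nonneg _))]
    congr 1; ext x
    rw [ENNReal.ofReal_mul (hψ0 a x), ofReal_norm]
  rw [Finset.sum_congr rfl e1, ← ENNReal.ofReal_sum_of_nonneg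
    fun a _ => integral_nonneg fun x => mul_nonneg (hψ0 a x) (norm_nonneg _)]
  refine ENNReal.le_of_forall_pos_le_add fun ε hε _ => ?_
  -- The regularisation costs κ Σ ∫ ψ_a altogether; the 1 in the denominator of the witness avoids
  -- division by zero.
  obtain ⟨κ, hκ0, hκ⟩ : ∃ κ : ℝ, 0 < κ ∧ κ * ∑ a ∈ s, ∫ x, ψ a x ≤ ε := by
    refine ⟨ε / (1 + ∑ a ∈ s, ∫ x, ψ a x), ?_, ?_⟩
    all_goals have h0 : 0 ≤ ∑ a ∈ s, ∫ x, ψ a x :=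
        Finset.sum_nonneg fun a _ => integral_nonneg (hψ0 a)
    · have : (0 : ℝ) < ε := hε
      positivity
    · rw [div_mul_eq_mul_div, div_le_iff₀ (by positivity)]
      nlinarith [ε.2]
  -- A smooth version of −ψ_a / |∇w_a|. The minus sign compensates for integration by parts.
  set c : α → Space n → ℝ := fun a x => -(ψ a x / √(κ ^ 2 + ‖blockGrad i (w a) x‖ ^ 2)) with hc
  set φ : α → Space n → Block n i := fun a x => c a x • blockGrad i (w a) x with hφ
  have hpos : ∀ a x, 0 < κ ^ 2 + ‖blockGrad i (w a) x‖ ^ 2 := fun a x => by positivity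
  have hφt : ∀ a ∈ s, IsTestFunction (tsupport (ψ a)) (φ a) := by
    intro a ha
    have hcs : ∀ x ∉ tsupport (ψ a), φ a x = 0 := fun x hx => by
      simp [hφ, hc, image_eq_zero_of_notMem_tsupport hx]
    have hts : tsupport (φ a) ⊆ tsupport (ψ a) :=
      closure_minimal (fun x hx => by_contra fun h' => hx (hcs x h')) (isClosed_tsupport _)
    refine ⟨?_, (hψ a ha).2.isCompact.of_isClosed_subset (isClosed_tsupport _) hts, hts⟩
    refine ContDiff.smul (ContDiff.neg (ContDiff.div (hψ a ha).1 ?_ fun x =>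
      (Real.sqrt_pos.2 (hpos a x)).ne')) (hG a)
    exact (contDiff_const.add ((hG a).norm_sq ℝ)).sqrt fun x => (hpos a x).ne'
  have hφn : ∀ a x, ‖φ a x‖ ≤ ψ a x := by
    intro a x
    have hs := Real.sqrt_pos.2 (hpos a x)
    rw [hφ, norm_smul, hc, norm_neg, Real.norm_of_nonneg (div_nonneg (hψ0 a x) hs.le),
      div_mul_eq_mul_div, div_le_iff₀ hs]
    exact mul_le_mul_of_nonneg_left (Real.le_sqrt_of_sq_le (by nlinarith)) (hψ0 a x)
  have hMt : ∀ a ∈ s, IsTestFunction Ω (mollify (m a) (φ a)) := fun a ha =>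
    IsTestFunction.mollify (hφt a ha).continuous (hφt a ha).2
      ((subset_tsupport _).trans (hφt a ha).3) (hm a ha)
  -- One single test field for u: pairing u with div Φ equals the sum of the pairings of the
  -- mollified w_a with div φ_a, and |Φ| ≤ Σ ρ_a * ψ_a ≤ C.
  set Φ : Space n → Block n i := fun x => ∑ a ∈ s, mollify (m a) (φ a) x with hΦ
  have hΦt : IsTestFunction Ω Φ := by
    have hK : IsCompact (⋃ a ∈ s, tsupport (mollify (m a) (φ a))) :=
      s.isCompact_biUnion fun a ha => (hMt a ha).2
    have hts : tsupport Φ ⊆ ⋃ a ∈ s, tsupport (mollify (m a) (φ a)) := by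
      refine closure_minimal (fun x hx => ?_) hK.isClosed
      obtain ⟨a, ha, h0⟩ := Finset.exists_ne_zero_of_sum_ne_zero (show ∑ a ∈ s, _ ≠ _ from hx)
      exact mem_biUnion ha (subset_tsupport _ h0)
    exact ⟨ContDiff.sum fun a ha => (hMt a ha).1, hK.of_isClosed_subset (isClosed_tsupport _) hts,
      hts.trans (iUnion₂_subset fun a ha => (hMt a ha).3)⟩
  have hΦn : ∀ x ∈ Ω, ‖Φ x‖ ≤ C := fun x _ => (norm_sum_le _ _).trans <| le_trans
    (Finset.sum_le_sum fun a ha => norm_mollify_le (m a) (hψi a ha).locallyIntegrable (hφn a) x)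
    (hsum x)
  have key : ∑ a ∈ s, ∫ x, ψ a x * ‖blockGrad i (w a) x‖
      ≤ (∫ x in Ω, u x * blockDiv i Φ x) + ε := by
    have h1 : ∫ x in Ω, u x * blockDiv i Φ x = ∑ a ∈ s, ∫ x, w a x * blockDiv i (φ a) x := by
      have h2 : ∀ x, Ω.indicator (fun x => u x * blockDiv i Φ x) x
          = ∑ a ∈ s, Ω.indicator u x * mollify (m a) (blockDiv i (φ a)) x := by
        intro x
        rw [← Finset.mul_sum]
        by_cases hx : x ∈ Ω
        · simp only [indicator_of_mem hx]
          rw [hΦ, blockDiv_sum s fun a ha => (hMt a ha).1.differentiable (by simp)]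
          congr 1
          refine Finset.sum_congr rfl fun a ha => ?_
          rw [blockDiv_mollify (m a) (hφt a ha).1 (hφt a ha).2]
        · simp [indicator_of_notMem hx]
      rw [← integral_indicator hΩ.measurableSet]
      simp_rw [h2]
      rw [integral_finsetSum]
      · refine Finset.sum_congr rfl fun a ha => ?_
        rw [integral_mollify_mul (m a) hui (hφt a ha).blockDiv.continuous (hφt a ha).blockDiv.2]
      · intro a ha
        have hb := (hφt a ha).blockDiv
        have hcont := (mollify_contDiff (m a) hb.continuous.locallyIntegrable).continuous
        obtain ⟨B, hB⟩ := (mollify_hasCompactSupport (m a) hb.2).exists_bound_of_continuous hcont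
        exact hui.mul_bdd hcont.aestronglyMeasurable (ae_of_all _ hB)
    have h3 : ∀ a ∈ s, ∫ x, w a x * blockDiv i (φ a) x
        = ∫ x, ψ a x * (‖blockGrad i (w a) x‖ ^ 2 / √(κ ^ 2 + ‖blockGrad i (w a) x‖ ^ 2)) := by
      intro a ha
      have := integral_mul_blockDiv_of_contDiffOn isOpen_univ (hwd a).contDiffOn
        ((hφt a ha).mono (subset_univ _))
      rw [Measure.restrict_univ] at this
      rw [this, ← integral_neg]
      congr 1; ext x
      rw [hφ, real_inner_smul_right, real_inner_self_eq_norm_sq, hc]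
      ring
    rw [h1, Finset.sum_congr rfl h3]
    have h4 : ∀ a ∈ s, ∫ x, ψ a x * ‖blockGrad i (w a) x‖
        ≤ (∫ x, ψ a x * (‖blockGrad i (w a) x‖ ^ 2 / √(κ ^ 2 + ‖blockGrad i (w a) x‖ ^ 2)))
          + κ * ∫ x, ψ a x := by
      intro a ha
      have hi2 : Integrable fun x =>
          ψ a x * (‖blockGrad i (w a) x‖ ^ 2 / √(κ ^ 2 + ‖blockGrad i (w a) x‖ ^ 2)) := by
        refine ((hψ a ha).continuous.mul (Continuous.div ((hG a).continuous.norm.pow 2) ?_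
          fun x => (Real.sqrt_pos.2 (hpos a x)).ne')).integrable_of_hasCompactSupport
          (hψ a ha).2.mul_right
        exact (continuous_const.add ((hG a).continuous.norm.pow 2)).sqrt
      rw [← integral_const_mul, ← integral_add hi2 ((hψi a ha).const_mul κ)]
      refine integral_mono (hint a ha) (hi2.add ((hψi a ha).const_mul κ)) fun x => ?_
      have := mul_le_mul_of_nonneg_left
        (sq_div_sqrt_ge hκ0 (norm_nonneg (blockGrad i (w a) x))) (hψ0 a x)
      simp only []
      nlinarith
    refine (Finset.sum_le_sum h4).trans ?_
    rw [Finset.sum_add_distrib, ← Finset.mul_sum]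
    gcongr
  refine (ENNReal.ofReal_le_ofReal key).trans (ENNReal.ofReal_add_le.trans ?_)
  rw [ENNReal.ofReal_coe_nnreal]
  gcongr
  exact ofReal_integral_mul_blockDiv_le hΦt hC hΦn

end Variation

/-! ### Dominated convergence and locally finite sums in L^p. -/

section Lp

variable {α : Type*} [MeasurableSpace α] {μ : Measure α} {F : Type*} [NormedAddCommGroup F]

lemma tendsto_eLpNorm_of_dominated {p : ℝ≥0∞} (hp' : p ≠ ⊤) {f : ℕ → α → F} {h : α → ℝ}
    (hf : ∀ m, AEStronglyMeasurable (f m) μ) (hh : MemLp h p μ)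
    (hfh : ∀ m, ∀ᵐ x ∂μ, ‖f m x‖ ≤ h x) (hlim : ∀ᵐ x ∂μ, Tendsto (fun m => f m x) atTop (𝓝 0)) :
    Tendsto (fun m => eLpNorm (f m) p μ) atTop (𝓝 0) := by
  rcases eq_or_ne p 0 with rfl | hp0
  · simp
  have hpr : 0 < p.toReal := ENNReal.toReal_pos hp0 hp'
  have key : Tendsto (fun m => ∫⁻ x, ‖f m x‖ₑ ^ p.toReal ∂μ) atTop (𝓝 (∫⁻ _, 0 ∂μ)) := by
    refine tendsto_lintegral_of_dominated_convergence' (fun x => ‖h x‖ₑ ^ p.toReal)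
      (fun m => (hf m).enorm.pow_const _) (fun m => ?_) ?_ ?_
    · filter_upwards [hfh m] with x hx
      refine ENNReal.rpow_le_rpow ?_ hpr.le
      rw [← ofReal_norm, ← ofReal_norm]
      exact ENNReal.ofReal_le_ofReal (hx.trans (le_abs_self _))
    · exact (lintegral_rpow_enorm_lt_top_of_eLpNorm_lt_top hp0 hp' hh.2).ne
    · filter_upwards [hlim] with x hx
      have := (ENNReal.continuous_rpow_const (y := p.toReal)).tendsto _ |>.comp hx.enorm
      simpa [hpr, Function.comp_def] using this
  have := (ENNReal.continuous_rpow_const (y := 1 / p.toReal)).tendsto _ |>.comp key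
  simp only [eLpNorm_eq_lintegral_rpow_enorm_toReal hp0 hp']
  simpa [hpr, Function.comp_def] using this

/-- At almost every point min(‖f‖, G_J) is eventually equal to ‖f‖, so Fatou's lemma applies
although the index J depends on the point. -/
lemma eLpNorm_le_of_eventually_norm_le {p C : ℝ≥0∞} {f : α → F} (hf : AEStronglyMeasurable f μ)
    {G : ℕ → α → ℝ} (hG : ∀ J, AEStronglyMeasurable (G J) μ) (hG0 : ∀ J x, 0 ≤ G J x)
    (h : ∀ᵐ x ∂μ, ∀ᶠ J in atTop, ‖f x‖ ≤ G J x) (hC : ∀ J, eLpNorm (G J) p μ ≤ C) :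
    eLpNorm f p μ ≤ C := by
  rw [← eLpNorm_norm]
  refine (Lp.eLpNorm_lim_le_liminf_eLpNorm (f := fun J x => min ‖f x‖ (G J x))
    (fun J => hf.norm.inf (hG J)) _ ?_).trans ?_
  · filter_upwards [h] with x hx
    refine tendsto_const_nhds.congr' ?_
    filter_upwards [hx] with J hJ
    exact (min_eq_left hJ).symm
  · refine (liminf_le_of_le (by isBoundedDefault) fun b hb => ?_)
    obtain ⟨J, hJ⟩ := hb.exists
    refine hJ.trans ((eLpNorm_mono fun x => ?_).trans (hC J))
    rw [Real.norm_of_nonneg (le_min (norm_nonneg _) (hG0 J x)), Real.norm_of_nonneg (hG0 J x)]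
    exact min_le_right _ _

/-- A pointwise bound by locally finite sums gives a bound in `L^p`. -/
lemma eLpNorm_le_tsum_add_tsum {p : ℝ≥0∞} (hp : 1 ≤ p) {f : α → F} (hf : AEStronglyMeasurable f μ)
    {X : ℕ × ℕ → α → ℝ} {W : ℕ → α → ℝ} (hX : ∀ a, AEStronglyMeasurable (X a) μ)
    (hW : ∀ j, AEStronglyMeasurable (W j) μ) {σ : ℕ × ℕ → ℝ≥0∞} {τ : ℕ → ℝ≥0∞}
    (hXσ : ∀ a, eLpNorm (X a) p μ ≤ σ a) (hWτ : ∀ j, eLpNorm (W j) p μ ≤ τ j)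
    (h : ∀ᵐ x ∂μ, ∀ᶠ J in atTop, ‖f x‖ ≤
      ∑ a ∈ Finset.range J ×ˢ Finset.range J, ‖X a x‖ + ∑ j ∈ Finset.range J, ‖W j x‖) :
    eLpNorm f p μ ≤ ∑' a, σ a + ∑' j, τ j := by
  refine eLpNorm_le_of_eventually_norm_le hf (fun J => ?_) (fun J x => by positivity) h fun J => ?_
  · exact (Finset.aestronglyMeasurable_fun_sum _ fun a _ => (hX a).norm).add
      (Finset.aestronglyMeasurable_fun_sum _ fun a _ => (hW a).norm)
  · have h1 : AEStronglyMeasurable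
        (fun x => ∑ a ∈ Finset.range J ×ˢ Finset.range J, ‖X a x‖) μ :=
      Finset.aestronglyMeasurable_fun_sum _ fun a _ => (hX a).norm
    have h2 : AEStronglyMeasurable (fun x => ∑ j ∈ Finset.range J, ‖W j x‖) μ :=
      Finset.aestronglyMeasurable_fun_sum _ fun a _ => (hW a).norm
    refine (eLpNorm_add_le h1 h2 hp).trans (add_le_add ?_ ?_)
    · have := eLpNorm_sum_le (s := Finset.range J ×ˢ Finset.range J) (f := fun a x => ‖X a x‖)
        (fun a _ => (hX a).norm) hp
      rw [Finset.sum_fn] at this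
      refine this.trans (le_trans (Finset.sum_le_sum fun a _ => ?_) (ENNReal.sum_le_tsum _))
      rw [eLpNorm_norm]; exact hXσ a
    · have := eLpNorm_sum_le (s := Finset.range J) (f := fun a x => ‖W a x‖)
        (fun a _ => (hW a).norm) hp
      rw [Finset.sum_fn] at this
      refine this.trans (le_trans (Finset.sum_le_sum fun a _ => ?_) (ENNReal.sum_le_tsum _))
      rw [eLpNorm_norm]; exact hWτ a

end Lp

/-! ### The arctangent truncation. -/

section Truncation

/-- A smooth truncation at height of order `M + 1`. -/
def smoothTrunc (M : ℕ) (s : ℝ) : ℝ := (M + 1) * Real.arctan (s / (M + 1))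

/-- The derivative of `smoothTrunc M`. -/
def smoothTruncDeriv (M : ℕ) (s : ℝ) : ℝ := 1 / (1 + (s / (M + 1)) ^ 2)

lemma hasDerivAt_smoothTrunc (M : ℕ) (s : ℝ) :
    HasDerivAt (smoothTrunc M) (smoothTruncDeriv M s) s := by
  have hM : (M : ℝ) + 1 ≠ 0 := by positivity
  have := (((hasDerivAt_id s).div_const ((M : ℝ) + 1)).arctan).const_mul ((M : ℝ) + 1)
  refine this.congr_deriv ?_
  simp only [smoothTruncDeriv, id]
  field_simp

lemma contDiff_smoothTrunc (M : ℕ) : ContDiff ℝ ∞ (smoothTrunc M) :=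
  contDiff_const.mul (Real.contDiff_arctan.comp (contDiff_id.div_const _))

lemma smoothTruncDeriv_nonneg (M : ℕ) (s : ℝ) : 0 ≤ smoothTruncDeriv M s := by
  unfold smoothTruncDeriv; positivity

lemma smoothTruncDeriv_le_one (M : ℕ) (s : ℝ) : smoothTruncDeriv M s ≤ 1 := by
  unfold smoothTruncDeriv
  rw [div_le_one (by positivity)]
  nlinarith [sq_nonneg (s / ((M : ℝ) + 1))]

lemma continuous_smoothTruncDeriv (M : ℕ) : Continuous (smoothTruncDeriv M) := by
  unfold smoothTruncDeriv
  exact continuous_const.div (by fun_prop) fun s => by positivity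

lemma abs_smoothTrunc_sub_le (M : ℕ) (s t : ℝ) : |smoothTrunc M s - smoothTrunc M t| ≤ |s - t| := by
  have := Convex.norm_image_sub_le_of_norm_hasDerivWithin_le (f := smoothTrunc M) (C := 1)
    (fun x _ => (hasDerivAt_smoothTrunc M x).hasDerivWithinAt)
    (fun x _ => by
      rw [Real.norm_of_nonneg (smoothTruncDeriv_nonneg M x)]; exact smoothTruncDeriv_le_one M x)
    convex_univ (mem_univ t) (mem_univ s)
  simpa using this

lemma smoothTrunc_zero (M : ℕ) : smoothTrunc M 0 = 0 := by simp [smoothTrunc]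

lemma abs_smoothTrunc_le (M : ℕ) (s : ℝ) : |smoothTrunc M s| ≤ |s| := by
  simpa [smoothTrunc_zero] using abs_smoothTrunc_sub_le M s 0

lemma abs_smoothTrunc_sub_self_le (M : ℕ) (s : ℝ) : |smoothTrunc M s - s| ≤ 2 * |s| := by
  have := abs_sub (smoothTrunc M s) s
  have := abs_smoothTrunc_le M s
  linarith

lemma abs_smoothTrunc_le_const (M : ℕ) (s : ℝ) : |smoothTrunc M s| ≤ (M + 1) * 2 := by
  rw [smoothTrunc, abs_mul, abs_of_nonneg (by positivity : (0 : ℝ) ≤ M + 1)]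
  refine mul_le_mul_of_nonneg_left ?_ (by positivity)
  rw [abs_le]
  have h1 := Real.arctan_lt_pi_div_two (s / (M + 1))
  have h2 := Real.neg_pi_div_two_lt_arctan (s / (M + 1))
  have h3 := Real.pi_le_four
  constructor <;> linarith

lemma tendsto_div_add_one (s : ℝ) : Tendsto (fun M : ℕ => s / ((M : ℝ) + 1)) atTop (𝓝 0) := by
  simpa [div_eq_mul_inv] using (tendsto_one_div_add_atTop_nhds_zero_nat (𝕜 := ℝ)).const_mul s

lemma tendsto_smoothTruncDeriv (s : ℝ) :
    Tendsto (fun M => smoothTruncDeriv M s) atTop (𝓝 1) := by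
  have : Tendsto (fun t : ℝ => 1 / (1 + t ^ 2)) (𝓝 0) (𝓝 1) := by
    have h : Continuous fun t : ℝ => 1 / (1 + t ^ 2) :=
      continuous_const.div (by fun_prop) fun t => by positivity
    simpa using h.tendsto 0
  exact this.comp (tendsto_div_add_one s)

lemma tendsto_smoothTrunc (s : ℝ) : Tendsto (fun M => smoothTrunc M s) atTop (𝓝 s) := by
  have hb : ∀ M : ℕ, |smoothTrunc M s - s| ≤ (1 - smoothTruncDeriv M s) * |s| := by
    intro M
    -- The derivative decreases with |x|, so between 0 and s its distance to 1 is largest at s; the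
    -- mean value inequality for θ_M − id then gives the bound.
    have hmono : ∀ x ∈ uIcc 0 s, ‖smoothTruncDeriv M x - 1‖ ≤ 1 - smoothTruncDeriv M s := by
      intro x hx
      rw [Real.norm_eq_abs, abs_sub_comm, abs_of_nonneg (by linarith [smoothTruncDeriv_le_one M x])]
      have hxs : x ^ 2 ≤ s ^ 2 := sq_le_sq.2 (by
        rcases le_total 0 s with h | h
        · rw [uIcc_of_le h] at hx; rw [abs_of_nonneg hx.1, abs_of_nonneg h]; exact hx.2
        · rw [uIcc_of_ge h] at hx; rw [abs_of_nonpos hx.2, abs_of_nonpos h]; linarith [hx.1])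
      have : smoothTruncDeriv M s ≤ smoothTruncDeriv M x := by
        unfold smoothTruncDeriv
        refine one_div_le_one_div_of_le (by positivity) ?_
        rw [div_pow, div_pow]; gcongr
      linarith
    have := Convex.norm_image_sub_le_of_norm_hasDerivWithin_le
      (f := fun x => smoothTrunc M x - x)
      (fun x _ => ((hasDerivAt_smoothTrunc M x).sub (hasDerivAt_id x)).hasDerivWithinAt)
      hmono (convex_uIcc 0 s) left_mem_uIcc right_mem_uIcc
    simpa [smoothTrunc_zero] using this
  have h0 : Tendsto (fun M => (1 - smoothTruncDeriv M s) * |s|) atTop (𝓝 0) := by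
    simpa using ((tendsto_smoothTruncDeriv s).const_sub 1).mul_const |s|
  exact tendsto_iff_norm_sub_tendsto_zero.2 (squeeze_zero (fun _ => norm_nonneg _) hb h0)

end Truncation

/-! ### Partitions of unity from exhaustions by compact sets. -/

section Cutoffs

variable {ι : Type} [Fintype ι] [DecidableEq ι]

/-- Smooth functions which form a locally finite partition of unity of `U` with compact supports,
ordered in such a way that their partial sums are eventually locally equal to `1`. -/
structure IsLayerPartition (U : Set (EuclideanSpace ℝ ι)) (ζ : ℕ → EuclideanSpace ℝ ι → ℝ) :
    Prop where
  test : ∀ j, IsTestFunction U (ζ j)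
  nonneg : ∀ j x, 0 ≤ ζ j x
  le_one : ∀ j x, ζ j x ≤ 1
  sum_eq : ∀ x ∈ U, ∃ J₀, ∀ᶠ y in 𝓝 x, ∀ J ≥ J₀, ∑ j ∈ Finset.range J, ζ j y = 1

lemma exists_contDiff_one_nhds_tsupport_subset {K V : Set (EuclideanSpace ℝ ι)} (hK : IsClosed K)
    (hV : IsOpen V) (hKV : K ⊆ V) : ∃ f : EuclideanSpace ℝ ι → ℝ, ContDiff ℝ ∞ f ∧
      (∀ x ∈ K, f x = 1) ∧ tsupport f ⊆ V ∧ ∀ x, f x ∈ Icc (0 : ℝ) 1 := by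
  obtain ⟨f, h0, h1, h01⟩ := exists_contMDiffMap_zero_one_nhds_of_isClosed (n := ⊤)
    𝓘(ℝ, EuclideanSpace ℝ ι) hV.isClosed_compl hK (disjoint_compl_left_iff_subset.2 hKV)
  refine ⟨f, f.contMDiff.contDiff, fun x hx => ?_, fun x hx => ?_, h01⟩
  · exact h1.self_of_nhdsSet x hx
  · by_contra hxV
    exact notMem_tsupport_iff_eventuallyEq.2 ((eventually_nhdsSet_iff_forall.1 h0) x hxV) hx

/-- Cutoffs f_j along an exhaustion K_j ⊆ V_j ⊆ K_{j+1} have telescoping differences whose partial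
sums are the f_j themselves, and these equal 1 near any given point for all large j. -/
lemma exists_isLayerPartition {U : Set (EuclideanSpace ℝ ι)} (hU : IsOpen U) :
    ∃ ζ : ℕ → EuclideanSpace ℝ ι → ℝ, IsLayerPartition U ζ := by
  -- The extended distance to the complement is ∞ when U is the whole space, so this case needs no
  -- separate treatment.
  set K : ℕ → Set (EuclideanSpace ℝ ι) := fun j =>
    Metric.closedBall 0 j ∩ {x | (((j : ℝ≥0∞) + 1))⁻¹ ≤ Metric.infEDist x Uᶜ} with hK
  set V : ℕ → Set (EuclideanSpace ℝ ι) := fun j =>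
    Metric.ball 0 (j + 1) ∩ {x | (((j : ℝ≥0∞) + 2))⁻¹ < Metric.infEDist x Uᶜ} with hV
  have hKc : ∀ j, IsCompact (K j) := fun j => (isCompact_closedBall _ _).inter_right
    (isClosed_le continuous_const Metric.continuous_infEDist)
  have hVo : ∀ j, IsOpen (V j) := fun j => Metric.isOpen_ball.inter
    (isOpen_lt continuous_const Metric.continuous_infEDist)
  have hKV : ∀ j, K j ⊆ V j := by
    rintro j x ⟨h1, h2⟩
    rw [mem_ofPred_eq] at h2
    refine ⟨Metric.closedBall_subset_ball (by linarith) h1, ?_⟩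
    rw [mem_ofPred_eq]
    refine lt_of_lt_of_le ?_ h2
    rw [ENNReal.inv_lt_inv]
    exact ENNReal.add_lt_add_left (by simp) (by norm_num)
  have hVK : ∀ j, V j ⊆ K (j + 1) := by
    rintro j x ⟨h1, h2⟩
    rw [mem_ofPred_eq] at h2
    refine ⟨by simpa using (Metric.ball_subset_closedBall h1), ?_⟩
    rw [mem_ofPred_eq]
    refine le_trans (le_of_eq ?_) h2.le
    push_cast; rw [add_assoc, one_add_one_eq_two]
  have hKU : ∀ j, K j ⊆ U := by
    rintro j x ⟨-, h2⟩
    by_contra hx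
    rw [mem_ofPred_eq, Metric.infEDist_zero_of_mem (show x ∈ Uᶜ from hx)] at h2
    simp at h2
  have hKmono : Monotone K := monotone_nat_of_le_succ fun j => (hKV j).trans (hVK j)
  have hUV : ∀ x ∈ U, ∃ j, x ∈ V j := by
    intro x hx
    have hpos : 0 < Metric.infEDist x Uᶜ := by
      rw [pos_iff_ne_zero, Ne, ← Metric.mem_iff_infEDist_zero_of_closed hU.isClosed_compl]
      simpa using hx
    obtain ⟨j₁, hj₁⟩ := exists_nat_gt ‖x‖
    obtain ⟨j₂, hj₂⟩ := ENNReal.exists_inv_nat_lt hpos.ne'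
    refine ⟨max j₁ j₂, ?_, ?_⟩
    · rw [mem_ball_zero_iff]
      have : (j₁ : ℝ) ≤ (max j₁ j₂ : ℕ) := by exact_mod_cast le_max_left _ _
      linarith
    · rw [mem_ofPred_eq]
      refine lt_of_le_of_lt ?_ hj₂
      rw [ENNReal.inv_le_inv]
      have : (j₂ : ℝ≥0∞) ≤ (max j₁ j₂ : ℕ) := by exact_mod_cast le_max_right _ _
      exact this.trans le_self_add
  choose f hf1 hf2 hf3 hf4 using fun j =>
    exists_contDiff_one_nhds_tsupport_subset (hKc j).isClosed (hVo j) (hKV j)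
  have hft : ∀ j, IsTestFunction U (f j) := fun j =>
    ⟨hf1 j, (hKc (j + 1)).of_isClosed_subset (isClosed_tsupport _) ((hf3 j).trans (hVK j)),
      (hf3 j).trans ((hVK j).trans (hKU _))⟩
  set ζ : ℕ → EuclideanSpace ℝ ι → ℝ := fun j x => Nat.casesOn j (f 0 x) fun i => f (i + 1) x - f i x
  have hζs : ∀ J x, ∑ j ∈ Finset.range (J + 1), ζ j x = f J x := by
    intro J x
    induction J with
    | zero => simp [ζ]
    | succ J ih => rw [Finset.sum_range_succ, ih]; simp [ζ]
  -- Monotonicity holds because f_{j+1} is 1 on the support of f_j; it makes the differences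
  -- nonnegative.
  have hmono : ∀ j x, f j x ≤ f (j + 1) x := by
    intro j x
    by_cases hx : x ∈ tsupport (f j)
    · rw [hf2 (j + 1) x (hVK j (hf3 j hx))]; exact (hf4 j x).2
    · rw [image_eq_zero_of_notMem_tsupport hx]; exact (hf4 (j + 1) x).1
  refine ⟨ζ, ⟨fun j => ?_, fun j x => ?_, fun j x => ?_, fun x hx => ?_⟩⟩
  · cases j with
    | zero => exact hft 0
    | succ i =>
      have ht : tsupport (ζ (i + 1)) ⊆ tsupport (f (i + 1)) ∪ tsupport (f i) :=
        tsupport_sub (f (i + 1)) (f i)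
      exact ⟨(hf1 (i + 1)).sub (hf1 i), ((hft (i + 1)).2.isCompact.union (hft i).2.isCompact).of_isClosed_subset
        (isClosed_tsupport _) ht, ht.trans (union_subset (hft (i + 1)).3 (hft i).3)⟩
  · cases j with
    | zero => exact (hf4 0 x).1
    | succ i => exact sub_nonneg.2 (hmono i x)
  · cases j with
    | zero => exact (hf4 0 x).2
    | succ i =>
      change f (i + 1) x - f i x ≤ 1
      linarith [(hf4 (i + 1) x).2, (hf4 i x).1]
  · obtain ⟨j, hj⟩ := hUV x hx
    -- The sum of the first J terms is f_{J-1}, and f_i equals 1 on V_j for i ≥ j + 1.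
    refine ⟨j + 2, ?_⟩
    filter_upwards [(hVo j).mem_nhds hj] with y hy J hJ
    obtain ⟨i, rfl⟩ : ∃ i, J = i + 1 := ⟨J - 1, by omega⟩
    rw [hζs]
    exact hf2 i y (hKmono (by omega : j + 1 ≤ i) (hVK j hy))

end Cutoffs

/-! ### The product partition of unity adapted to Ω₁ × Ω₂. -/

section Layering

variable {k : ℕ} [NeZero k] {n : Fin k → ℕ}

/-- The functions `Z j * B l` form a smooth partition of unity of `Ω` with compact supports, and
the functions `Z j` depend only on the first block and vanish near `S`. -/
structure IsLayering (Ω S : Set (Space n)) (Z B : ℕ → Space n → ℝ) : Prop where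
  contDiff_fst : ∀ j, ContDiff ℝ ∞ (Z j)
  contDiff_snd : ∀ l, ContDiff ℝ ∞ (B l)
  fst_nonneg : ∀ j x, 0 ≤ Z j x
  fst_le_one : ∀ j x, Z j x ≤ 1
  snd_nonneg : ∀ l x, 0 ≤ B l x
  snd_le_one : ∀ l x, B l x ≤ 1
  test : ∀ j l, IsTestFunction Ω fun x => Z j x * B l x
  sum_eq : ∀ x ∈ Ω, ∃ J₀, ∀ᶠ y in 𝓝 x, ∀ J ≥ J₀,
    ∑ j ∈ Finset.range J, Z j y = 1 ∧ ∑ l ∈ Finset.range J, B l y = 1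
  deriv_fst : ∀ j (c : Σ i, Fin (n i)), c.1 ≠ 0 → ∀ x, partialDeriv c (Z j) x = 0
  deriv_bound : ∀ j (c : Σ i, Fin (n i)), ∃ C, ∀ x, |partialDeriv c (Z j) x| ≤ C
  dist_le : ∀ j, ∃ d > 0, ∀ x ∈ S, ∀ y, Z j y ≠ 0 → d ≤ dist y x

/-- `firstBlock` as a continuous linear map. -/
def firstBlockL : Space n →L[ℝ] Block n 0 :=
  LinearMap.toContinuousLinearMap
    { toFun := firstBlock
      map_add' := fun _ _ => rfl
      map_smul' := fun _ _ => rfl }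

/-- `restBlocks` as a continuous linear map. -/
def restBlocksL : Space n →L[ℝ] OtherBlocks n :=
  LinearMap.toContinuousLinearMap
    { toFun := restBlocks
      map_add' := fun _ _ => rfl
      map_smul' := fun _ _ => rfl }

lemma continuous_firstBlock : Continuous (firstBlock : Space n → Block n 0) :=
  firstBlockL.continuous

lemma continuous_restBlocks : Continuous (restBlocks : Space n → OtherBlocks n) :=
  restBlocksL.continuous

lemma norm_firstBlock_le (x : Space n) : ‖firstBlock x‖ ≤ ‖x‖ := by
  rw [EuclideanSpace.norm_eq, EuclideanSpace.norm_eq, Fintype.sum_sigma]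
  refine Real.sqrt_le_sqrt ?_
  exact Finset.single_le_sum (f := fun i => ∑ j, ‖x ⟨i, j⟩‖ ^ 2)
    (fun i _ => Finset.sum_nonneg fun j _ => by positivity) (Finset.mem_univ 0)

lemma isOpen_blockProd {A : Set (Block n 0)} {B : Set (OtherBlocks n)} (hA : IsOpen A)
    (hB : IsOpen B) : IsOpen (blockProd A B) :=
  (hA.preimage continuous_firstBlock).inter (hB.preimage continuous_restBlocks)

lemma isCompact_closure_blockProd {A : Set (Block n 0)} {B : Set (OtherBlocks n)}
    (hA : Bornology.IsBounded A) (hB : Bornology.IsBounded B) :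
    IsCompact (closure (blockProd A B)) := by
  obtain ⟨R, hR⟩ := hA.exists_norm_le
  obtain ⟨R', hR'⟩ := hB.exists_norm_le
  have hK : IsCompact ((WithLp.toLp 2 : ((Σ i, Fin (n i)) → ℝ) → Space n) ''
      (Set.pi univ fun _ => Icc (-(max R R')) (max R R'))) :=
    (isCompact_univ_pi fun _ => isCompact_Icc).image (PiLp.continuous_toLp 2 _)
  refine hK.of_isClosed_subset isClosed_closure (closure_minimal (fun x hx => ?_) hK.isClosed)
  refine ⟨WithLp.ofLp x, fun c _ => ?_, rfl⟩
  refine abs_le.1 ?_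
  rw [← Real.norm_eq_abs]
  by_cases hc : c.1 = 0
  · obtain ⟨i, j⟩ := c
    obtain rfl : i = 0 := hc
    exact ((PiLp.norm_apply_le (firstBlock x) j).trans (hR _ hx.1)).trans (le_max_left _ _)
  · exact ((PiLp.norm_apply_le (restBlocks x) ⟨⟨c.1, hc⟩, c.2⟩).trans (hR' _ hx.2)).trans
      (le_max_right _ _)

/-- A boundary point of A can be approached from A by moving the first block alone; the other blocks
stay fixed in B. -/
lemma blockProd_frontier_subset {A : Set (Block n 0)} {B : Set (OtherBlocks n)} (hA : IsOpen A)
    (hB : IsOpen B) :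
    blockProd (frontier A) B ⊆ frontier (blockProd A B) := by
  rintro x ⟨h1, h2⟩
  rw [(isOpen_blockProd hA hB).frontier_eq]
  rw [hA.frontier_eq] at h1
  refine ⟨?_, fun h => h1.2 h.1⟩
  rw [mem_closure_iff_nhds]
  intro t ht
  set e : Block n 0 → Space n := fun y => x + extendBlock 0 (y - firstBlock x) with he
  have hec : Continuous e := by fun_prop
  have he0 : e (firstBlock x) = x := by simp [he]
  have he1 : ∀ y, firstBlock (e y) = y := fun y => by
    ext j
    change x ⟨0, j⟩ + extendBlock 0 (y - firstBlock x) ⟨0, j⟩ = y j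
    rw [extendBlock_apply_same]
    change x ⟨0, j⟩ + (y j - x ⟨0, j⟩) = y j
    ring
  have he2 : ∀ y, restBlocks (e y) = restBlocks x := fun y => by
    ext c
    change x ⟨c.1.1, c.2⟩ + extendBlock 0 (y - firstBlock x) ⟨c.1.1, c.2⟩ = x ⟨c.1.1, c.2⟩
    rw [extendBlock_apply_ne _ c.1.2, add_zero]
  obtain ⟨y, hy, hyA⟩ := mem_closure_iff_nhds.1 h1.1 (e ⁻¹' t)
    (hec.continuousAt.preimage_mem_nhds (by rwa [he0]))
  exact ⟨e y, hy, by rw [he1]; exact hyA, by rw [he2]; exact h2⟩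

/-- Pull back a partition of each factor. Compactness of the supports in Ω₁ gives both bounded
derivatives and a positive distance to the lateral boundary, whereas the Z_j alone are not compactly
supported in Ω. -/
theorem exists_isLayering {Ω₁ : Set (Block n 0)} {Ω₂ : Set (OtherBlocks n)}
    (hΩ₁ : IsOpen Ω₁) (hΩ₂ : IsOpen Ω₂) :
    ∃ Z B, IsLayering (blockProd Ω₁ Ω₂) (blockProd (frontier Ω₁) Ω₂) Z B := by
  obtain ⟨ζ, hζ⟩ := exists_isLayerPartition hΩ₁
  obtain ⟨β, hβ⟩ := exists_isLayerPartition hΩ₂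
  have hd : ∀ j (c : Σ i, Fin (n i)) x, partialDeriv c (fun x : Space n => ζ j (firstBlock x)) x
      = fderiv ℝ (ζ j) (firstBlock x) (firstBlockL (EuclideanSpace.single c 1)) := by
    intro j c x
    have := (((hζ.test j).1.differentiable (by simp) (firstBlock x)).hasFDerivAt.comp x
      (firstBlockL (n := n)).hasFDerivAt).fderiv
    rw [partialDeriv, show fderiv ℝ (fun x : Space n => ζ j (firstBlock x)) x = _ from this]
    rfl
  refine ⟨fun j x => ζ j (firstBlock x), fun l x => β l (restBlocks x),
    ⟨fun j => (hζ.test j).1.comp firstBlockL.contDiff,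
      fun l => (hβ.test l).1.comp restBlocksL.contDiff, fun j x => hζ.nonneg j _,
      fun j x => hζ.le_one j _, fun j x => hβ.nonneg j _, fun j x => hβ.le_one j _,
      fun j l => ?_, fun x hx => ?_, fun j c hc x => ?_, fun j c => ?_, fun j => ?_⟩⟩
  · have ht : tsupport (fun x : Space n => ζ j (firstBlock x) * β l (restBlocks x))
        ⊆ blockProd (tsupport (ζ j)) (tsupport (β l)) := by
      refine closure_minimal (fun x hx => ?_)
        (((isClosed_tsupport _).preimage continuous_firstBlock).inter
          ((isClosed_tsupport _).preimage continuous_restBlocks))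
      have hx' : ζ j (firstBlock x) * β l (restBlocks x) ≠ 0 := hx
      exact ⟨subset_tsupport _ (left_ne_zero_of_mul hx'),
        subset_tsupport _ (right_ne_zero_of_mul hx')⟩
    refine ⟨((hζ.test j).1.comp firstBlockL.contDiff).mul
      ((hβ.test l).1.comp restBlocksL.contDiff), ?_, fun x hx => ?_⟩
    · exact (isCompact_closure_blockProd (hζ.test j).2.isCompact.isBounded
        (hβ.test l).2.isCompact.isBounded).of_isClosed_subset (isClosed_tsupport _)
        (ht.trans subset_closure)
    · exact ⟨(hζ.test j).3 (ht hx).1, (hβ.test l).3 (ht hx).2⟩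
  · obtain ⟨J₁, h1⟩ := hζ.sum_eq _ hx.1
    obtain ⟨J₂, h2⟩ := hβ.sum_eq _ hx.2
    refine ⟨max J₁ J₂, ?_⟩
    filter_upwards [continuous_firstBlock.continuousAt.eventually h1,
      continuous_restBlocks.continuousAt.eventually h2] with y hy1 hy2 J hJ
    exact ⟨hy1 J (le_of_max_le_left hJ), hy2 J (le_of_max_le_right hJ)⟩
  · rw [hd]
    have : firstBlockL (EuclideanSpace.single c (1 : ℝ) : Space n) = 0 := by
      ext j
      change (EuclideanSpace.single c (1 : ℝ) : Space n) ⟨0, j⟩ = 0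
      have : (⟨0, j⟩ : Σ i, Fin (n i)) ≠ c := by rintro rfl; exact hc rfl
      simp [this]
    rw [this, map_zero]
  · have hc : Continuous fun y => fderiv ℝ (ζ j) y
        (firstBlockL (EuclideanSpace.single c (1 : ℝ) : Space n)) :=
      ((hζ.test j).1.continuous_fderiv (by simp)).clm_apply continuous_const
    obtain ⟨C, hC⟩ := ((hζ.test j).2.fderiv_apply ℝ
      (firstBlockL (EuclideanSpace.single c (1 : ℝ) : Space n))).exists_bound_of_continuous hc
    exact ⟨C, fun x => by rw [hd]; exact hC _⟩
  -- A neighbourhood of the support stays in the open set Ω₁, hence misses its frontier. Projection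
  -- to the first block does not increase distances, so the same d works in the full space.
  · obtain ⟨d, hd0, hd⟩ := (hζ.test j).2.isCompact.exists_thickening_subset_open hΩ₁ (hζ.test j).3
    refine ⟨d, hd0, fun x hx y hy => ?_⟩
    by_contra h
    have h1 : firstBlock x ∈ Metric.thickening d (tsupport (ζ j)) := by
      rw [Metric.mem_thickening_iff]
      refine ⟨firstBlock y, subset_tsupport _ hy, lt_of_le_of_lt ?_ (not_le.1 h)⟩
      rw [dist_comm, dist_eq_norm, dist_eq_norm]
      exact norm_firstBlock_le (y - x)
    have h2 := hx.1
    rw [hΩ₁.frontier_eq] at h2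
    exact h2.2 (hd h1)

end Layering

/-! ### The limits that allow the choice of truncation levels and mollification scales. -/

section Choice

variable {ι : Type} [Fintype ι] [DecidableEq ι] {p : ℝ≥0∞} {u g : EuclideanSpace ℝ ι → ℝ}

lemma tendsto_eLpNorm_smoothTrunc_sub (hp : p ≠ ⊤) (hu : MemLp u p) :
    Tendsto (fun M => eLpNorm (fun x => smoothTrunc M (u x) - u x) p volume) atTop (𝓝 0) := by
  refine tendsto_eLpNorm_of_dominated hp (fun M => ?_) (hu.norm.const_mul 2)
    (fun M => ae_of_all _ fun x => abs_smoothTrunc_sub_self_le M (u x)) (ae_of_all _ fun x => ?_)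
  · exact ((contDiff_smoothTrunc M).continuous.comp_aestronglyMeasurable hu.1).sub hu.1
  · simpa using (tendsto_smoothTrunc (u x)).sub_const (u x)

lemma tendsto_eLpNorm_smoothTruncDeriv_mul (hp : p ≠ ⊤) (hu : AEStronglyMeasurable u)
    (hg : MemLp g p) :
    Tendsto (fun M => eLpNorm (fun x => (smoothTruncDeriv M (u x) - 1) * g x) p volume)
      atTop (𝓝 0) := by
  refine tendsto_eLpNorm_of_dominated hp (fun M => ?_) hg.norm
    (fun M => ae_of_all _ fun x => ?_) (ae_of_all _ fun x => ?_)
  · exact (((continuous_smoothTruncDeriv M).comp_aestronglyMeasurable hu).sub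
      aestronglyMeasurable_const).mul hg.1
  · rw [norm_mul, Real.norm_eq_abs, abs_sub_comm,
      abs_of_nonneg (by linarith [smoothTruncDeriv_le_one M (u x)])]
    exact mul_le_of_le_one_left (norm_nonneg _) (by linarith [smoothTruncDeriv_nonneg M (u x)])
  · simpa using ((tendsto_smoothTruncDeriv (u x)).sub_const 1).mul_const (g x)

/-- The boundedness of the truncation together with the compact support of χ provides a majorant in
L^p even though u is merely locally integrable. This is the purpose of truncating. -/
lemma tendsto_eLpNorm_mul_smoothTrunc_mollify_sub (hp : p ≠ ⊤) (hu : LocallyIntegrable u) (M : ℕ)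
    {χ : EuclideanSpace ℝ ι → ℝ} (hχ : Continuous χ) (hχc : HasCompactSupport χ) :
    Tendsto (fun m => eLpNorm
      (fun x => χ x * (smoothTrunc M (mollify m u x) - smoothTrunc M (u x))) p volume)
      atTop (𝓝 0) := by
  have hθ := (contDiff_smoothTrunc M).continuous
  refine tendsto_eLpNorm_of_dominated hp (fun m => ?_)
    ((hχ.memLp_of_hasCompactSupport (p := p) (μ := volume) hχc).norm.mul_const ((M + 1 : ℝ) * 4))
    (fun m => ae_of_all _ fun x => ?_) ?_
  · exact hχ.aestronglyMeasurable.mul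
      ((hθ.comp_aestronglyMeasurable (mollify_contDiff m hu).continuous.aestronglyMeasurable).sub
        (hθ.comp_aestronglyMeasurable hu.aestronglyMeasurable))
  · rw [norm_mul]
    refine mul_le_mul_of_nonneg_left ?_ (norm_nonneg _)
    refine (norm_sub_le _ _).trans ?_
    have h1 := abs_smoothTrunc_le_const M (mollify m u x)
    have h2 := abs_smoothTrunc_le_const M (u x)
    rw [Real.norm_eq_abs, Real.norm_eq_abs]; linarith
  · filter_upwards [mollify_ae_tendsto hu] with x hx
    have := (((hθ.tendsto _).comp hx).sub_const (smoothTrunc M (u x))).const_mul (χ x)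
    simpa using this

/-- Split off θ'(ρ*u)(ρ*g − g), controlled by 0 ≤ θ' ≤ 1; the remainder (θ'(ρ*u) − θ'(u)) g is
dominated by |g| and tends to zero almost everywhere. -/
lemma tendsto_eLpNorm_smoothTruncDeriv_mollify_mul_sub (hp1 : 1 ≤ p) (hp : p ≠ ⊤)
    (hu : LocallyIntegrable u) (M : ℕ) (hg : MemLp g p) :
    Tendsto (fun m => eLpNorm (fun x => smoothTruncDeriv M (mollify m u x) * mollify m g x
      - smoothTruncDeriv M (u x) * g x) p volume) atTop (𝓝 0) := by
  have hθ := continuous_smoothTruncDeriv M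
  have hum : ∀ m, AEStronglyMeasurable (fun x => smoothTruncDeriv M (mollify m u x)) :=
    fun m => hθ.comp_aestronglyMeasurable (mollify_contDiff m hu).continuous.aestronglyMeasurable
  have huu : AEStronglyMeasurable (fun x => smoothTruncDeriv M (u x)) :=
    hθ.comp_aestronglyMeasurable hu.aestronglyMeasurable
  have hgm : ∀ m, AEStronglyMeasurable (mollify m g) := fun m =>
    (mollify_contDiff m (hg.locallyIntegrable hp1)).continuous.aestronglyMeasurable
  have h2 : Tendsto (fun m => eLpNorm (fun x => (smoothTruncDeriv M (mollify m u x)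
      - smoothTruncDeriv M (u x)) * g x) p volume) atTop (𝓝 0) := by
    refine tendsto_eLpNorm_of_dominated hp (fun m => ((hum m).sub huu).mul hg.1) hg.norm
      (fun m => ae_of_all _ fun x => ?_) ?_
    · rw [norm_mul]
      refine mul_le_of_le_one_left (norm_nonneg _) ?_
      rw [Real.norm_eq_abs, abs_le]
      constructor <;> linarith [smoothTruncDeriv_nonneg M (u x), smoothTruncDeriv_le_one M (u x),
        smoothTruncDeriv_nonneg M (mollify m u x), smoothTruncDeriv_le_one M (mollify m u x)]
    · filter_upwards [mollify_ae_tendsto hu] with x hx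
      have := (((hθ.tendsto _).comp hx).sub_const (smoothTruncDeriv M (u x))).mul_const (g x)
      simpa using this
  have h3 := (tendsto_eLpNorm_mollify_sub hp1 hp hg).add h2
  rw [add_zero] at h3
  refine tendsto_of_tendsto_of_tendsto_of_le_of_le tendsto_const_nhds h3 (fun _ => zero_le)
    fun m => ?_
  have e : (fun x => smoothTruncDeriv M (mollify m u x) * mollify m g x
      - smoothTruncDeriv M (u x) * g x)
      = (fun x => smoothTruncDeriv M (mollify m u x) * (mollify m g x - g x))
        + fun x => (smoothTruncDeriv M (mollify m u x) - smoothTruncDeriv M (u x)) * g x := by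
    ext x; simp only [Pi.add_apply]; ring
  simp only []
  rw [e]
  refine (eLpNorm_add_le ((hum m).mul ((hgm m).sub hg.1)) (((hum m).sub huu).mul hg.1) hp1).trans ?_
  refine add_le_add (eLpNorm_mono fun x => ?_) le_rfl
  rw [Pi.mul_apply, norm_mul]
  refine mul_le_of_le_one_left (norm_nonneg _) ?_
  rw [Real.norm_of_nonneg (smoothTruncDeriv_nonneg _ _)]
  exact smoothTruncDeriv_le_one _ _

end Choice

/-! ### Simultaneous choice of all the parameters. -/

section Estimates

variable {k : ℕ} [NeZero k] {n : Fin k → ℕ}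

/-- The product partition of unity. -/
def layerBump (Z B : ℕ → Space n → ℝ) (a : ℕ × ℕ) (x : Space n) : ℝ := Z a.1 x * B a.2 x

/-- Truncation levels `M` and mollification parameters `m` which make all the errors of the
approximation small. The derivatives of `u` in the directions in `I` are `g`, with integrability
exponents `r`. -/
structure LayerEstimates (Ω S : Set (Space n)) (Z B : ℕ → Space n → ℝ) (u : Space n → ℝ) (q : ℝ≥0∞)
    (I : Set (Σ i, Fin (n i))) (g : (Σ i, Fin (n i)) → Space n → ℝ)
    (r : (Σ i, Fin (n i)) → ℝ≥0∞) (M : ℕ → ℕ) (m : ℕ × ℕ → ℕ) (τ : ℕ → ℝ≥0) (σ : ℕ × ℕ → ℝ≥0)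
    (K : ℕ → ℝ≥0) (L : ℕ × ℕ → ℝ≥0) : Prop where
  deriv_fst_le : ∀ j c x, ‖partialDeriv c (Z j) x‖ₑ ≤ K j
  edist_le : ∀ j, ∀ x ∈ S, ∀ y, Z j y ≠ 0 →
    (edist y x ^ Fintype.card (Σ i, Fin (n i)))⁻¹ ≤ K j
  deriv_le : ∀ a c x, ‖partialDeriv c (layerBump Z B a) x‖ₑ ≤ L a
  le_L : ∀ a : ℕ × ℕ, K a.1 ≤ L a
  trunc_q : q ≠ ⊤ → ∀ j, eLpNorm (fun x => smoothTrunc (M j) (u x) - u x) q volume ≤ τ j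
  trunc_one : ∀ j, K j * eLpNorm (fun x => smoothTrunc (M j) (u x) - u x) 1 volume ≤ τ j
  trunc_one' : ∀ j, eLpNorm (fun x => smoothTrunc (M j) (u x) - u x) 1 volume ≤ τ j
  trunc_deriv : ∀ c ∈ I, ∀ j,
    eLpNorm (fun x => (smoothTruncDeriv (M j) (u x) - 1) * g c x) (r c) volume ≤ τ j
  subset : ∀ a, Metric.cthickening (1 / ((m a : ℝ) + 1)) (tsupport (layerBump Z B a)) ⊆ Ω
  moll_q : q ≠ ⊤ → ∀ a, eLpNorm (mollify (m a) u - u) q volume ≤ σ a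
  moll_one : ∀ a, L a * eLpNorm (mollify (m a) u - u) 1 volume ≤ σ a
  moll_one' : ∀ a, eLpNorm (mollify (m a) u - u) 1 volume ≤ σ a
  -- Needed in L^{r c}, where u itself may fail to be integrable; hence the truncated difference.
  moll_trunc : ∀ c ∈ I, ∀ a, eLpNorm (fun x => partialDeriv c (layerBump Z B a) x
    * (smoothTrunc (M a.1) (mollify (m a) u x) - smoothTrunc (M a.1) (u x))) (r c) volume ≤ σ a
  moll_deriv : ∀ c ∈ I, ∀ a, eLpNorm (fun x => smoothTruncDeriv (M a.1) (mollify (m a) u x)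
    * mollify (m a) (g c) x - smoothTruncDeriv (M a.1) (u x) * g c x) (r c) volume ≤ σ a
  -- Keeps the sum of the mollified bumps below 1 + Σ σ, the norm bound of the test field in the
  -- duality estimate.
  moll_bump : ∀ a x, mollify (m a) (layerBump Z B a) x ≤ layerBump Z B a x + σ a

/-- Each requirement holds eventually, and for each index only finitely many are imposed. The order
of choice matters: first the constants K and L of the partition, then the level M j, and only then
the scale m a, which may depend on M a.1. -/
theorem exists_layerEstimates {Ω S : Set (Space n)} (hΩ : IsOpen Ω) {Z B : ℕ → Space n → ℝ}
    (hL : IsLayering Ω S Z B) {u : Space n → ℝ} (hu : Integrable u) {q : ℝ≥0∞} (hq : 1 ≤ q)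
    (huq : MemLp u q) {I : Set (Σ i, Fin (n i))} {g : (Σ i, Fin (n i)) → Space n → ℝ}
    {r : (Σ i, Fin (n i)) → ℝ≥0∞} (hr1 : ∀ c ∈ I, 1 ≤ r c) (hr : ∀ c ∈ I, r c ≠ ⊤)
    (hg : ∀ c ∈ I, MemLp (g c) (r c)) {τ : ℕ → ℝ≥0} (hτ : ∀ j, 0 < τ j) {σ : ℕ × ℕ → ℝ≥0}
    (hσ : ∀ a, 0 < σ a) :
    ∃ M m K L, LayerEstimates Ω S Z B u q I g r M m τ σ K L := by
  have hu1 : MemLp u 1 := memLp_one_iff_integrable.2 hu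
  have hψ : ∀ a, IsTestFunction Ω (layerBump Z B a) := fun a => hL.test a.1 a.2
  have hK : ∀ j, ∃ K : ℝ≥0, (∀ c x, ‖partialDeriv c (Z j) x‖ₑ ≤ K) ∧ ∀ x ∈ S, ∀ y, Z j y ≠ 0 →
      (edist y x ^ Fintype.card (Σ i, Fin (n i)))⁻¹ ≤ K := by
    intro j
    choose C hC using hL.deriv_bound j
    obtain ⟨d, hd0, hd⟩ := hL.dist_le j
    refine ⟨∑ c, (C c).toNNReal + ((d ^ Fintype.card (Σ i, Fin (n i)))⁻¹).toNNReal,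
      fun c x => ?_, fun x hx y hy => ?_⟩
    · rw [← ofReal_norm, ENNReal.ofReal, ENNReal.coe_le_coe]
      refine (Real.toNNReal_le_toNNReal (hC c x)).trans (le_trans ?_ le_self_add)
      exact Finset.single_le_sum (f := fun c => (C c).toNNReal) (fun _ _ => zero_le)
        (Finset.mem_univ c)
    · refine le_trans ?_ (ENNReal.coe_le_coe.2 le_add_self)
      change _ ≤ ENNReal.ofReal _
      rw [ENNReal.ofReal_inv_of_pos (by positivity), ENNReal.inv_le_inv, ENNReal.ofReal_pow hd0.le,
        edist_dist]
      gcongr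
      exact hd x hx y hy
  choose K hK1 hK2 using hK
  have hLa : ∀ a : ℕ × ℕ, ∃ L : ℝ≥0, (∀ c x, ‖partialDeriv c (layerBump Z B a) x‖ₑ ≤ L) ∧
      K a.1 ≤ L := by
    intro a
    have : ∀ c, ∃ C, ∀ x, ‖partialDeriv c (layerBump Z B a) x‖ ≤ C := fun c =>
      ((hψ a).partialDeriv c).2.exists_bound_of_continuous ((hψ a).partialDeriv c).continuous
    choose C hC using this
    refine ⟨∑ c, (C c).toNNReal + K a.1, fun c x => ?_, le_add_self⟩
    rw [← ofReal_norm, ENNReal.ofReal, ENNReal.coe_le_coe]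
    refine (Real.toNNReal_le_toNNReal (hC c x)).trans (le_trans ?_ le_self_add)
    exact Finset.single_le_sum (f := fun c => (C c).toNNReal) (fun _ _ => zero_le)
      (Finset.mem_univ c)
  choose L hL1 hL2 using hLa
  have ev : ∀ {f : ℕ → ℝ≥0∞} {t : ℝ≥0}, 0 < t → Tendsto f atTop (𝓝 0) →
      ∀ᶠ M in atTop, f M ≤ t := fun ht hf =>
    ENNReal.tendsto_nhds_zero.1 hf _ (ENNReal.coe_pos.2 ht)
  have ev' : ∀ {f : ℕ → ℝ≥0∞} {t K : ℝ≥0}, 0 < t → Tendsto f atTop (𝓝 0) →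
      ∀ᶠ M in atTop, K * f M ≤ t := fun {f t K} ht hf => by
    refine ev ht ?_
    simpa using ENNReal.Tendsto.const_mul (a := (K : ℝ≥0∞)) hf (Or.inr ENNReal.coe_ne_top)
  have hM : ∀ j, ∃ M : ℕ,
      (q ≠ ⊤ → eLpNorm (fun x => smoothTrunc M (u x) - u x) q volume ≤ τ j) ∧
      (K j * eLpNorm (fun x => smoothTrunc M (u x) - u x) 1 volume ≤ τ j) ∧
      (eLpNorm (fun x => smoothTrunc M (u x) - u x) 1 volume ≤ τ j) ∧
      ∀ c ∈ I, eLpNorm (fun x => (smoothTruncDeriv M (u x) - 1) * g c x) (r c) volume ≤ τ j := by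
    intro j
    have h1 := tendsto_eLpNorm_smoothTrunc_sub ENNReal.one_ne_top hu1
    refine Eventually.exists (f := atTop) ?_
    refine Eventually.and ?_ ((ev' (hτ j) h1).and ((ev (hτ j) h1).and ?_))
    · by_cases h : q = ⊤
      · exact Eventually.of_forall fun _ h' => (h' h).elim
      · exact (ev (hτ j) (tendsto_eLpNorm_smoothTrunc_sub h huq)).mono fun _ h' _ => h'
    · refine eventually_all.2 fun c => ?_
      by_cases hc : c ∈ I
      · exact (ev (hτ j) (tendsto_eLpNorm_smoothTruncDeriv_mul (hr c hc) hu.1 (hg c hc))).mono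
          fun _ h' _ => h'
      · exact Eventually.of_forall fun _ h' => (hc h').elim
  choose M hM1 hM2 hM3 hM4 using hM
  have hm : ∀ a : ℕ × ℕ, ∃ m : ℕ,
      (Metric.cthickening (1 / ((m : ℝ) + 1)) (tsupport (layerBump Z B a)) ⊆ Ω) ∧
      (q ≠ ⊤ → eLpNorm (mollify m u - u) q volume ≤ σ a) ∧
      (L a * eLpNorm (mollify m u - u) 1 volume ≤ σ a) ∧
      (eLpNorm (mollify m u - u) 1 volume ≤ σ a) ∧
      (∀ c ∈ I, eLpNorm (fun x => partialDeriv c (layerBump Z B a) x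
        * (smoothTrunc (M a.1) (mollify m u x) - smoothTrunc (M a.1) (u x))) (r c) volume ≤ σ a) ∧
      (∀ c ∈ I, eLpNorm (fun x => smoothTruncDeriv (M a.1) (mollify m u x)
        * mollify m (g c) x - smoothTruncDeriv (M a.1) (u x) * g c x) (r c) volume ≤ σ a) ∧
      ∀ x, mollify m (layerBump Z B a) x ≤ layerBump Z B a x + σ a := by
    intro a
    have h1 := tendsto_eLpNorm_mollify_sub le_rfl ENNReal.one_ne_top hu1
    refine Eventually.exists (f := atTop) ?_
    refine (eventually_cthickening_subset (hψ a).2.isCompact hΩ (hψ a).3).and (Eventually.and ?_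
      ((ev' (hσ a) h1).and ((ev (hσ a) h1).and (Eventually.and ?_ (Eventually.and ?_ ?_)))))
    · by_cases h : q = ⊤
      · exact Eventually.of_forall fun _ h' => (h' h).elim
      · exact (ev (hσ a) (tendsto_eLpNorm_mollify_sub hq h huq)).mono fun _ h' _ => h'
    · refine eventually_all.2 fun c => ?_
      by_cases hc : c ∈ I
      · exact (ev (hσ a) (tendsto_eLpNorm_mul_smoothTrunc_mollify_sub (hr c hc)
          hu.locallyIntegrable (M a.1) ((hψ a).partialDeriv c).continuous
          ((hψ a).partialDeriv c).2)).mono fun _ h' _ => h'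
      · exact Eventually.of_forall fun _ h' => (hc h').elim
    · refine eventually_all.2 fun c => ?_
      by_cases hc : c ∈ I
      · exact (ev (hσ a) (tendsto_eLpNorm_smoothTruncDeriv_mollify_mul_sub (hr1 c hc) (hr c hc)
          hu.locallyIntegrable (M a.1) (hg c hc))).mono fun _ h' _ => h'
      · exact Eventually.of_forall fun _ h' => (hc h').elim
    · filter_upwards [eventually_dist_mollify_le (hψ a).continuous (hψ a).2
        (NNReal.coe_pos.2 (hσ a))] with m hm x
      have := (abs_le.1 (Real.dist_eq _ _ ▸ hm x)).2
      linarith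
  choose m hm1 hm2 hm3 hm4 hm5 hm6 hm7 using hm
  exact ⟨M, m, K, L, ⟨hK1, hK2, hL1, hL2, fun h j => hM1 j h, hM2, hM3, fun c hc j => hM4 j c hc,
    hm1, fun h a => hm2 a h, hm3, hm4, fun c hc a => hm5 a c hc, fun c hc a => hm6 a c hc, hm7⟩⟩

end Estimates

/-! ### Calculus rules for partial derivatives. -/

section PartialDeriv

variable {ι : Type} [Fintype ι] [DecidableEq ι]

lemma partialDeriv_congr {f h : EuclideanSpace ℝ ι → ℝ} {x : EuclideanSpace ℝ ι}
    (hfh : f =ᶠ[𝓝 x] h) (c : ι) : partialDeriv c f x = partialDeriv c h x := by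
  rw [partialDeriv, hfh.fderiv_eq, partialDeriv]

lemma partialDeriv_sum {α : Type*} (s : Finset α) {f : α → EuclideanSpace ℝ ι → ℝ}
    {x : EuclideanSpace ℝ ι} (hf : ∀ a ∈ s, DifferentiableAt ℝ (f a) x) (c : ι) :
    partialDeriv c (fun y => ∑ a ∈ s, f a y) x = ∑ a ∈ s, partialDeriv c (f a) x := by
  simp only [partialDeriv]
  rw [fderiv_fun_sum hf]
  simp

lemma partialDeriv_mul {f h : EuclideanSpace ℝ ι → ℝ} {x : EuclideanSpace ℝ ι}
    (hf : DifferentiableAt ℝ f x) (hh : DifferentiableAt ℝ h x) (c : ι) :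
    partialDeriv c (fun y => f y * h y) x = f x * partialDeriv c h x + partialDeriv c f x * h x := by
  simp only [partialDeriv]
  rw [fderiv_fun_mul hf hh]
  simp [mul_comm]

lemma partialDeriv_smoothTrunc {f : EuclideanSpace ℝ ι → ℝ} {x : EuclideanSpace ℝ ι}
    (hf : DifferentiableAt ℝ f x) (M : ℕ) (c : ι) :
    partialDeriv c (fun y => smoothTrunc M (f y)) x
      = smoothTruncDeriv M (f x) * partialDeriv c f x := by
  simp only [partialDeriv]
  have := ((hasDerivAt_smoothTrunc M (f x)).comp_hasFDerivAt x hf.hasFDerivAt).fderiv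
  rw [show fderiv ℝ (fun y => smoothTrunc M (f y)) x = _ from this]
  simp

lemma partialDeriv_eq_zero_of_eventually_const {f : EuclideanSpace ℝ ι → ℝ}
    {x : EuclideanSpace ℝ ι} {b : ℝ} (h : ∀ᶠ y in 𝓝 x, f y = b) (c : ι) :
    partialDeriv c f x = 0 := by
  rw [partialDeriv_congr (h := fun _ => b) h]
  simp [partialDeriv]

end PartialDeriv

/-! ### The approximating sum and its pointwise expansion. -/

section LayerSum

variable {k : ℕ} [NeZero k] {n : Fin k → ℕ} {Ω S : Set (Space n)} {Z B : ℕ → Space n → ℝ}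

/-- The pieces of the approximation of `u`. -/
def layerTerm (Z B : ℕ → Space n → ℝ) (u : Space n → ℝ) (M : ℕ → ℕ) (m : ℕ × ℕ → ℕ) (a : ℕ × ℕ)
    (x : Space n) : ℝ :=
  layerBump Z B a x * smoothTrunc (M a.1) (mollify (m a) u x)

/-- The smooth approximation of `u` with truncation levels `M` and mollification parameters `m`. -/
def layerSum (Z B : ℕ → Space n → ℝ) (u : Space n → ℝ) (M : ℕ → ℕ) (m : ℕ × ℕ → ℕ)
    (x : Space n) : ℝ :=
  ∑' a, layerTerm Z B u M m a x

/-- The index set `{0, …, J - 1}²`. -/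
def idxSquare (J : ℕ) : Finset (ℕ × ℕ) := Finset.range J ×ˢ Finset.range J

/-- Once all later partial sums equal 1, subtracting consecutive ones shows that the later terms
vanish. -/
lemma layerBump_eq_zero {J₀ J : ℕ} {y : Space n}
    (h : ∀ J ≥ J₀, ∑ j ∈ Finset.range J, Z j y = 1 ∧ ∑ l ∈ Finset.range J, B l y = 1)
    (hJ : J₀ ≤ J) {a : ℕ × ℕ} (ha : a ∉ idxSquare J) : layerBump Z B a y = 0 := by
  have hz : ∀ j ≥ J₀, Z j y = 0 ∧ B j y = 0 := fun j hj => by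
    have h1 := h (j + 1) (by omega)
    have h2 := h j hj
    rw [Finset.sum_range_succ, Finset.sum_range_succ, h2.1, h2.2] at h1
    exact ⟨by linarith [h1.1], by linarith [h1.2]⟩
  rw [idxSquare, Finset.mem_product, Finset.mem_range, Finset.mem_range, not_and_or, not_lt,
    not_lt] at ha
  rcases ha with ha | ha
  · simp [layerBump, (hz a.1 (hJ.trans ha)).1]
  · simp [layerBump, (hz a.2 (hJ.trans ha)).2]

lemma layerSum_eventuallyEq (hL : IsLayering Ω S Z B) (u : Space n → ℝ) (M : ℕ → ℕ)
    (m : ℕ × ℕ → ℕ) {x : Space n} (hx : x ∈ Ω) : ∀ᶠ J in atTop,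
    layerSum Z B u M m =ᶠ[𝓝 x] fun y => ∑ a ∈ idxSquare J, layerTerm Z B u M m a y := by
  obtain ⟨J₀, hJ₀⟩ := hL.sum_eq x hx
  filter_upwards [eventually_ge_atTop J₀] with J hJ
  filter_upwards [hJ₀] with y hy
  exact tsum_eq_sum fun a ha => by rw [layerTerm, layerBump_eq_zero hy hJ ha, zero_mul]

lemma layerBump_contDiff (hL : IsLayering Ω S Z B) (a : ℕ × ℕ) : ContDiff ℝ ∞ (layerBump Z B a) :=
  (hL.test a.1 a.2).1

lemma layerBump_nonneg (hL : IsLayering Ω S Z B) (a : ℕ × ℕ) (x : Space n) :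
    0 ≤ layerBump Z B a x :=
  mul_nonneg (hL.fst_nonneg _ _) (hL.snd_nonneg _ _)

lemma layerBump_le_one (hL : IsLayering Ω S Z B) (a : ℕ × ℕ) (x : Space n) :
    layerBump Z B a x ≤ 1 :=
  mul_le_one₀ (hL.fst_le_one _ _) (hL.snd_nonneg _ _) (hL.snd_le_one _ _)

lemma layerTerm_contDiff (hL : IsLayering Ω S Z B) {u : Space n → ℝ} (hu : LocallyIntegrable u)
    (M : ℕ → ℕ) (m : ℕ × ℕ → ℕ) (a : ℕ × ℕ) : ContDiff ℝ ∞ (layerTerm Z B u M m a) :=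
  (layerBump_contDiff hL a).mul ((contDiff_smoothTrunc _).comp (mollify_contDiff _ hu))

lemma layerSum_contDiffOn (hL : IsLayering Ω S Z B) {u : Space n → ℝ} (hu : LocallyIntegrable u)
    (M : ℕ → ℕ) (m : ℕ × ℕ → ℕ) : ContDiffOn ℝ ∞ (layerSum Z B u M m) Ω := by
  intro x hx
  obtain ⟨J, hJ⟩ := (layerSum_eventuallyEq hL u M m hx).exists
  refine (ContDiffAt.congr_of_eventuallyEq ?_ hJ).contDiffWithinAt
  exact (ContDiff.sum fun a _ => layerTerm_contDiff hL hu M m a).contDiffAt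

lemma sum_layerBump_mul {x : Space n} {J : ℕ} (hB : ∑ l ∈ Finset.range J, B l x = 1) (f : ℕ → ℝ) :
    ∑ a ∈ idxSquare J, layerBump Z B a x * f a.1 = ∑ j ∈ Finset.range J, Z j x * f j := by
  rw [idxSquare, Finset.sum_product]
  refine Finset.sum_congr rfl fun j _ => ?_
  simp only [layerBump]
  rw [← Finset.sum_mul, ← Finset.mul_sum, hB, mul_one]

lemma eventually_sum_eq (hL : IsLayering Ω S Z B) {x : Space n} (hx : x ∈ Ω) :
    ∀ᶠ J in atTop, ∑ j ∈ Finset.range J, Z j x = 1 ∧ ∑ l ∈ Finset.range J, B l x = 1 := by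
  obtain ⟨J₀, hJ₀⟩ := hL.sum_eq x hx
  filter_upwards [eventually_ge_atTop J₀] with J hJ using hJ₀.self_of_nhds J hJ

lemma eventually_sum_deriv_eq (hL : IsLayering Ω S Z B) {x : Space n} (hx : x ∈ Ω)
    (c : Σ i, Fin (n i)) : ∀ᶠ J in atTop, ∑ j ∈ Finset.range J, partialDeriv c (Z j) x = 0 ∧
      ∑ l ∈ Finset.range J, partialDeriv c (B l) x = 0 := by
  obtain ⟨J₀, hJ₀⟩ := hL.sum_eq x hx
  filter_upwards [eventually_ge_atTop J₀] with J hJ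
  rw [← partialDeriv_sum _ fun j _ => ((hL.contDiff_fst j).differentiable (by simp)) x,
    ← partialDeriv_sum _ fun j _ => ((hL.contDiff_snd j).differentiable (by simp)) x]
  exact ⟨partialDeriv_eq_zero_of_eventually_const (hJ₀.mono fun y hy => (hy J hJ).1) c,
    partialDeriv_eq_zero_of_eventually_const (hJ₀.mono fun y hy => (hy J hJ).2) c⟩

/-- For coefficients depending on j only, the sum over l can be carried out: Σ B_l = 1 and Σ ∂B_l =
0. Only derivatives of Z_j survive, and these vanish outside the first block. -/
lemma eventually_sum_layerBump_deriv_mul (hL : IsLayering Ω S Z B) {x : Space n} (hx : x ∈ Ω)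
    (c : Σ i, Fin (n i)) : ∀ᶠ J in atTop, ∀ f : ℕ → ℝ,
    ∑ a ∈ idxSquare J, partialDeriv c (layerBump Z B a) x * f a.1
      = ∑ j ∈ Finset.range J, partialDeriv c (Z j) x * f j := by
  filter_upwards [eventually_sum_eq hL hx, eventually_sum_deriv_eq hL hx c] with J h1 h2 f
  rw [idxSquare, Finset.sum_product]
  refine Finset.sum_congr rfl fun j _ => ?_
  have : ∀ l, partialDeriv c (layerBump Z B (j, l)) x
      = Z j x * partialDeriv c (B l) x + partialDeriv c (Z j) x * B l x := fun l =>
    partialDeriv_mul ((hL.contDiff_fst j).differentiable (by simp) x)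
      ((hL.contDiff_snd l).differentiable (by simp) x) c
  simp only [this]
  rw [← Finset.sum_mul, Finset.sum_add_distrib, ← Finset.mul_sum, ← Finset.mul_sum, h1.2, h2.2]
  ring

/-- Insert θ_{M_j}(u) as an intermediate term: the first sum is the mollification error, the second
the truncation error. -/
lemma eventually_layerSum_sub_eq (hL : IsLayering Ω S Z B) (u : Space n → ℝ) (M : ℕ → ℕ)
    (m : ℕ × ℕ → ℕ) {x : Space n} (hx : x ∈ Ω) : ∀ᶠ J in atTop,
    layerSum Z B u M m x - u x
      = ∑ a ∈ idxSquare J, layerBump Z B a x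
          * (smoothTrunc (M a.1) (mollify (m a) u x) - smoothTrunc (M a.1) (u x))
        + ∑ j ∈ Finset.range J, Z j x * (smoothTrunc (M j) (u x) - u x) := by
  filter_upwards [eventually_sum_eq hL hx, layerSum_eventuallyEq hL u M m hx] with J h1 h2
  rw [h2.self_of_nhds]
  simp only [mul_sub, Finset.sum_sub_distrib, layerTerm]
  rw [sum_layerBump_mul h1.2 fun j => smoothTrunc (M j) (u x), ← Finset.sum_mul, h1.1]
  ring

/-- Product rule, followed by the insertion of θ_{M_j}(u) into the terms where the partition is
differentiated; u can be subtracted there at no cost because Σ ∂_c Z_j = 0. -/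
lemma eventually_partialDeriv_layerSum (hL : IsLayering Ω S Z B) {u : Space n → ℝ}
    (hu : LocallyIntegrable u) (M : ℕ → ℕ) (m : ℕ × ℕ → ℕ) {x : Space n} (hx : x ∈ Ω)
    (c : Σ i, Fin (n i)) : ∀ᶠ J in atTop,
    partialDeriv c (layerSum Z B u M m) x
      = ∑ a ∈ idxSquare J, layerBump Z B a x * (smoothTruncDeriv (M a.1) (mollify (m a) u x)
          * partialDeriv c (mollify (m a) u) x)
        + ∑ a ∈ idxSquare J, partialDeriv c (layerBump Z B a) x
          * (smoothTrunc (M a.1) (mollify (m a) u x) - smoothTrunc (M a.1) (u x))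
        + ∑ j ∈ Finset.range J, partialDeriv c (Z j) x * (smoothTrunc (M j) (u x) - u x) := by
  filter_upwards [eventually_sum_deriv_eq hL hx c, layerSum_eventuallyEq hL u M m hx,
    eventually_sum_layerBump_deriv_mul hL hx c] with J h1 h2 h3
  have hd : ∀ a, DifferentiableAt ℝ (mollify (m a) u) x := fun a =>
    (mollify_contDiff (m a) hu).differentiable (by simp) x
  have hθ : ∀ a, DifferentiableAt ℝ (fun y => smoothTrunc (M a.1) (mollify (m a) u y)) x :=
    fun a => (((contDiff_smoothTrunc (M a.1)).differentiable (by simp)) _).comp x (hd a)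
  rw [partialDeriv_congr h2, partialDeriv_sum _
    fun a _ => (layerTerm_contDiff hL hu M m a).differentiable (by simp) x]
  have e : ∀ a, partialDeriv c (layerTerm Z B u M m a) x
      = layerBump Z B a x * (smoothTruncDeriv (M a.1) (mollify (m a) u x)
          * partialDeriv c (mollify (m a) u) x)
        + partialDeriv c (layerBump Z B a) x * smoothTrunc (M a.1) (mollify (m a) u x) := by
    intro a
    rw [show layerTerm Z B u M m a = fun y => layerBump Z B a y * smoothTrunc (M a.1)
      (mollify (m a) u y) from rfl,
      partialDeriv_mul ((layerBump_contDiff hL a).differentiable (by simp) x) (hθ a),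
      partialDeriv_smoothTrunc (hd a)]
  simp only [e, mul_sub, Finset.sum_sub_distrib, Finset.sum_add_distrib]
  rw [h3 fun j => smoothTrunc (M j) (u x), ← Finset.sum_mul, h1.1]
  ring

end LayerSum

/-! ### Norm, gradient, variation and weighted estimates for the approximating sum. -/

section LayerSumEstimates

variable {k : ℕ} [NeZero k] {n : Fin k → ℕ} {Ω S : Set (Space n)} {Z B : ℕ → Space n → ℝ}
  {u : Space n → ℝ} {M : ℕ → ℕ} {m : ℕ × ℕ → ℕ}

lemma layerSum_aestronglyMeasurable (hΩ : IsOpen Ω) (hL : IsLayering Ω S Z B)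
    (hu : LocallyIntegrable u) :
    AEStronglyMeasurable (layerSum Z B u M m) (volume.restrict Ω) :=
  (layerSum_contDiffOn hL hu M m).continuousOn.aestronglyMeasurable hΩ.measurableSet

lemma mollify_aestronglyMeasurable {f : Space n → ℝ} (hf : LocallyIntegrable f) (m : ℕ)
    (μ : Measure (Space n)) : AEStronglyMeasurable (mollify m f) μ :=
  (mollify_contDiff m hf).continuous.aestronglyMeasurable

lemma trunc_moll_aestronglyMeasurable (hu : LocallyIntegrable u) (M m : ℕ) :
    AEStronglyMeasurable (fun x => smoothTrunc M (mollify m u x) - smoothTrunc M (u x)) :=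
  ((contDiff_smoothTrunc M).continuous.comp_aestronglyMeasurable
    (mollify_aestronglyMeasurable hu m _)).sub
    ((contDiff_smoothTrunc M).continuous.comp_aestronglyMeasurable hu.aestronglyMeasurable)

lemma trunc_sub_aestronglyMeasurable (hu : LocallyIntegrable u) (M : ℕ) :
    AEStronglyMeasurable (fun x => smoothTrunc M (u x) - u x) :=
  ((contDiff_smoothTrunc M).continuous.comp_aestronglyMeasurable hu.aestronglyMeasurable).sub
    hu.aestronglyMeasurable

lemma norm_layerBump_mul_le (hL : IsLayering Ω S Z B) (a : ℕ × ℕ) (x : Space n) (t : ℝ) :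
    ‖layerBump Z B a x * t‖ ≤ ‖t‖ := by
  rw [norm_mul]
  refine mul_le_of_le_one_left (norm_nonneg _) ?_
  rw [Real.norm_of_nonneg (layerBump_nonneg hL a x)]
  exact layerBump_le_one hL a x

lemma norm_fst_mul_le (hL : IsLayering Ω S Z B) (j : ℕ) (x : Space n) (t : ℝ) :
    ‖Z j x * t‖ ≤ ‖t‖ := by
  rw [norm_mul]
  refine mul_le_of_le_one_left (norm_nonneg _) ?_
  rw [Real.norm_of_nonneg (hL.fst_nonneg j x)]
  exact hL.fst_le_one j x

lemma eventually_norm_add_sum_le {X : ℕ × ℕ → ℝ} {W : ℕ → ℝ} {y : ℝ} (J : ℕ)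
    (h : y = ∑ a ∈ idxSquare J, X a + ∑ j ∈ Finset.range J, W j) :
    ‖y‖ ≤ ∑ a ∈ idxSquare J, ‖X a‖ + ∑ j ∈ Finset.range J, ‖W j‖ := by
  rw [h]
  exact (norm_add_le _ _).trans (add_le_add (norm_sum_le _ _) (norm_sum_le _ _))

/-- Truncation is 1-Lipschitz and the weights are at most 1, so mollification and truncation errors
pass unchanged into the sum. -/
theorem eLpNorm_layerSum_sub_le (hΩ : IsOpen Ω) (hL : IsLayering Ω S Z B)
    (hu : LocallyIntegrable u) {p : ℝ≥0∞} (hp : 1 ≤ p) {σ : ℕ × ℕ → ℝ≥0∞} {τ : ℕ → ℝ≥0∞}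
    (hσ : ∀ a, eLpNorm (mollify (m a) u - u) p volume ≤ σ a)
    (hτ : ∀ j, eLpNorm (fun x => smoothTrunc (M j) (u x) - u x) p volume ≤ τ j) :
    eLpNorm (layerSum Z B u M m - u) p (volume.restrict Ω) ≤ ∑' a, σ a + ∑' j, τ j := by
  refine eLpNorm_le_tsum_add_tsum (X := fun a x => layerBump Z B a x
      * (smoothTrunc (M a.1) (mollify (m a) u x) - smoothTrunc (M a.1) (u x)))
    (W := fun j x => Z j x * (smoothTrunc (M j) (u x) - u x)) hp
    ((layerSum_aestronglyMeasurable hΩ hL hu).sub hu.aestronglyMeasurable.restrict)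
    (fun a => ?_) (fun j => ?_) (fun a => ?_) (fun j => ?_) ?_
  · exact ((layerBump_contDiff hL a).continuous.aestronglyMeasurable.mul
      (trunc_moll_aestronglyMeasurable hu _ _)).restrict
  · exact ((hL.contDiff_fst j).continuous.aestronglyMeasurable.mul
      (trunc_sub_aestronglyMeasurable hu _)).restrict
  · refine (eLpNorm_mono_measure _ Measure.restrict_le_self).trans
      ((eLpNorm_mono fun x => ?_).trans (hσ a))
    exact (norm_layerBump_mul_le hL a x _).trans (abs_smoothTrunc_sub_le _ _ _)
  · refine (eLpNorm_mono_measure _ Measure.restrict_le_self).trans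
      ((eLpNorm_mono fun x => ?_).trans (hτ j))
    exact norm_fst_mul_le hL j x _
  · refine (ae_restrict_iff' hΩ.measurableSet).2 (ae_of_all _ fun x hx => ?_)
    filter_upwards [eventually_layerSum_sub_eq hL u M m hx] with J hJ
    exact eventually_norm_add_sum_le J hJ

/-- At each point the sum is a convex combination of truncated mollifications, and neither operation
increases the supremum norm. -/
theorem eLpNorm_top_layerSum_le (hΩ : IsOpen Ω) (hL : IsLayering Ω S Z B)
    (hu : MemLp u ⊤) : eLpNorm (layerSum Z B u M m) ⊤ (volume.restrict Ω) ≤ eLpNorm u ⊤ volume := by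
  rw [eLpNorm_exponent_top]
  refine eLpNormEssSup_le_of_ae_enorm_bound ?_
  have h1 : ∀ᵐ x, ∀ a, ‖mollify (m a) u x‖ₑ ≤ eLpNorm u ⊤ volume := by
    refine ae_all_iff.2 fun a => ?_
    have := eLpNorm_mollify_le (m a) hu.1 le_top
    rw [eLpNorm_exponent_top] at this
    filter_upwards [enorm_ae_le_eLpNormEssSup (mollify (m a) u) volume] with x hx
    exact hx.trans this
  refine (ae_restrict_iff' hΩ.measurableSet).2 ?_
  filter_upwards [h1] with x hx hxΩ
  obtain ⟨J, h1, h2⟩ := ((eventually_sum_eq hL hxΩ).and (layerSum_eventuallyEq hL u M m hxΩ)).exists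
  rw [h2.self_of_nhds]
  refine (enorm_sum_le _ _).trans ?_
  calc ∑ a ∈ idxSquare J, ‖layerTerm Z B u M m a x‖ₑ
      ≤ ∑ a ∈ idxSquare J, ENNReal.ofReal (layerBump Z B a x) * eLpNorm u ⊤ volume := by
        refine Finset.sum_le_sum fun a _ => ?_
        rw [layerTerm, enorm_mul, Real.enorm_of_nonneg (layerBump_nonneg hL a x)]
        gcongr
        refine le_trans ?_ (hx a)
        rw [← ofReal_norm, ← ofReal_norm]
        exact ENNReal.ofReal_le_ofReal (abs_smoothTrunc_le _ _)
    _ = eLpNorm u ⊤ volume := by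
        rw [← Finset.sum_mul, ← ENNReal.ofReal_sum_of_nonneg fun a _ => layerBump_nonneg hL a x]
        have := sum_layerBump_mul (Z := Z) h1.2 fun _ => 1
        simp only [mul_one] at this
        rw [this, h1.1, ENNReal.ofReal_one, one_mul]

variable {q : ℝ≥0∞} {I : Set (Σ i, Fin (n i))} {g : (Σ i, Fin (n i)) → Space n → ℝ}
  {r : (Σ i, Fin (n i)) → ℝ≥0∞} {τ : ℕ → ℝ≥0} {σ : ℕ × ℕ → ℝ≥0} {K : ℕ → ℝ≥0} {L : ℕ × ℕ → ℝ≥0}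

lemma eLpNorm_mul_le_of_enorm_le {f h : Space n → ℝ} {C : ℝ≥0} (hf : ∀ x, ‖f x‖ₑ ≤ C)
    (p : ℝ≥0∞) : eLpNorm (fun x => f x * h x) p volume ≤ C * eLpNorm h p volume := by
  refine (eLpNorm_le_nnreal_smul_eLpNorm_of_ae_le_mul (c := C) (ae_of_all _ fun x => ?_) p).trans_eq
    rfl
  rw [nnnorm_mul]
  gcongr
  exact_mod_cast hf x

/-- In the first block the exponent is 1 and the level was chosen against K j; in the other blocks
the derivative of Z_j is zero. Thus u is never required to lie in L^{p_i}. -/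
lemma eLpNorm_deriv_fst_mul_le (hL : IsLayering Ω S Z B)
    (hE : LayerEstimates Ω S Z B u q I g r M m τ σ K L) {c : Σ i, Fin (n i)} {p : ℝ≥0∞}
    (hp : c.1 = 0 → p = 1) (j : ℕ) :
    eLpNorm (fun x => partialDeriv c (Z j) x * (smoothTrunc (M j) (u x) - u x)) p volume ≤ τ j := by
  by_cases hc : c.1 = 0
  · rw [hp hc]
    exact (eLpNorm_mul_le_of_enorm_le (hE.deriv_fst_le j c) 1).trans (hE.trunc_one j)
  · simp [hL.deriv_fst j c hc]

lemma eLpNorm_deriv_bump_mul_le (hE : LayerEstimates Ω S Z B u q I g r M m τ σ K L)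
    (c : Σ i, Fin (n i)) (a : ℕ × ℕ) :
    eLpNorm (fun x => partialDeriv c (layerBump Z B a) x
      * (smoothTrunc (M a.1) (mollify (m a) u x) - smoothTrunc (M a.1) (u x))) 1 volume ≤ σ a := by
  refine (eLpNorm_mul_le_of_enorm_le (hE.deriv_le a c) 1).trans (le_trans ?_ (hE.moll_one a))
  gcongr
  exact eLpNorm_mono fun x => abs_smoothTrunc_sub_le _ _ _

/-- The scale was chosen so that a ball around any point of the bump's support remains in Ω, where
the weak derivative equation holds. -/
lemma partialDeriv_mollify_of_layerBump_ne_zero (hΩ : IsOpen Ω)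
    (hE : LayerEstimates Ω S Z B u q I g r M m τ σ K L) (hu : Integrable u)
    (hu0 : Ω.indicator u = u) {c : Σ i, Fin (n i)} {f : Space n → ℝ} (hf0 : Ω.indicator f = f)
    (hw : IsWeakPartial Ω c u f) {a : ℕ × ℕ} {x : Space n} (hx : layerBump Z B a x ≠ 0) :
    partialDeriv c (mollify (m a) u) x = mollify (m a) f x := by
  have h := partialDeriv_mollify_of_weak (m a) hΩ.measurableSet hu.integrableOn hw (x := x)
    ((Metric.closedBall_subset_cthickening (subset_tsupport (layerBump Z B a) hx) _).trans
      (hE.subset a))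
  rwa [hu0, hf0] at h

theorem eLpNorm_partialDeriv_layerSum_sub_le (hΩ : IsOpen Ω) (hL : IsLayering Ω S Z B)
    (hE : LayerEstimates Ω S Z B u q I g r M m τ σ K L) (hu : Integrable u)
    (hu0 : Ω.indicator u = u) {c : Σ i, Fin (n i)} (hc : c ∈ I) (hr1 : 1 ≤ r c)
    (hr0 : c.1 = 0 → r c = 1) (hg : MemLp (g c) (r c)) (hg0 : Ω.indicator (g c) = g c)
    (hw : IsWeakPartial Ω c u (g c)) :
    eLpNorm (partialDeriv c (layerSum Z B u M m) - g c) (r c) (volume.restrict Ω)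
      ≤ ∑' a, 2 * (σ a : ℝ≥0∞) + ∑' j, 2 * (τ j : ℝ≥0∞) := by
  have hul := hu.locallyIntegrable
  have hgl := hg.locallyIntegrable hr1
  have a1 : ∀ a, AEStronglyMeasurable (fun x => partialDeriv c (layerBump Z B a) x
      * (smoothTrunc (M a.1) (mollify (m a) u x) - smoothTrunc (M a.1) (u x))) volume := fun a =>
    (contDiff_partialDeriv (layerBump_contDiff hL a) c).continuous.aestronglyMeasurable.mul
      (trunc_moll_aestronglyMeasurable hul _ _)
  have a2 : ∀ a, AEStronglyMeasurable (fun x => smoothTruncDeriv (M a.1) (mollify (m a) u x)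
      * mollify (m a) (g c) x - smoothTruncDeriv (M a.1) (u x) * g c x) volume := fun a =>
    (((continuous_smoothTruncDeriv _).comp_aestronglyMeasurable
      (mollify_aestronglyMeasurable hul _ _)).mul (mollify_aestronglyMeasurable hgl _ _)).sub
    (((continuous_smoothTruncDeriv _).comp_aestronglyMeasurable hu.1).mul hg.1)
  have a3 : ∀ j, AEStronglyMeasurable
      (fun x => partialDeriv c (Z j) x * (smoothTrunc (M j) (u x) - u x)) volume := fun j =>
    (contDiff_partialDeriv (hL.contDiff_fst j) c).continuous.aestronglyMeasurable.mul
      (trunc_sub_aestronglyMeasurable hul _)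
  have a4 : ∀ j, AEStronglyMeasurable
      (fun x => (smoothTruncDeriv (M j) (u x) - 1) * g c x) volume := fun j =>
    (((continuous_smoothTruncDeriv _).comp_aestronglyMeasurable hu.1).sub
      aestronglyMeasurable_const).mul hg.1
  refine eLpNorm_le_tsum_add_tsum
    (X := fun a x => ‖partialDeriv c (layerBump Z B a) x
      * (smoothTrunc (M a.1) (mollify (m a) u x) - smoothTrunc (M a.1) (u x))‖
      + ‖smoothTruncDeriv (M a.1) (mollify (m a) u x)
        * mollify (m a) (g c) x - smoothTruncDeriv (M a.1) (u x) * g c x‖)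
    (W := fun j x => ‖partialDeriv c (Z j) x * (smoothTrunc (M j) (u x) - u x)‖
      + ‖(smoothTruncDeriv (M j) (u x) - 1) * g c x‖) hr1 ?_
    (fun a => ((a1 a).norm.add (a2 a).norm).restrict)
    (fun j => ((a3 j).norm.add (a4 j).norm).restrict) (fun a => ?_) (fun j => ?_) ?_
  · exact ((contDiffOn_partialDeriv hΩ (layerSum_contDiffOn hL hul M m)
      c).continuousOn.aestronglyMeasurable hΩ.measurableSet).sub hg.1.restrict
  · refine (eLpNorm_mono_measure _ Measure.restrict_le_self).trans
      ((eLpNorm_add_le (a1 a).norm (a2 a).norm hr1).trans ?_)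
    rw [eLpNorm_norm, eLpNorm_norm, two_mul]
    exact add_le_add (hE.moll_trunc c hc a) (hE.moll_deriv c hc a)
  · refine (eLpNorm_mono_measure _ Measure.restrict_le_self).trans
      ((eLpNorm_add_le (a3 j).norm (a4 j).norm hr1).trans ?_)
    rw [eLpNorm_norm, eLpNorm_norm, two_mul]
    exact add_le_add (eLpNorm_deriv_fst_mul_le hL hE hr0 j) (hE.trunc_deriv c hc j)
  · refine (ae_restrict_iff' hΩ.measurableSet).2 (ae_of_all _ fun x hx => ?_)
    filter_upwards [eventually_partialDeriv_layerSum hL hul M m hx c, eventually_sum_eq hL hx]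
      with J h1 h2
    have e1 : ∀ a, layerBump Z B a x * (smoothTruncDeriv (M a.1) (mollify (m a) u x)
        * partialDeriv c (mollify (m a) u) x)
        = layerBump Z B a x * (smoothTruncDeriv (M a.1) (mollify (m a) u x)
        * mollify (m a) (g c) x) := by
      intro a
      by_cases h0 : layerBump Z B a x = 0
      · simp [h0]
      · rw [partialDeriv_mollify_of_layerBump_ne_zero hΩ hE hu hu0 hg0 hw h0]
    -- The main term is compared with g through θ'_{M_j}(u) g: one sum carries the mollification
    -- errors, the other the truncation errors.
    have e2 : partialDeriv c (layerSum Z B u M m) x - g c x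
        = ∑ a ∈ idxSquare J, (partialDeriv c (layerBump Z B a) x
            * (smoothTrunc (M a.1) (mollify (m a) u x) - smoothTrunc (M a.1) (u x))
          + layerBump Z B a x * (smoothTruncDeriv (M a.1) (mollify (m a) u x)
            * mollify (m a) (g c) x - smoothTruncDeriv (M a.1) (u x) * g c x))
        + ∑ j ∈ Finset.range J, (partialDeriv c (Z j) x * (smoothTrunc (M j) (u x) - u x)
          + Z j x * ((smoothTruncDeriv (M j) (u x) - 1) * g c x)) := by
      rw [h1]
      simp only [e1]
      have e3 := sum_layerBump_mul (Z := Z) h2.2 fun j => smoothTruncDeriv (M j) (u x) * g c x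
      have e4 : ∑ j ∈ Finset.range J, Z j x * g c x = g c x := by
        rw [← Finset.sum_mul, h2.1, one_mul]
      simp only [mul_sub, sub_mul, one_mul, Finset.sum_add_distrib, Finset.sum_sub_distrib]
      rw [e3, e4]
      ring
    refine (eventually_norm_add_sum_le J e2).trans (add_le_add ?_ ?_)
    · refine Finset.sum_le_sum fun a _ => ?_
      refine le_trans ?_ (le_abs_self _)
      exact (norm_add_le _ _).trans (add_le_add le_rfl (norm_layerBump_mul_le hL a x _))
    · refine Finset.sum_le_sum fun j _ => ?_
      refine le_trans ?_ (le_abs_self _)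
      exact (norm_add_le _ _).trans (add_le_add le_rfl (norm_fst_mul_le hL j x _))

/-- Any finite index set lies in a large square, whose bumps add up to 1 on Ω; outside Ω all bumps
vanish. -/
lemma sum_layerBump_le_one (hL : IsLayering Ω S Z B) (s : Finset (ℕ × ℕ)) (x : Space n) :
    ∑ a ∈ s, layerBump Z B a x ≤ 1 := by
  by_cases hx : x ∈ Ω
  · have hs : ∀ᶠ J in atTop, s ⊆ idxSquare J := by
      filter_upwards [eventually_gt_atTop (s.sup fun a => max a.1 a.2)] with J hJ a ha
      have := (Finset.le_sup (f := fun a : ℕ × ℕ => max a.1 a.2) ha).trans_lt hJ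
      simp only [idxSquare, Finset.mem_product, Finset.mem_range]
      exact max_lt_iff.1 this
    obtain ⟨J, h1, h2⟩ := ((eventually_sum_eq hL hx).and hs).exists
    refine (Finset.sum_le_sum_of_subset_of_nonneg h2
      fun a _ _ => layerBump_nonneg hL a x).trans_eq ?_
    have := sum_layerBump_mul (Z := Z) h1.2 fun _ => 1
    simp only [mul_one] at this
    rw [this, h1.1]
  · have : ∀ a, layerBump Z B a x = 0 := fun a => (hL.test a.1 a.2).eq_zero hx
    simp [this]

/-- No weak derivative of u in the first block is used. The main part is bounded by the duality
estimate, and the remaining terms are L¹ errors in each of the n 0 coordinates. -/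
theorem lintegral_blockGrad_layerSum_le (hΩ : IsOpen Ω) (hL : IsLayering Ω S Z B)
    (hE : LayerEstimates Ω S Z B u q I g r M m τ σ K L) (hu : Integrable u)
    (hu0 : Ω.indicator u = u) {ε : ℝ≥0} (hσ : ∑' a, (σ a : ℝ≥0∞) ≤ ε)
    (hτ : ∑' j, (τ j : ℝ≥0∞) ≤ ε) :
    ∫⁻ x in Ω, ‖blockGrad 0 (layerSum Z B u M m) x‖ₑ
      ≤ (1 + ε) * blockVariation Ω 0 u + n 0 * (ε + ε) := by
  have hul := hu.locallyIntegrable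
  set X : Fin (n 0) → ℕ × ℕ → Space n → ℝ := fun c a x =>
    partialDeriv (⟨0, c⟩ : Σ i, Fin (n i)) (layerBump Z B a) x
      * (smoothTrunc (M a.1) (mollify (m a) u x) - smoothTrunc (M a.1) (u x)) with hX
  set W : Fin (n 0) → ℕ → Space n → ℝ := fun c j x =>
    partialDeriv (⟨0, c⟩ : Σ i, Fin (n i)) (Z j) x * (smoothTrunc (M j) (u x) - u x) with hW
  have hXm : ∀ c a, AEStronglyMeasurable (X c a) volume := fun c a =>
    (contDiff_partialDeriv (layerBump_contDiff hL a) _).continuous.aestronglyMeasurable.mul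
      (trunc_moll_aestronglyMeasurable hul _ _)
  have hWm : ∀ c j, AEStronglyMeasurable (W c j) volume := fun c j =>
    (contDiff_partialDeriv (hL.contDiff_fst j) _).continuous.aestronglyMeasurable.mul
      (trunc_sub_aestronglyMeasurable hul _)
  set D : ℕ × ℕ → Space n → ℝ≥0∞ := fun a x =>
    ENNReal.ofReal (layerBump Z B a x) * ‖blockGrad 0 (mollify (m a) u) x‖ₑ with hD
  have hDm : ∀ a, Measurable (D a) := fun a =>
    (layerBump_contDiff hL a).continuous.measurable.ennreal_ofReal.mul
      (contDiff_euclidean.2 fun _ => contDiff_partialDeriv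
        (mollify_contDiff (m a) hul) _ : ContDiff ℝ ∞ (blockGrad 0 (mollify (m a) u))).continuous.enorm.measurable
  have hpt : ∀ x ∈ Ω, ‖blockGrad 0 (layerSum Z B u M m) x‖ₑ
      ≤ ∑' a, D a x + ∑ c, (∑' a, ‖X c a x‖ₑ + ∑' j, ‖W c j x‖ₑ) := by
    intro x hx
    obtain ⟨J, hJ⟩ := (eventually_all.2 fun c : Fin (n 0) =>
      eventually_partialDeriv_layerSum hL hul M m hx ⟨0, c⟩).exists
    -- The part of the gradient in which the mollifications are differentiated; 0 ≤ θ' ≤ 1 lets the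
    -- truncation be dropped from its norm.
    set G : Block n 0 := ∑ a ∈ idxSquare J, (layerBump Z B a x
      * smoothTruncDeriv (M a.1) (mollify (m a) u x)) • blockGrad 0 (mollify (m a) u) x with hG
    have hGe : ‖G‖ₑ ≤ ∑' a, D a x := by
      refine (enorm_sum_le _ _).trans (le_trans (Finset.sum_le_sum fun a _ => ?_)
        (ENNReal.sum_le_tsum (idxSquare J)))
      rw [enorm_smul, Real.enorm_of_nonneg
        (mul_nonneg (layerBump_nonneg hL a x) (smoothTruncDeriv_nonneg _ _))]
      refine mul_le_mul_left (ENNReal.ofReal_le_ofReal ?_) _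
      exact mul_le_of_le_one_right (layerBump_nonneg hL a x) (smoothTruncDeriv_le_one _ _)
    have hsub : ‖blockGrad 0 (layerSum Z B u M m) x - G‖ₑ
        ≤ ∑ c, (∑' a, ‖X c a x‖ₑ + ∑' j, ‖W c j x‖ₑ) := by
      have h1 : ‖blockGrad 0 (layerSum Z B u M m) x - G‖ₑ
          ≤ ∑ c, ‖(blockGrad 0 (layerSum Z B u M m) x - G) c‖ₑ := by
        set y := blockGrad 0 (layerSum Z B u M m) x - G
        have : y = ∑ c, EuclideanSpace.single c (y c) := by
          ext c; simp [Finset.sum_apply]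
        conv_lhs => rw [this]
        refine (enorm_sum_le _ _).trans (Finset.sum_le_sum fun c _ => ?_)
        rw [← ofReal_norm, PiLp.norm_single, ofReal_norm]
      refine h1.trans (Finset.sum_le_sum fun c _ => ?_)
      have h2 : (blockGrad 0 (layerSum Z B u M m) x - G) c
          = ∑ a ∈ idxSquare J, X c a x + ∑ j ∈ Finset.range J, W c j x := by
        have : G c = ∑ a ∈ idxSquare J, layerBump Z B a x
            * (smoothTruncDeriv (M a.1) (mollify (m a) u x)
              * partialDeriv (⟨0, c⟩ : Σ i, Fin (n i)) (mollify (m a) u) x) := by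
          rw [hG]
          simp [Finset.sum_apply, blockGrad, mul_assoc]
        change partialDeriv (⟨0, c⟩ : Σ i, Fin (n i)) (layerSum Z B u M m) x - G c = _
        rw [hJ c, this]
        ring
      rw [h2]
      refine (enorm_add_le _ _).trans (add_le_add ?_ ?_)
      · exact (enorm_sum_le _ _).trans (ENNReal.sum_le_tsum (f := fun a => ‖X c a x‖ₑ) _)
      · exact (enorm_sum_le _ _).trans (ENNReal.sum_le_tsum (f := fun a => ‖W c a x‖ₑ) _)
    calc ‖blockGrad 0 (layerSum Z B u M m) x‖ₑ
        = ‖G + (blockGrad 0 (layerSum Z B u M m) x - G)‖ₑ := by rw [add_sub_cancel]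
      _ ≤ _ := (enorm_add_le _ _).trans (add_le_add hGe hsub)
  have hD1 : ∑' a, ∫⁻ x, D a x ≤ (1 + ε) * blockVariation Ω 0 u := by
    rw [ENNReal.tsum_eq_iSup_sum]
    refine iSup_le fun s => ?_
    have h := sum_lintegral_blockGrad_mollify_le (i := 0) hΩ hu.integrableOn s m (layerBump Z B)
      (layerBump_nonneg hL) (fun a _ => hL.test a.1 a.2) (fun a _ => hE.subset a)
      (C := 1 + ε) (by positivity) fun x => ?_
    · have e : ENNReal.ofReal (1 + (ε : ℝ)) = 1 + ε := by
        rw [ENNReal.ofReal_add zero_le_one (NNReal.coe_nonneg ε), ENNReal.ofReal_one, ENNReal.ofReal_coe_nnreal]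
      rw [hu0, e] at h
      exact h
    · refine (Finset.sum_le_sum fun a _ => hE.moll_bump a x).trans ?_
      rw [Finset.sum_add_distrib]
      refine add_le_add (sum_layerBump_le_one hL s x) ?_
      have : ∑ a ∈ s, (σ a : ℝ≥0∞) ≤ ε := (ENNReal.sum_le_tsum s).trans hσ
      exact_mod_cast this
  calc ∫⁻ x in Ω, ‖blockGrad 0 (layerSum Z B u M m) x‖ₑ
      ≤ ∫⁻ x in Ω, (∑' a, D a x + ∑ c, (∑' a, ‖X c a x‖ₑ + ∑' j, ‖W c j x‖ₑ)) :=
        setLIntegral_mono' hΩ.measurableSet hpt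
    _ ≤ ∫⁻ x, (∑' a, D a x + ∑ c, (∑' a, ‖X c a x‖ₑ + ∑' j, ‖W c j x‖ₑ)) :=
        setLIntegral_le_lintegral _ _
    _ = (∑' a, ∫⁻ x, D a x)
        + ∑ c, ((∑' a, ∫⁻ x, ‖X c a x‖ₑ) + ∑' j, ∫⁻ x, ‖W c j x‖ₑ) := by
        rw [lintegral_add_left (Measurable.tsum hDm),
          lintegral_tsum fun a => (hDm a).aemeasurable, lintegral_finsetSum']
        · congr 1
          refine Finset.sum_congr rfl fun c _ => ?_
          rw [lintegral_add_left' (AEMeasurable.tsum fun a => (hXm c a).enorm),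
            lintegral_tsum fun a => (hXm c a).enorm, lintegral_tsum fun a => (hWm c a).enorm]
        · exact fun c _ => (AEMeasurable.tsum fun a => (hXm c a).enorm).add
            (AEMeasurable.tsum fun a => (hWm c a).enorm)
    _ ≤ (1 + ε) * blockVariation Ω 0 u + ∑ c : Fin (n 0), ((ε : ℝ≥0∞) + ε) := by
        refine add_le_add hD1 (Finset.sum_le_sum fun c _ => add_le_add ?_ ?_)
        · refine (ENNReal.tsum_le_tsum fun a => ?_).trans hσ
          rw [← eLpNorm_one_eq_lintegral_enorm]
          exact eLpNorm_deriv_bump_mul_le hE _ a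
        · refine (ENNReal.tsum_le_tsum fun j => ?_).trans hτ
          rw [← eLpNorm_one_eq_lintegral_enorm]
          exact eLpNorm_deriv_fst_mul_le hL hE (fun _ => rfl) j
    _ = (1 + ε) * blockVariation Ω 0 u + n 0 * (ε + ε) := by simp [mul_add]

/-- Wherever Z_j is nonzero the weight is at most K j, and the L¹ errors of the layer were made
small even after multiplication by K j or L a ≥ K a.1. The bound does not depend on x₀. -/
theorem lintegral_layerSum_sub_weight_le (hΩ : IsOpen Ω) (hL : IsLayering Ω S Z B)
    (hE : LayerEstimates Ω S Z B u q I g r M m τ σ K L) (hu : LocallyIntegrable u)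
    {x₀ : Space n} (hx₀ : x₀ ∈ S) :
    ∫⁻ y in Ω, ‖layerSum Z B u M m y - u y‖ₑ * (edist y x₀ ^ Fintype.card (Σ i, Fin (n i)))⁻¹
      ≤ ∑' a, (σ a : ℝ≥0∞) + ∑' j, (τ j : ℝ≥0∞) := by
  set X : ℕ × ℕ → Space n → ℝ := fun a x =>
    smoothTrunc (M a.1) (mollify (m a) u x) - smoothTrunc (M a.1) (u x) with hX
  set W : ℕ → Space n → ℝ := fun j x => smoothTrunc (M j) (u x) - u x with hW
  have hXm : ∀ a, AEStronglyMeasurable (X a) volume := fun a =>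
    trunc_moll_aestronglyMeasurable hu _ _
  have hWm : ∀ j, AEStronglyMeasurable (W j) volume := fun j => trunc_sub_aestronglyMeasurable hu _
  have hw : ∀ y j t, ‖Z j y * t‖ₑ * (edist y x₀ ^ Fintype.card (Σ i, Fin (n i)))⁻¹
      ≤ K j * ‖t‖ₑ := by
    intro y j t
    by_cases h0 : Z j y = 0
    · simp [h0]
    · rw [mul_comm]
      refine mul_le_mul' (hE.edist_le j x₀ hx₀ y h0) ?_
      rw [← ofReal_norm, ← ofReal_norm]
      exact ENNReal.ofReal_le_ofReal (norm_fst_mul_le hL j y t)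
  have hpt : ∀ y ∈ Ω, ‖layerSum Z B u M m y - u y‖ₑ
      * (edist y x₀ ^ Fintype.card (Σ i, Fin (n i)))⁻¹
      ≤ ∑' a, L a * ‖X a y‖ₑ + ∑' j, K j * ‖W j y‖ₑ := by
    intro y hy
    obtain ⟨J, hJ⟩ := (eventually_layerSum_sub_eq hL u M m hy).exists
    rw [hJ]
    refine (mul_le_mul_left ((enorm_add_le _ _).trans
      (add_le_add (enorm_sum_le _ _) (enorm_sum_le _ _))) _).trans ?_
    rw [add_mul, Finset.sum_mul, Finset.sum_mul]
    refine add_le_add ?_ ?_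
    · refine le_trans (Finset.sum_le_sum fun a _ => ?_)
        (ENNReal.sum_le_tsum (f := fun a => L a * ‖X a y‖ₑ) _)
      rw [layerBump, mul_assoc]
      refine (hw y a.1 _).trans (mul_le_mul' (by exact_mod_cast hE.le_L a) ?_)
      rw [← ofReal_norm, ← ofReal_norm, norm_mul]
      refine ENNReal.ofReal_le_ofReal (mul_le_of_le_one_left (norm_nonneg _) ?_)
      rw [Real.norm_of_nonneg (hL.snd_nonneg _ _)]
      exact hL.snd_le_one _ _
    · exact le_trans (Finset.sum_le_sum fun j _ => hw y j _)
        (ENNReal.sum_le_tsum (f := fun a => K a * ‖W a y‖ₑ) _)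
  calc _ ≤ ∫⁻ y in Ω, (∑' a, L a * ‖X a y‖ₑ + ∑' j, K j * ‖W j y‖ₑ) :=
        setLIntegral_mono' hΩ.measurableSet hpt
    _ ≤ ∫⁻ y, (∑' a, L a * ‖X a y‖ₑ + ∑' j, K j * ‖W j y‖ₑ) := setLIntegral_le_lintegral _ _
    _ = (∑' a, L a * ∫⁻ y, ‖X a y‖ₑ) + ∑' j, K j * ∫⁻ y, ‖W j y‖ₑ := by
        rw [lintegral_add_left' (AEMeasurable.tsum fun a => (hXm a).enorm.const_mul _),
          lintegral_tsum fun a => (hXm a).enorm.const_mul _,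
          lintegral_tsum fun j => (hWm j).enorm.const_mul _]
        congr 1
        · exact tsum_congr fun a => lintegral_const_mul' _ _ ENNReal.coe_ne_top
        · exact tsum_congr fun a => lintegral_const_mul' _ _ ENNReal.coe_ne_top
    _ ≤ _ := by
        refine add_le_add (ENNReal.tsum_le_tsum fun a => ?_) (ENNReal.tsum_le_tsum fun j => ?_)
        · refine le_trans ?_ (hE.moll_one a)
          rw [← eLpNorm_one_eq_lintegral_enorm]
          gcongr
          exact eLpNorm_mono fun x => abs_smoothTrunc_sub_le _ _ _
        · rw [← eLpNorm_one_eq_lintegral_enorm]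
          exact hE.trunc_one j

end LayerSumEstimates

/-! ### Boundary values on a flat boundary. -/

section HalfSpace

variable {V : Type*} [NormedAddCommGroup V] [NormedSpace ℝ V] [FiniteDimensional ℝ V]
  [MeasurableSpace V] [BorelSpace V] (μ : Measure V) [μ.IsAddHaarMeasure]

theorem tendsto_setLIntegral_Ioo_zero {G : ℝ → ℝ≥0∞} {δ : ℝ} (hG : ∫⁻ t in Ioo 0 δ, G t ≠ ⊤)
    {h : ℕ → ℝ} (hh : Tendsto h atTop (𝓝 0)) (hhδ : ∀ n, h n ≤ δ) :
    Tendsto (fun n => ∫⁻ t in Ioo 0 (h n), G t) atTop (𝓝 0) := by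
  have e : ∀ n, ∫⁻ t in Ioo 0 (h n), G t
      = ∫⁻ t in Ioo 0 (h n), G t ∂(volume.restrict (Ioo 0 δ)) := by
    intro n
    rw [Measure.restrict_restrict measurableSet_Ioo,
      inter_eq_left.2 (Ioo_subset_Ioo_right (hhδ n))]
  simp only [e]
  refine tendsto_setLIntegral_zero hG ?_
  refine tendsto_of_tendsto_of_tendsto_of_le_of_le tendsto_const_nhds
    (?_ : Tendsto (fun n => ENNReal.ofReal (h n)) atTop (𝓝 0)) (fun _ => zero_le) fun n => ?_
  · simpa using ENNReal.tendsto_ofReal hh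
  · refine (Measure.restrict_apply_le _ _).trans ?_
    simp

/-- Existence of the limits of `f (z, t)` as `t → 0⁺`, with a bound of the rate of convergence. -/
theorem exists_measurable_limit {f : V → ℝ → ℝ} {G : V → ℝ → ℝ≥0∞} {δ : ℝ} (hδ : 0 < δ)
    (hf : ∀ t ∈ Ioo 0 δ, Measurable fun z => f z t)
    (hGfin : ∀ᵐ z ∂μ, ∫⁻ t in Ioo 0 δ, G z t ≠ ⊤)
    (hfG : ∀ z, ∀ t ∈ Ioo 0 δ, ∀ s ∈ Ioo 0 t, ‖f z t - f z s‖ₑ ≤ ∫⁻ r in Ioo 0 t, G z r) :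
    ∃ T : V → ℝ, Measurable T ∧
      ∀ᵐ z ∂μ, ∀ t ∈ Ioo 0 δ, ‖f z t - T z‖ₑ ≤ ∫⁻ r in Ioo 0 t, G z r := by
  -- A sequence of heights suffices: it gives measurability of the limit, and the Cauchy estimate
  -- between arbitrary heights recovers the rate.
  obtain ⟨h, hanti, hmem, hlim⟩ := exists_seq_strictAnti_tendsto' hδ
  have hconv : ∀ᵐ z ∂μ, ∃ l : ℝ, Tendsto (fun n => f z (h n)) atTop (𝓝 l) := by
    filter_upwards [hGfin] with z hz
    have h0 := tendsto_setLIntegral_Ioo_zero hz hlim fun n => (hmem n).2.le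
    refine cauchySeq_tendsto_of_complete ?_
    rw [EMetric.cauchySeq_iff_le_tendsto_0]
    refine ⟨fun n => ∫⁻ t in Ioo 0 (h n), G z t, ?_, h0⟩
    have key : ∀ N a b, N ≤ a → a ≤ b →
        edist (f z (h a)) (f z (h b)) ≤ ∫⁻ t in Ioo 0 (h N), G z t := by
      intro N a b hN hab
      rcases hab.eq_or_lt with rfl | hlt
      · simp
      · rw [edist_eq_enorm_sub]
        refine (hfG z _ (hmem a) _ ⟨(hmem b).1, hanti hlt⟩).trans ?_
        exact lintegral_mono_set (Ioo_subset_Ioo_right (hanti.antitone hN))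
    intro a b N ha hb
    rcases le_total a b with hab | hab
    · exact key N a b ha hab
    · rw [edist_comm]; exact key N b a hb hab
  obtain ⟨T, hT, hTlim⟩ := measurable_limit_of_tendsto_metrizable_ae
    (fun n => (hf _ (hmem n)).aemeasurable) hconv
  refine ⟨T, hT, ?_⟩
  filter_upwards [hTlim] with z hz t ht
  have : Tendsto (fun n => ‖f z t - f z (h n)‖ₑ) atTop (𝓝 ‖f z t - T z‖ₑ) :=
    (tendsto_const_nhds.sub hz).enorm
  refine le_of_tendsto this ?_
  filter_upwards [hlim.eventually (gt_mem_nhds ht.1)] with n hn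
  exact hfG z t ht _ ⟨(hmem n).1, hn⟩

/-- Average |T| ≤ |f(·,t)| + ∫ G over the heights 0 < t < δ and integrate in z. -/
theorem lintegral_limit_ne_top {f : V → ℝ → ℝ} {G : V → ℝ → ℝ≥0∞} {δ : ℝ} (hδ : 0 < δ)
    {T : V → ℝ} (hTG : ∀ᵐ z ∂μ, ∀ t ∈ Ioo 0 δ, ‖f z t - T z‖ₑ ≤ ∫⁻ r in Ioo 0 t, G z r)
    (hf : ∀ z, Measurable (f z)) (hGm : Measurable fun z => ∫⁻ t in Ioo 0 δ, G z t)
    (hfi : ∫⁻ z, ∫⁻ t in Ioo 0 δ, ‖f z t‖ₑ ∂volume ∂μ ≠ ⊤)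
    (hGi : ∫⁻ z, ∫⁻ t in Ioo 0 δ, G z t ∂volume ∂μ ≠ ⊤) :
    ∫⁻ z, ‖T z‖ₑ ∂μ ≠ ⊤ := by
  have hle : ∀ᵐ z ∂μ, ENNReal.ofReal δ * ‖T z‖ₑ
      ≤ (∫⁻ t in Ioo 0 δ, ‖f z t‖ₑ) + ENNReal.ofReal δ * ∫⁻ t in Ioo 0 δ, G z t := by
    filter_upwards [hTG] with z hz
    have hv : volume (Ioo 0 δ) = ENNReal.ofReal δ := by simp
    calc ENNReal.ofReal δ * ‖T z‖ₑ = ∫⁻ _ in Ioo 0 δ, ‖T z‖ₑ := by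
          rw [setLIntegral_const, hv, mul_comm]
      _ ≤ ∫⁻ t in Ioo 0 δ, (‖f z t‖ₑ + ∫⁻ r in Ioo 0 δ, G z r) := by
          refine setLIntegral_mono' measurableSet_Ioo fun t ht => ?_
          have e : T z = f z t - (f z t - T z) := by ring
          calc ‖T z‖ₑ = ‖f z t - (f z t - T z)‖ₑ := by rw [← e]
            _ ≤ ‖f z t‖ₑ + ‖f z t - T z‖ₑ := enorm_sub_le
            _ ≤ _ := add_le_add le_rfl ((hz t ht).trans
              (lintegral_mono_set (Ioo_subset_Ioo_right ht.2.le)))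
      _ = _ := by
          rw [lintegral_add_left (hf z).enorm, setLIntegral_const, hv, mul_comm (ENNReal.ofReal δ)]
  have h2 := lintegral_mono_ae hle
  rw [lintegral_const_mul' _ _ ENNReal.ofReal_ne_top, lintegral_add_right _ (hGm.const_mul _),
    lintegral_const_mul' _ _ ENNReal.ofReal_ne_top] at h2
  intro htop
  rw [htop, ENNReal.mul_top (by simpa using hδ)] at h2
  exact ENNReal.add_ne_top.2 ⟨hfi, ENNReal.mul_ne_top ENNReal.ofReal_ne_top hGi⟩ (top_le_iff.1 h2)

/-- A Haar measure gives a ball of radius ρ the mass ρ^d times that of the unit ball, which converts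
differentiation of measures into division by a power of ρ. -/
theorem tendsto_lintegral_closedBall_div_pow {F : V → ℝ≥0∞} {z₀ : V} {c : ℝ≥0∞}
    (h : Tendsto (fun a => (∫⁻ z in a, F z ∂μ) / μ a)
      ((IsUnifLocDoublingMeasure.vitaliFamily μ 1).filterAt z₀) (𝓝 c)) :
    Tendsto (fun ρ : ℝ => (∫⁻ z in Metric.closedBall z₀ ρ, F z ∂μ)
      / ENNReal.ofReal (ρ ^ Module.finrank ℝ V)) (𝓝[>] 0) (𝓝 (c * μ (Metric.ball 0 1))) := by
  have h1 := h.comp (IsUnifLocDoublingMeasure.tendsto_closedBall_filterAt (K := 1) μ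
    (fun _ : ℝ => z₀) (fun ρ => ρ) tendsto_id (by
      filter_upwards [self_mem_nhdsWithin] with ρ hρ
      rw [one_mul]; exact Metric.mem_closedBall_self (le_of_lt hρ)))
  have hb : μ (Metric.ball 0 1) ≠ ⊤ := Metric.isBounded_ball.measure_lt_top.ne
  have hb0 : μ (Metric.ball 0 1) ≠ 0 := (Metric.measure_ball_pos μ _ one_pos).ne'
  refine (ENNReal.Tendsto.mul_const h1 (Or.inr hb)).congr' ?_
  filter_upwards [self_mem_nhdsWithin] with ρ hρ
  have hρ' : (0 : ℝ) < ρ := hρ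
  simp only [Function.comp]
  rw [Measure.addHaar_closedBall μ _ hρ'.le, div_eq_mul_inv, div_eq_mul_inv,
    ENNReal.mul_inv (Or.inr hb) (Or.inr hb0), mul_assoc, mul_assoc,
    ENNReal.inv_mul_cancel hb0 hb, mul_one]

/-- Almost every point of the hyperplane `t = 0` has a boundary value. -/
theorem ae_exists_tendsto_lintegral_cylinder {f : V → ℝ → ℝ} {G : V → ℝ → ℝ≥0∞} {δ : ℝ}
    (hδ : 0 < δ) (hf : Measurable (Function.uncurry f)) (hG : Measurable (Function.uncurry G))
    (hfi : ∫⁻ z, ∫⁻ t in Ioo 0 δ, ‖f z t‖ₑ ∂volume ∂μ ≠ ⊤)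
    (hGi : ∫⁻ z, ∫⁻ t in Ioo 0 δ, G z t ∂volume ∂μ ≠ ⊤)
    (hfG : ∀ z, ∀ t ∈ Ioo 0 δ, ∀ s ∈ Ioo 0 t, ‖f z t - f z s‖ₑ ≤ ∫⁻ r in Ioo 0 t, G z r) :
    ∀ᵐ z₀ ∂μ, ∃ a : ℝ, ∀ C : ℝ, 0 < C →
      Tendsto (fun ρ : ℝ => (∫⁻ z in Metric.closedBall z₀ ρ, ∫⁻ t in Ioo 0 (C * ρ),
          ‖f z t - a‖ₑ ∂volume ∂μ) / ENNReal.ofReal (ρ ^ (Module.finrank ℝ V + 1)))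
        (𝓝[>] 0) (𝓝 0) := by
  have hGm : ∀ h, Measurable fun z => ∫⁻ t in Ioo 0 h, G z t := fun h => hG.lintegral_prod_right'
  have hGfin : ∀ᵐ z ∂μ, ∫⁻ t in Ioo 0 δ, G z t ≠ ⊤ := by
    filter_upwards [ae_lt_top (hGm δ) hGi] with z hz using hz.ne
  obtain ⟨T, hT, hTG⟩ := exists_measurable_limit μ hδ
    (fun t _ => hf.comp (measurable_id.prodMk measurable_const)) hGfin hfG
  have hTi : Integrable T μ := ⟨hT.aestronglyMeasurable, lt_top_iff_ne_top.2
    (lintegral_limit_ne_top μ hδ hTG (fun z => hf.comp (measurable_const.prodMk measurable_id))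
      (hGm δ) hfi hGi)⟩
  obtain ⟨h, hanti, hmem, hlim⟩ := exists_seq_strictAnti_tendsto' hδ
  -- Lebesgue differentiation of the integrals of G over the strips 0 < t < h n; countably many
  -- strips leave a null exceptional set.
  have hF : ∀ᵐ z ∂μ, ∀ n, Tendsto (fun a => (∫⁻ y in a, (∫⁻ t in Ioo 0 (h n), G y t) ∂μ) / μ a)
      ((IsUnifLocDoublingMeasure.vitaliFamily μ 1).filterAt z)
      (𝓝 (∫⁻ t in Ioo 0 (h n), G z t)) := by
    rw [ae_all_iff]
    intro n
    refine VitaliFamily.ae_tendsto_lintegral_div _ (hGm (h n)).aemeasurable ?_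
    refine ne_top_of_le_ne_top hGi (lintegral_mono fun z => ?_)
    exact lintegral_mono_set (Ioo_subset_Ioo_right (hmem n).2.le)
  filter_upwards [VitaliFamily.ae_tendsto_lintegral_enorm_sub_div
    (IsUnifLocDoublingMeasure.vitaliFamily μ 1) hTi.locallyIntegrable, hF, hGfin]
    with z₀ hz1 hz2 hz3
  refine ⟨T z₀, fun C hC => ?_⟩
  have h1 := tendsto_lintegral_closedBall_div_pow μ hz1
  have h2 := fun n => tendsto_lintegral_closedBall_div_pow μ (hz2 n)
  have h3 := tendsto_setLIntegral_Ioo_zero hz3 hlim fun n => (hmem n).2.le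
  set d := Module.finrank ℝ V
  have hb : μ (Metric.ball 0 1) ≠ ⊤ := Metric.isBounded_ball.measure_lt_top.ne
  -- Compare f(z,t) with T z along the vertical line and T z with T z₀ at a Lebesgue point. The
  -- height C ρ supplies the missing factor ρ, since neither bound depends on t.
  have hbound : ∀ n, ∀ᶠ ρ : ℝ in 𝓝[>] 0,
      (∫⁻ z in Metric.closedBall z₀ ρ, ∫⁻ t in Ioo 0 (C * ρ), ‖f z t - T z₀‖ₑ ∂volume ∂μ)
        / ENNReal.ofReal (ρ ^ (d + 1))
      ≤ ENNReal.ofReal C * ((∫⁻ z in Metric.closedBall z₀ ρ, ‖T z - T z₀‖ₑ ∂μ)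
          / ENNReal.ofReal (ρ ^ d)
        + (∫⁻ z in Metric.closedBall z₀ ρ, (∫⁻ t in Ioo 0 (h n), G z t) ∂μ)
          / ENNReal.ofReal (ρ ^ d)) := by
    intro n
    have hsm : ∀ᶠ ρ : ℝ in 𝓝[>] 0, C * ρ < h n := by
      have : Tendsto (fun ρ : ℝ => C * ρ) (𝓝[>] 0) (𝓝 (C * 0)) :=
        (tendsto_id.mono_left nhdsWithin_le_nhds).const_mul C
      rw [mul_zero] at this
      exact this.eventually (gt_mem_nhds (hmem n).1)
    filter_upwards [hsm, self_mem_nhdsWithin] with ρ hρ hρ0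
    have hρ' : (0 : ℝ) < ρ := hρ0
    have hv : volume (Ioo 0 (C * ρ)) = ENNReal.ofReal C * ENNReal.ofReal ρ := by
      simp [ENNReal.ofReal_mul hC.le]
    have hI : ∫⁻ z in Metric.closedBall z₀ ρ, ∫⁻ t in Ioo 0 (C * ρ), ‖f z t - T z₀‖ₑ ∂volume ∂μ
        ≤ (ENNReal.ofReal C * ENNReal.ofReal ρ)
          * ((∫⁻ z in Metric.closedBall z₀ ρ, ‖T z - T z₀‖ₑ ∂μ)
            + ∫⁻ z in Metric.closedBall z₀ ρ, (∫⁻ t in Ioo 0 (h n), G z t) ∂μ) := by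
      rw [← lintegral_add_right _ (hGm (h n)), ← lintegral_const_mul' _ _ (by finiteness)]
      refine lintegral_mono_ae ?_
      filter_upwards [ae_restrict_of_ae hTG] with z hz
      calc ∫⁻ t in Ioo 0 (C * ρ), ‖f z t - T z₀‖ₑ
          ≤ ∫⁻ _ in Ioo 0 (C * ρ), (‖T z - T z₀‖ₑ + ∫⁻ t in Ioo 0 (h n), G z t) := by
            refine setLIntegral_mono' measurableSet_Ioo fun t ht => ?_
            have htn : t < h n := ht.2.trans hρ
            have e : f z t - T z₀ = (T z - T z₀) + (f z t - T z) := by ring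
            rw [e]
            refine (enorm_add_le _ _).trans (add_le_add le_rfl ?_)
            refine (hz t ⟨ht.1, htn.trans (hmem n).2⟩).trans ?_
            exact lintegral_mono_set (Ioo_subset_Ioo_right htn.le)
        _ = _ := by rw [setLIntegral_const, hv, mul_comm]
    rw [← ENNReal.add_div, ← mul_div_assoc]
    refine (ENNReal.div_le_div_right hI _).trans (le_of_eq ?_)
    rw [pow_succ, ENNReal.ofReal_mul (by positivity), div_eq_mul_inv, div_eq_mul_inv,
      ENNReal.mul_inv (Or.inr (by simp)) (Or.inr (by simpa using hρ'))]
    have hc : ENNReal.ofReal ρ * (ENNReal.ofReal ρ)⁻¹ = 1 :=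
      ENNReal.mul_inv_cancel (by simpa using hρ') (by simp)
    set A := (∫⁻ z in Metric.closedBall z₀ ρ, ‖T z - T z₀‖ₑ ∂μ)
            + ∫⁻ z in Metric.closedBall z₀ ρ, (∫⁻ t in Ioo 0 (h n), G z t) ∂μ
    calc _ = ENNReal.ofReal C * A * (ENNReal.ofReal (ρ ^ d))⁻¹
          * (ENNReal.ofReal ρ * (ENNReal.ofReal ρ)⁻¹) := by ring
      _ = _ := by rw [hc, mul_one]
  rw [zero_mul] at h1
  have hlimn : ∀ n, limsup (fun ρ : ℝ =>
      (∫⁻ z in Metric.closedBall z₀ ρ, ∫⁻ t in Ioo 0 (C * ρ), ‖f z t - T z₀‖ₑ ∂volume ∂μ)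
        / ENNReal.ofReal (ρ ^ (d + 1))) (𝓝[>] 0)
      ≤ ENNReal.ofReal C * ((∫⁻ t in Ioo 0 (h n), G z₀ t) * μ (Metric.ball 0 1)) := by
    intro n
    refine (limsup_le_limsup (hbound n)).trans (le_of_eq ?_)
    have := ENNReal.Tendsto.const_mul (h1.add (h2 n)) (Or.inr (ENNReal.ofReal_ne_top (r := C)))
    rw [zero_add] at this
    exact this.limsup_eq
  have h4 : Tendsto (fun n => ENNReal.ofReal C *
      ((∫⁻ t in Ioo 0 (h n), G z₀ t) * μ (Metric.ball 0 1))) atTop (𝓝 0) := by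
    have := ENNReal.Tendsto.const_mul (ENNReal.Tendsto.mul_const h3 (Or.inr hb))
      (Or.inr (ENNReal.ofReal_ne_top (r := C)))
    simpa using this
  -- First ρ → 0 with the strip fixed, then the height of the strip tends to zero.
  exact tendsto_of_le_liminf_of_limsup_le zero_le (ge_of_tendsto' h4 hlimn)

end HalfSpace

theorem measurable_indicator_of_continuousOn {X Y : Type*} [TopologicalSpace X]
    [MeasurableSpace X] [OpensMeasurableSpace X] [TopologicalSpace Y] [MeasurableSpace Y]
    [BorelSpace Y] [Zero Y] {f : X → Y} {s : Set X} (hs : MeasurableSet s)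
    (hf : ContinuousOn f s) : Measurable (s.indicator f) := by
  classical
  rw [← piecewise_eq_indicator]
  exact hf.measurable_piecewise continuousOn_const hs

/-! ### Coordinates that flatten a graph. -/

section GraphCoordinates

variable {ι : Type} [Fintype ι] [DecidableEq ι]

/-- The decomposition `(z, s) ↦ z + s e` of the space along a unit vector. -/
def splitEquiv (e : EuclideanSpace ℝ ι) (he : ‖e‖ = 1) :
    ((Submodule.span ℝ {e})ᗮ × ℝ) ≃L[ℝ] EuclideanSpace ℝ ι :=
  LinearEquiv.toContinuousLinearEquiv
  { toFun := fun x => (x.1 : EuclideanSpace ℝ ι) + x.2 • e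
    map_add' := fun x y => by
      simp only [Prod.fst_add, Prod.snd_add, Submodule.coe_add, add_smul]; abel
    map_smul' := fun c x => by simp [mul_smul]
    invFun := fun y => ((Submodule.span ℝ {e})ᗮ.orthogonalProjectionOnto y, inner ℝ e y)
    left_inv := fun x => by
      have h0 : inner ℝ e (x.1 : EuclideanSpace ℝ ι) = 0 :=
        Submodule.mem_orthogonal_singleton_iff_inner_right.1 x.1.2
      ext1
      · simp only [map_add, map_smul]
        rw [Submodule.orthogonalProjectionOnto_mem_subspace_eq_self,
          Submodule.orthogonalProjectionOnto_orthogonal_apply_eq_zero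
            (Submodule.mem_span_singleton_self e), smul_zero, add_zero]
      · simp [inner_add_right, inner_smul_right, h0, he]
    right_inv := fun y => by
      have := Submodule.starProjection_add_starProjection_orthogonal
        (K := Submodule.span ℝ {e}) y
      rw [Submodule.starProjection_unit_singleton ℝ he, add_comm] at this
      exact this }

theorem splitEquiv_apply {e : EuclideanSpace ℝ ι} (he : ‖e‖ = 1)
    (x : (Submodule.span ℝ {e})ᗮ × ℝ) :
    splitEquiv e he x = (x.1 : EuclideanSpace ℝ ι) + x.2 • e := rfl

theorem splitEquiv_symm_apply {e : EuclideanSpace ℝ ι} (he : ‖e‖ = 1) (y : EuclideanSpace ℝ ι) :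
    (splitEquiv e he).symm y
      = ((Submodule.span ℝ {e})ᗮ.orthogonalProjectionOnto y, inner ℝ e y) := rfl

theorem finrank_orthogonal_span_add_one {e : EuclideanSpace ℝ ι} (he : ‖e‖ = 1) :
    Module.finrank ℝ (Submodule.span ℝ {e})ᗮ + 1 = Fintype.card ι := by
  have := (splitEquiv e he).toLinearEquiv.finrank_eq
  simpa using this

/-- The chart `(z, t) ↦ z + (γ z + t) e` whose slice `t = 0` is the graph of `γ`. -/
def graphChart (e : EuclideanSpace ℝ ι) (γ : (Submodule.span ℝ {e})ᗮ → ℝ)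
    (x : (Submodule.span ℝ {e})ᗮ × ℝ) : EuclideanSpace ℝ ι :=
  (x.1 : EuclideanSpace ℝ ι) + (γ x.1 + x.2) • e

variable {e : EuclideanSpace ℝ ι} {γ : (Submodule.span ℝ {e})ᗮ → ℝ}

theorem continuous_graphChart (hγ : Continuous γ) : Continuous (graphChart e γ) := by
  unfold graphChart
  fun_prop

theorem orthogonalProjectionOnto_graphChart (he : ‖e‖ = 1) (x : (Submodule.span ℝ {e})ᗮ × ℝ) :
    (Submodule.span ℝ {e})ᗮ.orthogonalProjectionOnto (graphChart e γ x) = x.1 := by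
  have := (splitEquiv e he).symm_apply_apply (x.1, γ x.1 + x.2)
  rw [splitEquiv_symm_apply] at this
  exact congrArg Prod.fst this

theorem inner_graphChart (he : ‖e‖ = 1) (x : (Submodule.span ℝ {e})ᗮ × ℝ) :
    inner ℝ e (graphChart e γ x) = γ x.1 + x.2 := by
  have := (splitEquiv e he).symm_apply_apply (x.1, γ x.1 + x.2)
  rw [splitEquiv_symm_apply] at this
  exact congrArg Prod.snd this

theorem graphChart_orthogonalProjectionOnto (he : ‖e‖ = 1) (y : EuclideanSpace ℝ ι) :
    graphChart e γ ((Submodule.span ℝ {e})ᗮ.orthogonalProjectionOnto y,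
      inner ℝ e y - γ ((Submodule.span ℝ {e})ᗮ.orthogonalProjectionOnto y)) = y := by
  have := (splitEquiv e he).apply_symm_apply y
  rw [splitEquiv_symm_apply, splitEquiv_apply] at this
  unfold graphChart
  rw [add_sub_cancel]
  exact this

/-- The chart is a shear followed by a linear isomorphism. The shear preserves the product measure
and the isomorphism takes it to a Haar measure, so uniqueness of Haar measure gives a constant
Jacobian; no differentiability of γ is needed. -/
theorem exists_lintegral_eq_graphChart (he : ‖e‖ = 1) (hγ : Continuous γ)
    (μ : Measure (Submodule.span ℝ {e})ᗮ) [μ.IsAddHaarMeasure] :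
    ∃ c : ℝ≥0∞, c ≠ 0 ∧ c ≠ ⊤ ∧ ∀ F : EuclideanSpace ℝ ι → ℝ≥0∞, Measurable F →
      ∫⁻ y, F y = c * ∫⁻ z, ∫⁻ t, F (graphChart e γ (z, t)) ∂volume ∂μ := by
  let ν := Measure.map (splitEquiv e he) (μ.prod (volume : Measure ℝ))
  have hν : ν.IsAddHaarMeasure := (splitEquiv e he).isAddHaarMeasure_map _
  have hshear : MeasurePreserving
      (fun x : (Submodule.span ℝ {e})ᗮ × ℝ => (x.1, γ x.1 + x.2)) (μ.prod volume)
      (μ.prod volume) :=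
    (MeasurePreserving.id μ).skew_product (g := fun z t => γ z + t) (by
      unfold Function.uncurry; fun_prop)
      (ae_of_all _ fun z => (measurePreserving_add_left volume (γ z)).map_eq)
  have hc := Measure.isAddLeftInvariant_eq_smul (volume : Measure (EuclideanSpace ℝ ι)) ν
  have hpos := Measure.addHaarScalarFactor_pos_of_isAddHaarMeasure
    (volume : Measure (EuclideanSpace ℝ ι)) ν
  refine ⟨Measure.addHaarScalarFactor volume ν, by simpa using hpos.ne', by simp, fun F hF => ?_⟩
  conv_lhs => rw [hc]
  rw [lintegral_smul_measure, ENNReal.smul_def, smul_eq_mul]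
  congr 1
  have hFm : Measurable fun x => F (splitEquiv e he x) :=
    hF.comp (splitEquiv e he).continuous.measurable
  rw [lintegral_map hF (splitEquiv e he).continuous.measurable, ← hshear.lintegral_comp hFm]
  exact lintegral_prod _ (hFm.comp hshear.measurable).aemeasurable

end GraphCoordinates

/-! ### Traces on Lipschitz domains and their stability. -/

section LipschitzTrace

variable {ι : Type} [Fintype ι] [DecidableEq ι]
variable {e : EuclideanSpace ℝ ι} {γ : (Submodule.span ℝ {e})ᗮ → ℝ} {K : ℝ≥0}

theorem norm_graphChart_sub_le (he : ‖e‖ = 1) (hγ : LipschitzWith K γ)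
    (x y : (Submodule.span ℝ {e})ᗮ × ℝ) :
    ‖graphChart e γ x - graphChart e γ y‖ ≤ (1 + K) * ‖x.1 - y.1‖ + |x.2 - y.2| := by
  have h1 : graphChart e γ x - graphChart e γ y
      = ((x.1 - y.1 : (Submodule.span ℝ {e})ᗮ) : EuclideanSpace ℝ ι)
        + ((γ x.1 - γ y.1) + (x.2 - y.2)) • e := by
    unfold graphChart
    rw [Submodule.coe_sub]
    module
  rw [h1]
  refine (norm_add_le _ _).trans ?_
  rw [norm_smul, he, mul_one, Real.norm_eq_abs]
  have h2 : |γ x.1 - γ y.1| ≤ K * ‖x.1 - y.1‖ := by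
    have := hγ.dist_le_mul x.1 y.1
    rwa [Real.dist_eq, dist_eq_norm] at this
  have h3 := abs_add_le (γ x.1 - γ y.1) (x.2 - y.2)
  rw [← Submodule.coe_norm]
  linarith

theorem hasDerivAt_comp_graphChart {v : EuclideanSpace ℝ ι → ℝ} {z : (Submodule.span ℝ {e})ᗮ}
    {t : ℝ} (hv : DifferentiableAt ℝ v (graphChart e γ (z, t))) :
    HasDerivAt (fun s => v (graphChart e γ (z, s))) (fderiv ℝ v (graphChart e γ (z, t)) e) t := by
  have h : HasDerivAt (fun s : ℝ => graphChart e γ (z, s)) e t := by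
    unfold graphChart
    simpa using (((hasDerivAt_id t).const_add (γ z)).smul_const e).const_add
      (z : EuclideanSpace ℝ ι)
  exact hv.hasFDerivAt.comp_hasDerivAt t h

/-- In a Lipschitz domain, near a boundary point, almost every boundary point admits a boundary
value for a smooth integrable function with integrable gradient. -/
theorem exists_ball_hausdorffMeasure_null {Ω : Set (EuclideanSpace ℝ ι)} (hΩ : IsOpen Ω)
    {v : EuclideanSpace ℝ ι → ℝ} (hv : ContDiffOn ℝ 1 v Ω)
    (hvi : ∫⁻ x in Ω, ‖v x‖ₑ ≠ ⊤) (hdv : ∫⁻ x in Ω, ‖fderiv ℝ v x‖ₑ ≠ ⊤)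
    (he : ‖e‖ = 1) (hγ : LipschitzWith K γ) {x₀ : EuclideanSpace ℝ ι} {r : ℝ} (hr : 0 < r)
    (hgraph : ∀ y ∈ Metric.ball x₀ r, y ∈ Ω ↔
      γ ((Submodule.span ℝ {e})ᗮ.orthogonalProjectionOnto y) < inner ℝ e y)
    (hx₀ : x₀ ∈ frontier Ω) :
    ∃ δ > 0, (Measure.hausdorffMeasure ((Fintype.card ι : ℝ) - 1) :
        Measure (EuclideanSpace ℝ ι))
      ({x | x ∈ frontier Ω ∧ ¬ ∃ a, HasBoundaryValue Ω v x a} ∩ Metric.ball x₀ δ) = 0 := by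
  set P := (Submodule.span ℝ {e})ᗮ.orthogonalProjectionOnto with hP
  set d := Module.finrank ℝ (Submodule.span ℝ {e})ᗮ with hd
  have hdim : d + 1 = Fintype.card ι := finrank_orthogonal_span_add_one he
  -- Using Hausdorff measure as the Haar measure on the hyperplane allows null sets to be carried to
  -- the graph by a Lipschitz map.
  let μ : Measure (Submodule.span ℝ {e})ᗮ := Measure.hausdorffMeasure (d : ℝ)
  have : μ.IsAddHaarMeasure := MeasureTheory.isAddHaarMeasure_hausdorffMeasure
  set Φ := graphChart e γ with hΦ
  have hΦc : Continuous Φ := continuous_graphChart hγ.continuous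
  obtain ⟨c, hc0, hc1, hc⟩ := exists_lintegral_eq_graphChart he hγ.continuous μ
  have hfront : ∀ y ∈ Metric.ball x₀ r, y ∈ frontier Ω → γ (P y) = inner ℝ e y := by
    intro y hy hyf
    have hc1 : Continuous fun y : EuclideanSpace ℝ ι => γ (P y) :=
      hγ.continuous.comp P.continuous
    have hc2 : Continuous fun y : EuclideanSpace ℝ ι => (inner ℝ e y : ℝ) := by fun_prop
    rcases lt_trichotomy (γ (P y)) (inner ℝ e y) with h | h | h
    · exact absurd ((hgraph y hy).2 h) (fun h' => (hΩ.frontier_eq ▸ hyf).2 h')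
    · exact h
    · exfalso
      have hcl : y ∈ closure Ω := frontier_subset_closure hyf
      have hopen : IsOpen (Metric.ball x₀ r ∩ {y | inner ℝ e y < γ (P y)}) :=
        Metric.isOpen_ball.inter (isOpen_lt hc2 hc1)
      obtain ⟨w, hw, hwΩ⟩ := mem_closure_iff.1 hcl _ hopen ⟨hy, h⟩
      exact absurd ((hgraph w hw.1).1 hwΩ) (not_lt.2 (le_of_lt hw.2))
  have hback : ∀ y ∈ Metric.ball x₀ r, y ∈ frontier Ω → Φ (P y, 0) = y := by
    intro y hy hyf
    have := graphChart_orthogonalProjectionOnto (γ := γ) he y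
    rwa [← hP, hfront y hy hyf, sub_self] at this
  set z₁ := P x₀ with hz₁
  have hx₀b : Φ (z₁, 0) = x₀ := hback x₀ (Metric.mem_ball_self hr) hx₀
  -- The chart has Lipschitz constants 1 + K in z and 1 in t, so the cylinder of size δ is mapped
  -- into the ball of radius r.
  set δ := r / (2 + K) with hδ
  have hK0 : (0 : ℝ) < 2 + K := by positivity
  have hδ0 : 0 < δ := div_pos hr hK0
  set U := Metric.ball z₁ δ with hU
  have hinball : ∀ z ∈ U, ∀ t ∈ Ioo 0 δ, Φ (z, t) ∈ Metric.ball x₀ r := by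
    intro z hz t ht
    rw [mem_ball_iff_norm, ← hx₀b]
    refine (norm_graphChart_sub_le he hγ _ _).trans_lt ?_
    have h1 : ‖z - z₁‖ < δ := mem_ball_iff_norm.1 hz
    have h2 : |t - 0| < δ := by rw [sub_zero, abs_of_pos ht.1]; exact ht.2
    have h3 : (2 + K) * δ = r := mul_div_cancel₀ _ hK0.ne'
    have h4 : (0 : ℝ) < 1 + K := by positivity
    nlinarith
  have hinΩ : ∀ z ∈ U, ∀ t ∈ Ioo 0 δ, Φ (z, t) ∈ Ω := by
    intro z hz t ht
    rw [hgraph _ (hinball z hz t ht), orthogonalProjectionOnto_graphChart he, inner_graphChart he]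
    simpa using ht.1
  set Q : Set ((Submodule.span ℝ {e})ᗮ × ℝ) := U ×ˢ Ioo 0 δ with hQ
  have hQm : MeasurableSet Q := measurableSet_ball.prod measurableSet_Ioo
  have hQmaps : MapsTo Φ Q Ω := fun x hx => hinΩ x.1 hx.1 x.2 hx.2
  -- Extension by zero outside the cylinder gives globally measurable functions; the vertical
  -- estimate persists because whole vertical segments are kept or discarded together.
  let f : (Submodule.span ℝ {e})ᗮ → ℝ → ℝ := fun z t => Q.indicator (v ∘ Φ) (z, t)
  let G : (Submodule.span ℝ {e})ᗮ → ℝ → ℝ≥0∞ := fun z t => Q.indicator (fun x => ‖fderiv ℝ v (Φ x)‖ₑ) (z, t)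
  have hdc : ContinuousOn (fun x => ‖fderiv ℝ v x‖ₑ) Ω :=
    (hv.continuousOn_fderiv_of_isOpen hΩ le_rfl).enorm
  have hfm : Measurable (Function.uncurry f) :=
    measurable_indicator_of_continuousOn hQm (hv.continuousOn.comp hΦc.continuousOn hQmaps)
  have hGm : Measurable (Function.uncurry G) :=
    measurable_indicator_of_continuousOn hQm (hdc.comp hΦc.continuousOn hQmaps)
  have hfin : ∀ w : EuclideanSpace ℝ ι → ℝ≥0∞, ContinuousOn w Ω → ∫⁻ x in Ω, w x ≠ ⊤ →
      ∫⁻ z, ∫⁻ t in Ioo 0 δ, Q.indicator (w ∘ Φ) (z, t) ∂volume ∂μ ≠ ⊤ := by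
    intro w hw hwi
    rw [← lintegral_indicator hΩ.measurableSet,
      hc _ (measurable_indicator_of_continuousOn hΩ.measurableSet hw)] at hwi
    have hwi' : ∫⁻ z, ∫⁻ t, Ω.indicator w (Φ (z, t)) ∂volume ∂μ ≠ ⊤ := by
      intro h
      rw [h, ENNReal.mul_top hc0] at hwi
      exact hwi rfl
    refine ne_top_of_le_ne_top hwi' (lintegral_mono fun z => ?_)
    refine (setLIntegral_le_lintegral _ _).trans (lintegral_mono fun t => ?_)
    by_cases hx : ((z, t) : (Submodule.span ℝ {e})ᗮ × ℝ) ∈ Q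
    · simp [hx, hQmaps hx]
    · simp [hx]
  have hfi : ∫⁻ z, ∫⁻ t in Ioo 0 δ, ‖f z t‖ₑ ∂volume ∂μ ≠ ⊤ := by
    have := hfin (fun x => ‖v x‖ₑ) hv.continuousOn.enorm hvi
    convert this using 5 with z t
    simp only [f, enorm_indicator_eq_indicator_enorm]
    rfl
  have hGi : ∫⁻ z, ∫⁻ t in Ioo 0 δ, G z t ∂volume ∂μ ≠ ⊤ :=
    hfin (fun x => ‖fderiv ℝ v x‖ₑ) hdc hdv
  have hfG : ∀ z, ∀ t ∈ Ioo 0 δ, ∀ s ∈ Ioo 0 t, ‖f z t - f z s‖ₑ ≤ ∫⁻ r in Ioo 0 t, G z r := by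
    intro z t ht s hs
    by_cases hz : z ∈ U
    · have hmem : ∀ τ ∈ Icc s t, τ ∈ Ioo 0 δ := fun τ hτ =>
        ⟨hs.1.trans_le hτ.1, hτ.2.trans_lt ht.2⟩
      have hval : ∀ τ ∈ Icc s t, f z τ = v (Φ (z, τ)) := fun τ hτ =>
        indicator_of_mem (show ((z, τ) : (Submodule.span ℝ {e})ᗮ × ℝ) ∈ Q from ⟨hz, hmem τ hτ⟩) _
      rw [hval t (right_mem_Icc.2 hs.2.le), hval s (left_mem_Icc.2 hs.2.le)]
      have hcd : ContDiffOn ℝ 1 (fun τ => v (Φ (z, τ))) (Icc s t) := by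
        refine hv.comp (ContDiff.contDiffOn ?_) fun τ hτ => hinΩ z hz τ (hmem τ hτ)
        simp only [hΦ, graphChart]
        fun_prop
      refine (enorm_sub_le_lintegral_deriv_of_contDiffOn_Icc hcd hs.2.le).trans ?_
      rw [← restrict_Ioo_eq_restrict_Icc]
      refine le_trans ?_ (lintegral_mono_set (Ioo_subset_Ioo_left hs.1.le))
      refine setLIntegral_mono' measurableSet_Ioo fun τ hτ => ?_
      have hτ' := hmem τ (Ioo_subset_Icc_self hτ)
      have hG : G z τ = ‖fderiv ℝ v (Φ (z, τ))‖ₑ :=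
        indicator_of_mem (show ((z, τ) : (Submodule.span ℝ {e})ᗮ × ℝ) ∈ Q from ⟨hz, hτ'⟩) _
      have hdiff : DifferentiableAt ℝ v (Φ (z, τ)) :=
        (hv.contDiffAt (hΩ.mem_nhds (hinΩ z hz τ hτ'))).differentiableAt one_ne_zero
      rw [hG, (hasDerivAt_comp_graphChart hdiff).deriv]
      refine (ContinuousLinearMap.le_opENorm _ _).trans (le_of_eq ?_)
      rw [← ofReal_norm e, he, ENNReal.ofReal_one, mul_one]
    · have h0 : ∀ τ, f z τ = 0 := fun τ =>
        indicator_of_notMem (fun h : ((z, τ) : (Submodule.span ℝ {e})ᗮ × ℝ) ∈ Q => hz h.1) _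
      simp [h0]
  have hmain := ae_exists_tendsto_lintegral_cylinder μ hδ0 hfm hGm hfi hGi hfG
  refine ⟨δ, hδ0, ?_⟩
  set N : Set (Submodule.span ℝ {e})ᗮ := {z₀ | ¬ ∃ a : ℝ, ∀ C : ℝ, 0 < C →
      Tendsto (fun ρ : ℝ => (∫⁻ z in Metric.closedBall z₀ ρ, ∫⁻ t in Ioo 0 (C * ρ),
          ‖f z t - a‖ₑ ∂volume ∂μ) / ENNReal.ofReal (ρ ^ (Module.finrank ℝ (Submodule.span ℝ {e})ᗮ + 1)))
        (𝓝[>] 0) (𝓝 0)} with hN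
  have hN0 : μ N = 0 := hmain
  -- The exceptional boundary points are the image of the null set N under this Lipschitz
  -- parametrisation of the boundary.
  have hlipg : LipschitzWith (1 + K) fun z : (Submodule.span ℝ {e})ᗮ => Φ (z, 0) := by
    refine LipschitzWith.of_dist_le_mul fun x y => ?_
    rw [dist_eq_norm, dist_eq_norm]
    simpa using norm_graphChart_sub_le he hγ (x, 0) (y, 0)
  have himg : (Measure.hausdorffMeasure ((Fintype.card ι : ℝ) - 1) :
      Measure (EuclideanSpace ℝ ι)) ((fun z : (Submodule.span ℝ {e})ᗮ => Φ (z, 0)) '' N) = 0 := by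
    have hdr : (Fintype.card ι : ℝ) - 1 = d := by
      rw [← hdim]; push_cast; ring
    rw [hdr]
    have h1 := hlipg.hausdorffMeasure_image_le (d := (d : ℝ)) (by positivity) N
    have h2 : (Measure.hausdorffMeasure (d : ℝ) : Measure (Submodule.span ℝ {e})ᗮ) N = 0 := hN0
    rw [h2, mul_zero] at h1
    exact le_antisymm h1 zero_le
  refine measure_mono_null ?_ himg
  rintro x ⟨⟨hxf, hxn⟩, hxb⟩
  have hδr : δ ≤ r := by
    rw [hδ, div_le_iff₀ hK0]
    nlinarith [K.coe_nonneg]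
  have hxr : x ∈ Metric.ball x₀ r := Metric.ball_subset_ball hδr hxb
  have hx0 := hback x hxr hxf
  have hxU : P x ∈ U := by
    rw [hU, mem_ball_iff_norm, hz₁, ← map_sub]
    exact ((Submodule.span ℝ {e})ᗮ.norm_orthogonalProjectionOnto_apply_le _).trans_lt (mem_ball_iff_norm.1 hxb)
  refine ⟨P x, fun ⟨a, ha⟩ => hxn ⟨a, ?_⟩, hx0⟩
  have hlim := ha (2 + K) hK0
  have hlim' := ENNReal.Tendsto.const_mul hlim (Or.inr hc1)
  rw [mul_zero] at hlim'
  refine tendsto_of_tendsto_of_tendsto_of_le_of_le' tendsto_const_nhds hlim'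
    (Eventually.of_forall fun _ => zero_le) ?_
  have hsm1 : ∀ᶠ ρ : ℝ in 𝓝[>] 0, Metric.ball x ρ ⊆ Metric.ball x₀ r := by
    obtain ⟨ρ₀, hρ₀, hsub⟩ := Metric.isOpen_iff.1 Metric.isOpen_ball x hxr
    filter_upwards [Ioo_mem_nhdsGT hρ₀] with ρ hρ
    exact (Metric.ball_subset_ball hρ.2.le).trans hsub
  have hsm2 : ∀ᶠ ρ : ℝ in 𝓝[>] 0, Metric.closedBall (P x) ρ ⊆ U := by
    obtain ⟨ρ₀, hρ₀, hsub⟩ := Metric.isOpen_iff.1 Metric.isOpen_ball (P x) hxU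
    filter_upwards [Ioo_mem_nhdsGT hρ₀] with ρ hρ
    exact (Metric.closedBall_subset_ball hρ.2).trans hsub
  have hsm3 : ∀ᶠ ρ : ℝ in 𝓝[>] 0, (2 + K) * ρ < δ := by
    filter_upwards [Ioo_mem_nhdsGT (div_pos hδ0 hK0)] with ρ hρ
    have := (lt_div_iff₀ hK0).1 hρ.2
    linarith
  filter_upwards [hsm1, hsm2, hsm3] with ρ h1 h2 h3
  rw [hdim, ← mul_div_assoc]
  refine ENNReal.div_le_div_right ?_ _
  have hΩb : MeasurableSet (Ω ∩ Metric.ball x ρ) := hΩ.measurableSet.inter measurableSet_ball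
  have hva : ContinuousOn (fun y => ‖v y - a‖ₑ) (Ω ∩ Metric.ball x ρ) :=
    ((hv.continuousOn.mono inter_subset_left).sub continuousOn_const).enorm
  rw [← lintegral_indicator hΩb, hc _ (measurable_indicator_of_continuousOn hΩb hva)]
  refine mul_le_mul_right ?_ c
  rw [← lintegral_indicator Metric.isClosed_closedBall.measurableSet]
  refine lintegral_mono fun z => ?_
  -- The part of Ω in a small ball lies in a cylinder of comparable size: the height differs from
  -- that of x by less than ρ and γ varies by at most K ρ.
  have hpt : ∀ t, Φ (z, t) ∈ Ω ∩ Metric.ball x ρ →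
      z ∈ Metric.closedBall (P x) ρ ∧ t ∈ Ioo 0 ((2 + K) * ρ) := by
    rintro t ⟨htΩ, htb⟩
    have hPz : P (Φ (z, t)) = z := orthogonalProjectionOnto_graphChart he (z, t)
    have hin : inner ℝ e (Φ (z, t)) = γ z + t := inner_graphChart he (z, t)
    have ht0 : 0 < t := by
      have := (hgraph _ (h1 htb)).1 htΩ
      rw [hPz, hin] at this
      linarith
    have hn : ‖Φ (z, t) - x‖ < ρ := mem_ball_iff_norm.1 htb
    have hz : ‖z - P x‖ < ρ := by
      have : z - P x = P (Φ (z, t) - x) := by rw [map_sub, hPz]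
      rw [this]
      exact ((Submodule.span ℝ {e})ᗮ.norm_orthogonalProjectionOnto_apply_le _).trans_lt hn
    refine ⟨mem_closedBall_iff_norm.2 hz.le, ht0, ?_⟩
    have hi : |inner ℝ e (Φ (z, t) - x)| < ρ := by
      refine (abs_real_inner_le_norm _ _).trans_lt ?_
      rwa [he, one_mul]
    rw [inner_sub_right, hin, ← hfront x hxr hxf] at hi
    have hL : |γ z - γ (P x)| ≤ K * ‖z - P x‖ := by
      have := hγ.dist_le_mul z (P x)
      rwa [Real.dist_eq, dist_eq_norm] at this
    have hL2 : (K : ℝ) * ‖z - P x‖ ≤ K * ρ := mul_le_mul_of_nonneg_left hz.le K.coe_nonneg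
    have a1 := (abs_lt.1 hi).2
    have a2 := (abs_le.1 hL).1
    have hρ0 : 0 < ρ := (norm_nonneg _).trans_lt hn
    nlinarith
  by_cases hz : z ∈ Metric.closedBall (P x) ρ
  · rw [indicator_of_mem hz, ← lintegral_indicator measurableSet_Ioo]
    refine lintegral_mono fun t => ?_
    by_cases ht : Φ (z, t) ∈ Ω ∩ Metric.ball x ρ
    · have ht' := (hpt t ht).2
      have hfe : f z t = v (Φ (z, t)) :=
        indicator_of_mem (show ((z, t) : (Submodule.span ℝ {e})ᗮ × ℝ) ∈ Q from ⟨h2 hz, ht'.1, ht'.2.trans h3⟩) _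
      rw [indicator_of_mem ht, indicator_of_mem ht', hfe]
    · rw [indicator_of_notMem ht]
      exact zero_le
  · have : ∀ t, (Ω ∩ Metric.ball x ρ).indicator (fun y => ‖v y - a‖ₑ) (Φ (z, t)) = 0 := fun t =>
      indicator_of_notMem (fun ht => hz (hpt t ht).1) _
    exact (lintegral_eq_zero_of_ae_eq_zero (ae_of_all _ this)).le.trans zero_le

/-- A smooth integrable function with integrable gradient on a Lipschitz domain has a boundary
value at almost every boundary point. -/
theorem ae_exists_hasBoundaryValue {Ω : Set (EuclideanSpace ℝ ι)} (hΩ : IsOpen Ω)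
    (hLip : HasLipschitzBoundary Ω) {v : EuclideanSpace ℝ ι → ℝ} (hv : ContDiffOn ℝ 1 v Ω)
    (hvi : ∫⁻ x in Ω, ‖v x‖ₑ ≠ ⊤) (hdv : ∫⁻ x in Ω, ‖fderiv ℝ v x‖ₑ ≠ ⊤) :
    ∀ᵐ x ∂(Measure.hausdorffMeasure ((Fintype.card ι : ℝ) - 1) :
      Measure (EuclideanSpace ℝ ι)), x ∈ frontier Ω → ∃ a, HasBoundaryValue Ω v x a := by
  rw [ae_iff]
  simp only [Classical.not_imp]
  -- The local null sets combine because the space is second countable.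
  refine measure_null_of_locally_null _ fun x hx => ?_
  obtain ⟨e, γ, K, r, he, hγ, hr, hgraph⟩ := hLip x hx.1
  obtain ⟨δ, hδ, h0⟩ := exists_ball_hausdorffMeasure_null hΩ hv hvi hdv he hγ hr hgraph hx.1
  exact ⟨_, inter_mem_nhdsWithin _ (Metric.ball_mem_nhds x hδ), h0⟩

/-- Functions whose difference is integrable against `|y - x|^{-N}` have the same boundary values
at `x`. -/
theorem HasBoundaryValue.of_lintegral_weight {Ω : Set (EuclideanSpace ℝ ι)} [Nonempty ι]
    {u v : EuclideanSpace ℝ ι → ℝ} {x : EuclideanSpace ℝ ι} {a : ℝ}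
    (hmeas : AEMeasurable u (volume.restrict Ω)) (hΩ : MeasurableSet Ω)
    (h : ∫⁻ y in Ω, ‖v y - u y‖ₑ * (edist y x ^ Fintype.card ι)⁻¹ ≠ ⊤)
    (hu : HasBoundaryValue Ω u x a) : HasBoundaryValue Ω v x a := by
  -- Absolute continuity of the integral, since the balls shrink to measure zero.
  have hlim : Tendsto (fun r : ℝ => ∫⁻ y in Ω ∩ Metric.ball x r,
      ‖v y - u y‖ₑ * (edist y x ^ Fintype.card ι)⁻¹) (𝓝[>] 0) (𝓝 0) := by
    have e1 : ∀ r : ℝ, ∫⁻ y in Ω ∩ Metric.ball x r,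
        ‖v y - u y‖ₑ * (edist y x ^ Fintype.card ι)⁻¹
        = ∫⁻ y in Metric.ball x r, ‖v y - u y‖ₑ * (edist y x ^ Fintype.card ι)⁻¹
          ∂(volume.restrict Ω) := by
      intro r
      rw [Measure.restrict_restrict measurableSet_ball, inter_comm]
    simp only [e1]
    refine tendsto_setLIntegral_zero h ?_
    refine tendsto_of_tendsto_of_tendsto_of_le_of_le tendsto_const_nhds
      (?_ : Tendsto (fun r : ℝ => volume (Metric.ball x r)) (𝓝[>] 0) (𝓝 0))
      (fun _ => zero_le) fun r => Measure.restrict_apply_le _ _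
    have e2 : ∀ᶠ r : ℝ in 𝓝[>] 0, ENNReal.ofReal (r ^ Fintype.card ι)
        * volume (Metric.ball (0 : EuclideanSpace ℝ ι) 1) = volume (Metric.ball x r) := by
      filter_upwards [self_mem_nhdsWithin] with r hr
      rw [Measure.addHaar_ball _ _ (le_of_lt hr), finrank_euclideanSpace]
    refine Tendsto.congr' e2 ?_
    have e3 : Tendsto (fun r : ℝ => ENNReal.ofReal (r ^ Fintype.card ι)) (𝓝[>] 0) (𝓝 0) := by
      have : Tendsto (fun r : ℝ => r ^ Fintype.card ι) (𝓝[>] 0) (𝓝 (0 ^ Fintype.card ι)) :=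
        (tendsto_id.mono_left nhdsWithin_le_nhds).pow _
      rw [zero_pow Fintype.card_ne_zero] at this
      simpa using ENNReal.tendsto_ofReal this
    simpa using ENNReal.Tendsto.mul_const e3
      (Or.inr (Metric.isBounded_ball (x := (0 : EuclideanSpace ℝ ι)) (r := 1)).measure_lt_top.ne)
  have hsum := hlim.add hu
  rw [add_zero] at hsum
  refine tendsto_of_tendsto_of_tendsto_of_le_of_le' tendsto_const_nhds hsum
    (Eventually.of_forall fun _ => zero_le) ?_
  filter_upwards [self_mem_nhdsWithin] with r hr
  have hr' : (0 : ℝ) < r := hr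
  have hpow : ENNReal.ofReal (r ^ Fintype.card ι) = ENNReal.ofReal r ^ Fintype.card ι :=
    ENNReal.ofReal_pow hr'.le _
  have hp0 : ENNReal.ofReal (r ^ Fintype.card ι) ≠ 0 := by
    simpa using pow_pos hr' _
  have h1 : ∫⁻ y in Ω ∩ Metric.ball x r, ‖v y - a‖ₑ
      ≤ (∫⁻ y in Ω ∩ Metric.ball x r, ‖v y - u y‖ₑ)
        + ∫⁻ y in Ω ∩ Metric.ball x r, ‖u y - a‖ₑ := by
    rw [← lintegral_add_right' _ ((hmeas.mono_measure
      (Measure.restrict_mono inter_subset_left le_rfl)).sub_const a).enorm]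
    refine lintegral_mono fun y => ?_
    have : v y - a = (v y - u y) + (u y - a) := by ring
    rw [this]
    exact enorm_add_le _ _
  refine (ENNReal.div_le_div_right h1 _).trans ?_
  rw [ENNReal.add_div]
  refine add_le_add ?_ le_rfl
  rw [ENNReal.div_le_iff hp0 ENNReal.ofReal_ne_top, mul_comm,
    ← lintegral_const_mul' _ _ ENNReal.ofReal_ne_top]
  refine setLIntegral_mono' (hΩ.inter measurableSet_ball) fun y hy => ?_
  rw [hpow]
  have hle : edist y x ^ Fintype.card ι ≤ ENNReal.ofReal r ^ Fintype.card ι := by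
    refine pow_le_pow_left' ?_ _
    rw [edist_dist]
    exact ENNReal.ofReal_le_ofReal (Metric.mem_ball.1 hy.2).le
  -- Inside the ball r^N |y - x|^{-N} is at least 1, so the average of |v - u| over the ball is
  -- controlled by the weighted integral.
  have hone : 1 ≤ ENNReal.ofReal r ^ Fintype.card ι * (edist y x ^ Fintype.card ι)⁻¹ := by
    rw [← div_eq_mul_inv]
    rw [ENNReal.le_div_iff_mul_le (Or.inr (by simpa using hr')) (Or.inr (by finiteness)), one_mul]
    exact hle
  calc ‖v y - u y‖ₑ = ‖v y - u y‖ₑ * 1 := (mul_one _).symm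
    _ ≤ ‖v y - u y‖ₑ * (ENNReal.ofReal r ^ Fintype.card ι * (edist y x ^ Fintype.card ι)⁻¹) := by
        gcongr
    _ = _ := by ring

end LipschitzTrace

/-! ### Reduction of vector norms to coordinates. -/

section EuclideanValued

variable {α : Type*} [MeasurableSpace α] {μ : Measure α} {κ : Type*} [Fintype κ] [DecidableEq κ]

theorem eLpNorm_le_sum_eval {p : ℝ≥0∞} (hp : 1 ≤ p) {f : α → EuclideanSpace ℝ κ}
    (hf : ∀ j, AEStronglyMeasurable (fun x => f x j) μ) :
    eLpNorm f p μ ≤ ∑ j, eLpNorm (fun x => f x j) p μ := by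
  have e : f = ∑ j, fun x => EuclideanSpace.single j (f x j) := by
    ext x j
    simp [Finset.sum_apply]
  have hm : ∀ j, AEStronglyMeasurable (fun x => EuclideanSpace.single j (f x j)) μ := by
    intro j
    have hc : Continuous fun t : ℝ => EuclideanSpace.single j t := by
      have : (fun t : ℝ => EuclideanSpace.single j t)
          = fun t => t • EuclideanSpace.single j (1 : ℝ) := by
        ext t i
        simp
      rw [this]
      fun_prop
    exact hc.comp_aestronglyMeasurable (hf j)
  conv_lhs => rw [e]
  refine (eLpNorm_sum_le (fun j _ => hm j) hp).trans (Finset.sum_le_sum fun j _ => ?_)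
  exact (eLpNorm_congr_norm_ae (ae_of_all _ fun x => by simp)).le

theorem norm_fderiv_le_sum_partialDeriv {ι : Type} [Fintype ι] [DecidableEq ι]
    (v : EuclideanSpace ℝ ι → ℝ) (x : EuclideanSpace ℝ ι) :
    ‖fderiv ℝ v x‖ₑ ≤ ∑ c, ‖partialDeriv c v x‖ₑ := by
  have h : ‖fderiv ℝ v x‖ ≤ ∑ c, ‖partialDeriv c v x‖ := by
    refine ContinuousLinearMap.opNorm_le_bound _ (by positivity) fun y => ?_
    have e : y = ∑ c, y c • EuclideanSpace.single c (1 : ℝ) := by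
      ext i
      simp [Pi.single_apply]
    conv_lhs => rw [e, map_sum]
    rw [Finset.sum_mul]
    refine (norm_sum_le _ _).trans (Finset.sum_le_sum fun c _ => ?_)
    rw [map_smul, norm_smul, mul_comm]
    exact mul_le_mul_of_nonneg_left (PiLp.norm_apply_le y c) (norm_nonneg _)
  rw [← ofReal_norm]
  refine (ENNReal.ofReal_le_ofReal h).trans (le_of_eq ?_)
  rw [ENNReal.ofReal_sum_of_nonneg fun _ _ => norm_nonneg _]
  simp only [ofReal_norm]

end EuclideanValued

/-! ### One approximation of prescribed accuracy. -/

section Approximation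

variable {k : ℕ} {n : Fin k → ℕ} {Ω S : Set (Space n)}

theorem isWeakBlockGrad_of_contDiffOn (hΩ : IsOpen Ω) {v : Space n → ℝ}
    (hv : ContDiffOn ℝ ∞ v Ω) (i : Fin k) : IsWeakBlockGrad Ω i v (blockGrad i v) :=
  ⟨(contDiffOn_blockGrad hΩ hv).continuousOn.locallyIntegrableOn hΩ.measurableSet,
    fun _ hφ j => integral_mul_partialDeriv_of_contDiffOn hΩ hv hφ ⟨i, j⟩⟩

/-- The fundamental lemma of the calculus of variations, coordinate by coordinate. It lets
convergence be proved for one chosen weak gradient and stated for all. -/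
theorem IsWeakBlockGrad.ae_eq (hΩ : IsOpen Ω) {i : Fin k} {u : Space n → ℝ}
    {g g' : Space n → Block n i} (hg : IsWeakBlockGrad Ω i u g) (hg' : IsWeakBlockGrad Ω i u g') :
    g =ᵐ[volume.restrict Ω] g' := by
  have hcoord : ∀ j, ∀ᵐ x, x ∈ Ω → g x j - g' x j = 0 := by
    intro j
    have hloc : ∀ {f : Space n → Block n i}, LocallyIntegrableOn f Ω →
        LocallyIntegrableOn (fun x => f x j) Ω := by
      intro f hf x hx
      obtain ⟨s, hs, hfs⟩ := hf x hx
      exact ⟨s, hs, (EuclideanSpace.proj j : Block n i →L[ℝ] ℝ).integrable_comp hfs⟩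
    refine hΩ.ae_eq_zero_of_integral_contDiff_smul_eq_zero ((hloc hg.1).sub (hloc hg'.1)) ?_
    intro φ hφ hφc hφΩ
    have htest : IsTestFunction Ω φ := ⟨hφ, hφc, hφΩ⟩
    have hint : ∀ {f : Space n → Block n i}, LocallyIntegrableOn f Ω →
        Integrable fun x => φ x * f x j := by
      intro f hf
      have h1 : IntegrableOn (fun x => f x j) (tsupport φ) :=
        (hloc hf).integrableOn_compact_subset hφΩ hφc
      have h2 : IntegrableOn (fun x => φ x * f x j) (tsupport φ) :=
        h1.continuousOn_mul hφ.continuous.continuousOn hφc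
      rwa [integrableOn_iff_integrable_of_support_subset] at h2
      intro x hx
      exact subset_tsupport _ (left_ne_zero_of_mul hx)
    have hval : ∀ {f : Space n → Block n i}, IsWeakBlockGrad Ω i u f →
        ∫ x, φ x * f x j = -∫ x in Ω, u x * partialDeriv ⟨i, j⟩ φ x := by
      intro f hf
      rw [hf.2 φ htest j, neg_neg, ← setIntegral_eq_integral_of_forall_compl_eq_zero (s := Ω)]
      · simp only [mul_comm]
      · intro x hx
        rw [htest.eq_zero hx, zero_mul]
    simp only [smul_eq_mul, mul_sub]
    rw [integral_sub (hint hg.1) (hint hg'.1), hval hg, hval hg', sub_self]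
  rw [EventuallyEq, ae_restrict_iff' hΩ.measurableSet]
  filter_upwards [ae_all_iff.2 hcoord] with x hx hxΩ
  ext j
  exact sub_eq_zero.1 (hx j hxΩ)

variable [NeZero k] {Z B : ℕ → Space n → ℝ}

/-- For every `ε > 0` there is a smooth function on `Ω` which is `ε`-close to `u` and has the same
boundary values as `u` on `S`. -/
theorem exists_smooth_approx (hΩ : IsOpen Ω) (hL : IsLayering Ω S Z B) {u : Space n → ℝ}
    (hu : IntegrableOn u Ω) {q : ℝ≥0∞} (hq : 1 ≤ q) (huq : MemLp u q (volume.restrict Ω))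
    {I : Set (Σ i, Fin (n i))} {g : (Σ i, Fin (n i)) → Space n → ℝ}
    {r : (Σ i, Fin (n i)) → ℝ≥0∞} (hr1 : ∀ c ∈ I, 1 ≤ r c) (hr : ∀ c ∈ I, r c ≠ ⊤)
    (hr0 : ∀ c ∈ I, c.1 = 0 → r c = 1) (hg : ∀ c ∈ I, MemLp (g c) (r c) (volume.restrict Ω))
    (hw : ∀ c ∈ I, IsWeakPartial Ω c u (g c)) {ε : ℝ≥0} (hε : 0 < ε) :
    ∃ v : Space n → ℝ, ContDiffOn ℝ ∞ v Ω ∧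
      eLpNorm (v - u) 1 (volume.restrict Ω) ≤ ε + ε ∧
      (q ≠ ⊤ → eLpNorm (v - u) q (volume.restrict Ω) ≤ ε + ε) ∧
      (q = ⊤ → eLpNorm v ⊤ (volume.restrict Ω) ≤ eLpNorm u ⊤ (volume.restrict Ω)) ∧
      (∀ c ∈ I, eLpNorm (partialDeriv c v - g c) (r c) (volume.restrict Ω) ≤ 2 * ε + 2 * ε) ∧
      ∫⁻ x in Ω, ‖blockGrad 0 v x‖ₑ ≤ (1 + ε) * blockVariation Ω 0 u + n 0 * (ε + ε) ∧
      ∀ x₀ ∈ S, ∫⁻ y in Ω, ‖v y - u y‖ₑ * (edist y x₀ ^ Fintype.card (Σ i, Fin (n i)))⁻¹ ≠ ⊤ := by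
  obtain ⟨τ, hτ, hτs⟩ := ENNReal.exists_pos_sum_of_countable (ε := ε) (by simpa using hε.ne') ℕ
  obtain ⟨σ, hσ, hσs⟩ := ENNReal.exists_pos_sum_of_countable (ε := ε) (by simpa using hε.ne')
    (ℕ × ℕ)
  have hm := hΩ.measurableSet
  -- Mollification acts on the whole space, so u and its weak derivatives are extended by zero;
  -- every quantity in the conclusion depends only on values almost everywhere in Ω.
  set w := Ω.indicator u with hwdef
  have hw0 : Ω.indicator w = w := by simp [hwdef]
  have hwi : Integrable w := (integrable_indicator_iff hm).2 hu
  have hwq : MemLp w q := (memLp_indicator_iff_restrict hm).2 huq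
  have hae : w =ᵐ[volume.restrict Ω] u := indicator_ae_eq_restrict hm
  set h : (Σ i, Fin (n i)) → Space n → ℝ := fun c => Ω.indicator (g c) with hhdef
  have hh0 : ∀ c, Ω.indicator (h c) = h c := fun c => by simp [hhdef]
  have hhr : ∀ c ∈ I, MemLp (h c) (r c) := fun c hc => (memLp_indicator_iff_restrict hm).2 (hg c hc)
  have hhae : ∀ c, h c =ᵐ[volume.restrict Ω] g c := fun c => indicator_ae_eq_restrict hm
  have hhw : ∀ c ∈ I, IsWeakPartial Ω c w (h c) := by
    intro c hc φ hφ
    have e1 : ∫ x in Ω, w x * partialDeriv c φ x = ∫ x in Ω, u x * partialDeriv c φ x :=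
      integral_congr_ae (hae.mul (ae_eq_refl _))
    have e2 : ∫ x in Ω, h c x * φ x = ∫ x in Ω, g c x * φ x :=
      integral_congr_ae ((hhae c).mul (ae_eq_refl _))
    rw [e1, e2]
    exact hw c hc φ hφ
  have hvar : blockVariation Ω 0 w = blockVariation Ω 0 u := by
    unfold blockVariation
    refine iSup_congr fun φ => iSup_congr fun _ => iSup_congr fun _ => ?_
    congr 1
    exact integral_congr_ae (hae.mul (ae_eq_refl _))
  obtain ⟨M, m, K, L, hE⟩ := exists_layerEstimates hΩ hL hwi hq hwq hr1 hr hhr hτ hσ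
  set v := layerSum Z B w M m with hv
  have hlp : ∀ p : ℝ≥0∞, eLpNorm (v - u) p (volume.restrict Ω)
      = eLpNorm (v - w) p (volume.restrict Ω) := fun p =>
    eLpNorm_congr_ae ((ae_eq_refl v).sub hae.symm)
  have hsum : ∑' a, (σ a : ℝ≥0∞) + ∑' j, (τ j : ℝ≥0∞) ≤ ε + ε := add_le_add hσs.le hτs.le
  refine ⟨v, layerSum_contDiffOn hL hwi.locallyIntegrable M m, ?_, fun hq' => ?_, fun hq' => ?_,
    fun c hc => ?_, ?_, fun x₀ hx₀ => ?_⟩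
  · rw [hlp]
    exact (eLpNorm_layerSum_sub_le hΩ hL hwi.locallyIntegrable le_rfl hE.moll_one'
      hE.trunc_one').trans hsum
  · rw [hlp]
    exact (eLpNorm_layerSum_sub_le hΩ hL hwi.locallyIntegrable hq (hE.moll_q hq')
      (hE.trunc_q hq')).trans hsum
  · rw [hq'] at hwq
    refine (eLpNorm_top_layerSum_le hΩ hL hwq).trans (le_of_eq ?_)
    exact eLpNorm_indicator_eq_eLpNorm_restrict hm
  · have e : eLpNorm (partialDeriv c v - g c) (r c) (volume.restrict Ω)
        = eLpNorm (partialDeriv c v - h c) (r c) (volume.restrict Ω) :=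
      eLpNorm_congr_ae ((ae_eq_refl (partialDeriv c v)).sub (hhae c).symm)
    rw [e]
    refine (eLpNorm_partialDeriv_layerSum_sub_le hΩ hL hE hwi hw0 hc (hr1 c hc) (hr0 c hc)
      (hhr c hc) (hh0 c) (hhw c hc)).trans ?_
    rw [ENNReal.tsum_mul_left, ENNReal.tsum_mul_left]
    gcongr
  · rw [← hvar]
    exact lintegral_blockGrad_layerSum_le hΩ hL hE hwi hw0 hσs.le hτs.le
  · have e : ∫⁻ y in Ω, ‖v y - u y‖ₑ * (edist y x₀ ^ Fintype.card (Σ i, Fin (n i)))⁻¹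
        = ∫⁻ y in Ω, ‖v y - w y‖ₑ * (edist y x₀ ^ Fintype.card (Σ i, Fin (n i)))⁻¹ := by
      refine lintegral_congr_ae ?_
      filter_upwards [hae] with y hy
      rw [hy]
    rw [e]
    refine ne_top_of_le_ne_top ?_ ((lintegral_layerSum_sub_weight_le hΩ hL hE
      hwi.locallyIntegrable hx₀).trans hsum)
    simp

end Approximation

/-! ### Convergence in L^q, including the weak* case. -/

section Convergence

variable {k : ℕ} {n : Fin k → ℕ} {Ω : Set (Space n)}

theorem convergesLq_of_tendsto {q : ℝ≥0∞} {v : ℕ → Space n → ℝ} {u : Space n → ℝ}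
    (hvm : ∀ m, AEStronglyMeasurable (v m) (volume.restrict Ω))
    (huq : MemLp u q (volume.restrict Ω))
    (h1 : Tendsto (fun m => eLpNorm (v m - u) 1 (volume.restrict Ω)) atTop (𝓝 0))
    (hfin : q ≠ ⊤ → ∀ m, eLpNorm (v m - u) q (volume.restrict Ω) ≠ ⊤)
    (hq : q ≠ ⊤ → Tendsto (fun m => eLpNorm (v m - u) q (volume.restrict Ω)) atTop (𝓝 0))
    (htop : q = ⊤ → ∀ m, eLpNorm (v m) ⊤ (volume.restrict Ω) ≤ eLpNorm u ⊤ (volume.restrict Ω)) :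
    ConvergesLq Ω q v u := by
  refine ⟨fun m => ?_, hq, fun hqt f hf => ?_⟩
  · by_cases hqt : q = ⊤
    · subst hqt
      exact ⟨hvm m, (htop rfl m).trans_lt huq.2⟩
    · have h2 : MemLp (v m - u) q (volume.restrict Ω) :=
        ⟨(hvm m).sub huq.1, lt_top_iff_ne_top.2 (hfin hqt m)⟩
      have := h2.add huq
      rwa [sub_add_cancel] at this
  · subst hqt
    -- L¹ convergence gives almost everywhere convergence along a further subsequence, and the
    -- uniform bound by ‖u‖_∞ gives the majorant; the limit is independent of the subsequence.
    refine tendsto_of_subseq_tendsto fun ns hns => ?_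
    have hmeas : TendstoInMeasure (volume.restrict Ω) (fun m => v (ns m)) atTop u :=
      tendstoInMeasure_of_tendsto_eLpNorm one_ne_zero (fun m => hvm (ns m)) huq.1 (h1.comp hns)
    obtain ⟨ms, -, hms⟩ := hmeas.exists_seq_tendsto_ae
    refine ⟨ms, ?_⟩
    set C := (eLpNorm u ⊤ (volume.restrict Ω)).toReal with hC
    refine tendsto_integral_of_dominated_convergence (fun x => C * ‖f x‖)
      (fun j => (hvm _).mul hf.1) (hf.norm.const_mul C) (fun j => ?_) ?_
    · have hb := ae_le_eLpNormEssSup (f := v (ns (ms j))) (μ := volume.restrict Ω)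
      filter_upwards [hb] with x hx
      rw [norm_mul]
      refine mul_le_mul_of_nonneg_right ?_ (norm_nonneg _)
      have h3 : ‖v (ns (ms j)) x‖ₑ ≤ eLpNorm u ⊤ (volume.restrict Ω) := by
        refine hx.trans ?_
        rw [← eLpNorm_exponent_top]
        exact htop rfl _
      have h4 := ENNReal.toReal_mono huq.2.ne h3
      rwa [toReal_enorm] at h4
    · filter_upwards [hms] with x hx
      exact hx.mul_const _

end Convergence

/-! ### Gradients, variation and traces of the approximating sequence. -/

section FinalEstimates

variable {k : ℕ} {n : Fin k → ℕ} {Ω S : Set (Space n)}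

theorem eLpNorm_blockGrad_sub_le (hΩ : IsOpen Ω) {v : Space n → ℝ} (hv : ContDiffOn ℝ ∞ v Ω)
    {i : Fin k} {p : ℝ≥0∞} (hp : 1 ≤ p) {g : Space n → Block n i}
    (hg : AEStronglyMeasurable g (volume.restrict Ω)) {δ : ℝ≥0∞}
    (h : ∀ j, eLpNorm (partialDeriv ⟨i, j⟩ v - fun x => g x j) p (volume.restrict Ω) ≤ δ) :
    eLpNorm (fun x => blockGrad i v x - g x) p (volume.restrict Ω) ≤ n i * δ := by
  have hm : ∀ j, AEStronglyMeasurable (fun x => (blockGrad i v x - g x) j)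
      (volume.restrict Ω) := by
    intro j
    have h1 : AEStronglyMeasurable (fun x => blockGrad i v x - g x) (volume.restrict Ω) :=
      ((contDiffOn_blockGrad hΩ hv).continuousOn.aestronglyMeasurable hΩ.measurableSet).sub hg
    exact (EuclideanSpace.proj j : Block n i →L[ℝ] ℝ).continuous.comp_aestronglyMeasurable h1
  refine (eLpNorm_le_sum_eval hp hm).trans ?_
  refine (Finset.sum_le_sum fun j _ => h j).trans (le_of_eq ?_)
  simp

theorem lintegral_fderiv_ne_top_of_blockGrad {v : Space n → ℝ}
    (h : ∀ i, IntegrableOn (blockGrad i v) Ω) : ∫⁻ x in Ω, ‖fderiv ℝ v x‖ₑ ≠ ⊤ := by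
  have hc : ∀ c : Σ i, Fin (n i), IntegrableOn (partialDeriv c v) Ω := fun c =>
    (EuclideanSpace.proj c.2 : Block n c.1 →L[ℝ] ℝ).integrable_comp (h c.1)
  refine ne_top_of_le_ne_top ?_ (lintegral_mono fun x => norm_fderiv_le_sum_partialDeriv v x)
  rw [lintegral_finsetSum' _ fun c _ => (hc c).1.enorm]
  exact (ENNReal.sum_lt_top.2 fun c _ => (hc c).2).ne

/-- Lower semicontinuity of the variation from below, the assumed bounds from above. -/
theorem tendsto_lintegral_blockGrad (hΩ : IsOpen Ω) {i : Fin k} {u : Space n → ℝ}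
    {v : ℕ → Space n → ℝ} (hu : IntegrableOn u Ω) (hvi : ∀ m, IntegrableOn (v m) Ω)
    (hv : ∀ m, ContDiffOn ℝ ∞ (v m) Ω)
    (h1 : Tendsto (fun m => eLpNorm (v m - u) 1 (volume.restrict Ω)) atTop (𝓝 0))
    {b : ℕ → ℝ≥0∞} (hb : Tendsto b atTop (𝓝 (blockVariation Ω i u)))
    (hle : ∀ m, ∫⁻ x in Ω, ‖blockGrad i (v m) x‖ₑ ≤ b m) :
    Tendsto (fun m => ∫⁻ x in Ω, ‖blockGrad i (v m) x‖ₑ) atTop (𝓝 (blockVariation Ω i u)) := by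
  refine tendsto_of_le_liminf_of_limsup_le ?_ ?_
  · exact (blockVariation_le_liminf hu hvi h1).trans
      (liminf_le_liminf (Eventually.of_forall fun m => blockVariation_le_lintegral hΩ (hv m)))
  · exact (limsup_le_limsup (Eventually.of_forall hle)).trans hb.limsup_eq.le

/-- Existence is obtained for the smooth function v 0 only. The weighted estimate transfers its
boundary values to u, and from u to every v m, at each point of S where v 0 has one. -/
theorem exists_common_trace (hΩ : IsOpen Ω) (hLip : HasLipschitzBoundary Ω)
    [Nonempty (Σ i, Fin (n i))] (hS : S ⊆ frontier Ω) {u : Space n → ℝ} {v : ℕ → Space n → ℝ}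
    (hu : IntegrableOn u Ω) (hvi : ∀ m, IntegrableOn (v m) Ω) (hv : ∀ m, ContDiffOn ℝ ∞ (v m) Ω)
    (hgrad : ∀ m i, IntegrableOn (blockGrad i (v m)) Ω)
    (hS' : ∀ m, ∀ x₀ ∈ S, ∫⁻ y in Ω,
      ‖v m y - u y‖ₑ * (edist y x₀ ^ Fintype.card (Σ i, Fin (n i)))⁻¹ ≠ ⊤) :
    ∃ T, IsTraceOn Ω S u T ∧ ∀ m, IsTraceOn Ω S (v m) T := by
  have hex := ae_exists_hasBoundaryValue hΩ hLip ((hv 0).of_le (by simp)) (hvi 0).2.ne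
    (lintegral_fderiv_ne_top_of_blockGrad (hgrad 0))
  choose! T hT using fun (x : Space n) (h : ∃ a, HasBoundaryValue Ω (v 0) x a) => h
  have huT : ∀ x ∈ S, HasBoundaryValue Ω (v 0) x (T x) → HasBoundaryValue Ω u x (T x) := by
    intro x hx h0
    refine h0.of_lintegral_weight (hvi 0).1.aemeasurable hΩ.measurableSet ?_
    have := hS' 0 x hx
    simpa only [enorm_sub_rev (u _)] using this
  refine ⟨T, ?_, fun m => ?_⟩
  · filter_upwards [hex] with x hx hxS
    exact huT x hxS (hT x (hx (hS hxS)))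
  · filter_upwards [hex] with x hx hxS
    exact (huT x hxS (hT x (hx (hS hxS)))).of_lintegral_weight hu.1.aemeasurable
      hΩ.measurableSet (hS' m x hxS)

end FinalEstimates

end

/-! ### Assembly of the theorem. -/

theorem mainTheorem9 {k : ℕ} [NeZero k] (n : Fin k → ℕ) (hn : ∀ i, 0 < n i)
    (Ω₁ : Set (Block n 0)) (Ω₂ : Set (OtherBlocks n))
    (hΩ₁ : IsOpen Ω₁) (hΩ₁b : Bornology.IsBounded Ω₁)
    (hΩ₂ : IsOpen Ω₂) (hΩ₂b : Bornology.IsBounded Ω₂)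
    (hLip : HasLipschitzBoundary (blockProd Ω₁ Ω₂))
    (p : Fin k → ℝ) (hp0 : p 0 = 1) (hp : ∀ i, i ≠ 0 → 1 < p i)
    (q : ℝ≥0∞) (hq : 1 ≤ q)
    (u : Space n → ℝ) (hu : MemAnisoBV (blockProd Ω₁ Ω₂) p u)
    (huq : MemLp u q (volume.restrict (blockProd Ω₁ Ω₂))) :
    ∃ v : ℕ → Space n → ℝ,
      (∀ m, MemW11 (blockProd Ω₁ Ω₂) (v m) ∧ ContDiffOn ℝ ∞ (v m) (blockProd Ω₁ Ω₂)) ∧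
      ConvergesLq (blockProd Ω₁ Ω₂) q v u ∧
      (Tendsto (fun m => ∫⁻ x in blockProd Ω₁ Ω₂, ‖blockGrad 0 (v m) x‖ₑ) atTop
          (𝓝 (blockVariation (blockProd Ω₁ Ω₂) 0 u)) ∧
        blockVariation (blockProd Ω₁ Ω₂) 0 u ≠ ⊤) ∧
      (∀ i, i ≠ 0 → ∀ g : Space n → Block n i, IsWeakBlockGrad (blockProd Ω₁ Ω₂) i u g →
        Tendsto
          (fun m => eLpNorm (fun x => blockGrad i (v m) x - g x) (ENNReal.ofReal (p i))
            (volume.restrict (blockProd Ω₁ Ω₂)))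
          atTop (𝓝 0)) ∧
      (∃ T : Space n → ℝ,
        IsTraceOn (blockProd Ω₁ Ω₂) (blockProd (frontier Ω₁) Ω₂) u T ∧
        ∀ m, IsTraceOn (blockProd Ω₁ Ω₂) (blockProd (frontier Ω₁) Ω₂) (v m) T) ∧
      (MemAnisoW (blockProd Ω₁ Ω₂) p u →
        ∀ g : Space n → Block n 0, IsWeakBlockGrad (blockProd Ω₁ Ω₂) 0 u g →
          Tendsto
            (fun m => eLpNorm (fun x => blockGrad 0 (v m) x - g x) 1
              (volume.restrict (blockProd Ω₁ Ω₂)))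
            atTop (𝓝 0)) := by
  set Ω := blockProd Ω₁ Ω₂ with hΩdef
  set S := blockProd (frontier Ω₁) Ω₂ with hSdef
  have hΩ : IsOpen Ω := isOpen_blockProd hΩ₁ hΩ₂
  have hne : Nonempty (Σ i, Fin (n i)) := ⟨⟨0, ⟨0, hn 0⟩⟩⟩
  have hS : S ⊆ frontier Ω := blockProd_frontier_subset hΩ₁ hΩ₂
  -- Boundedness of Ω is needed to pass from gradients in L^{p_i} to integrable gradients.
  have hfinite : IsFiniteMeasure (volume.restrict Ω) := ⟨by
    rw [Measure.restrict_apply_univ]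
    exact (measure_mono subset_closure).trans_lt
      (isCompact_closure_blockProd hΩ₁b hΩ₂b).measure_lt_top⟩
  obtain ⟨Z, B, hL⟩ := exists_isLayering hΩ₁ hΩ₂
  have hui : IntegrableOn u Ω := hu.1.1
  have hV : blockVariation Ω 0 u ≠ ⊤ := blockVariation_ne_top_of_memBV hu.1
  have hp1 : ∀ i, 1 ≤ ENNReal.ofReal (p i) := by
    intro i
    rw [ENNReal.one_le_ofReal]
    rcases eq_or_ne i 0 with rfl | hi
    · exact hp0.ge
    · exact (hp i hi).le
  -- The blocks with a weak gradient in L^{p_i}. All i ≠ 0 qualify; block 0 qualifies exactly when u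
  -- also has an integrable weak gradient in x₁. Controlling every block in P makes one sequence
  -- serve both parts of the theorem.
  let P : Fin k → Prop := fun i => ∃ g : Space n → Block n i, IsWeakBlockGrad Ω i u g ∧
      MemLp g (ENNReal.ofReal (p i)) (volume.restrict Ω)
  have hPi : ∀ i, i ≠ 0 → P i := hu.2
  choose! G hG using fun (i : Fin k) (h : P i) => h
  have hcoord : ∀ c : Σ i, Fin (n i), P c.1 →
      MemLp (fun x => G c.1 x c.2) (ENNReal.ofReal (p c.1)) (volume.restrict Ω) := fun c hc =>
    (EuclideanSpace.proj c.2 : Block n c.1 →L[ℝ] ℝ).comp_memLp' (hG c.1 hc).2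
  have happrox : ∀ m : ℕ, _ := fun m : ℕ => exists_smooth_approx (S := S) hΩ hL hui hq huq
    (I := {c | P c.1}) (g := fun c x => G c.1 x c.2) (r := fun c => ENNReal.ofReal (p c.1))
    (fun c _ => hp1 c.1) (fun c _ => ENNReal.ofReal_ne_top)
    (fun c _ hc0 => by simp [hc0, hp0]) hcoord (fun c hc φ hφ => (hG c.1 hc).1.2 φ hφ c.2)
    (ε := 1 / ((m : ℝ≥0) + 1)) (by positivity)
  choose v hv hv1 hvq hvtop hvg hvar hvS using happrox
  have hε : Tendsto (fun m : ℕ => ((1 / ((m : ℝ≥0) + 1) : ℝ≥0) : ℝ≥0∞)) atTop (𝓝 0) := by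
    rw [← ENNReal.coe_zero, ENNReal.tendsto_coe]
    exact tendsto_one_div_add_atTop_nhds_zero_nat
  have hεε := hε.add hε
  rw [add_zero] at hεε
  have hvm : ∀ m, AEStronglyMeasurable (v m) (volume.restrict Ω) := fun m =>
    (hv m).continuousOn.aestronglyMeasurable hΩ.measurableSet
  have h1 : Tendsto (fun m => eLpNorm (v m - u) 1 (volume.restrict Ω)) atTop (𝓝 0) :=
    tendsto_of_tendsto_of_tendsto_of_le_of_le tendsto_const_nhds hεε (fun _ => zero_le) hv1
  have hvi : ∀ m, IntegrableOn (v m) Ω := by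
    intro m
    have h2 : Integrable (v m - u) (volume.restrict Ω) := by
      rw [← memLp_one_iff_integrable]
      exact ⟨(hvm m).sub hui.1, (hv1 m).trans_lt (by finiteness)⟩
    have := h2.add hui
    rwa [sub_add_cancel] at this
  have hgrad : ∀ i, P i → ∀ g : Space n → Block n i, IsWeakBlockGrad Ω i u g → ∀ m,
      eLpNorm (fun x => blockGrad i (v m) x - g x) (ENNReal.ofReal (p i)) (volume.restrict Ω)
        ≤ n i * (2 * (1 / ((m : ℝ≥0) + 1) : ℝ≥0) + 2 * (1 / ((m : ℝ≥0) + 1) : ℝ≥0)) := by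
    intro i hi g hg m
    have hae := hg.ae_eq hΩ (hG i hi).1
    have e : eLpNorm (fun x => blockGrad i (v m) x - g x) (ENNReal.ofReal (p i))
          (volume.restrict Ω)
        = eLpNorm (fun x => blockGrad i (v m) x - G i x) (ENNReal.ofReal (p i))
          (volume.restrict Ω) :=
      eLpNorm_congr_ae ((ae_eq_refl (blockGrad i (v m))).sub hae)
    rw [e]
    exact eLpNorm_blockGrad_sub_le hΩ (hv m) (hp1 i) (hG i hi).2.1 fun j => hvg m ⟨i, j⟩ hi
  have hgradlim : ∀ i, P i → ∀ g : Space n → Block n i, IsWeakBlockGrad Ω i u g →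
      Tendsto (fun m => eLpNorm (fun x => blockGrad i (v m) x - g x) (ENNReal.ofReal (p i))
        (volume.restrict Ω)) atTop (𝓝 0) := by
    intro i hi g hg
    have h2 := ENNReal.Tendsto.const_mul hε (Or.inr (by simp : (2 : ℝ≥0∞) ≠ ⊤))
    have h3 := ENNReal.Tendsto.const_mul (h2.add h2) (Or.inr (by simp : (n i : ℝ≥0∞) ≠ ⊤))
    simp only [mul_zero, add_zero] at h3
    exact tendsto_of_tendsto_of_tendsto_of_le_of_le tendsto_const_nhds h3 (fun _ => zero_le)
      (hgrad i hi g hg)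
  have hgi : ∀ m i, IntegrableOn (blockGrad i (v m)) Ω := by
    intro m i
    have hmeas : AEStronglyMeasurable (blockGrad i (v m)) (volume.restrict Ω) :=
      (contDiffOn_blockGrad hΩ (hv m)).continuousOn.aestronglyMeasurable hΩ.measurableSet
    rcases eq_or_ne i 0 with rfl | hi
    · refine ⟨hmeas, (hvar m).trans_lt (lt_top_iff_ne_top.2 ?_)⟩
      finiteness
    · have h2 : MemLp (fun x => blockGrad i (v m) x - G i x) (ENNReal.ofReal (p i))
          (volume.restrict Ω) :=
        ⟨hmeas.sub (hG i (hPi i hi)).2.1,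
          (hgrad i (hPi i hi) _ (hG i (hPi i hi)).1 m).trans_lt (by finiteness)⟩
      have h3 := h2.add (hG i (hPi i hi)).2
      have e : (fun x => blockGrad i (v m) x - G i x) + G i = blockGrad i (v m) := by
        ext1 x
        simp
      rw [e] at h3
      exact h3.integrable (hp1 i)
  refine ⟨v, fun m => ⟨⟨hvi m, fun i => ⟨blockGrad i (v m),
      isWeakBlockGrad_of_contDiffOn hΩ (hv m) i, hgi m i⟩⟩, hv m⟩, ?_, ⟨?_, hV⟩,
    fun i hi => hgradlim i (hPi i hi), ?_, fun hW g hg => ?_⟩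
  · refine convergesLq_of_tendsto hvm huq h1 (fun hqt m => ?_) (fun hqt => ?_)
      fun hqt m => hvtop m hqt
    · exact ne_top_of_le_ne_top (by finiteness) (hvq m hqt)
    · exact tendsto_of_tendsto_of_tendsto_of_le_of_le tendsto_const_nhds hεε (fun _ => zero_le)
        fun m => hvq m hqt
  · refine tendsto_lintegral_blockGrad hΩ hui hvi hv h1 ?_ hvar
    have h2 := ENNReal.Tendsto.mul_const (hε.const_add 1) (Or.inr hV)
    have h3 := ENNReal.Tendsto.const_mul hεε (Or.inr (by simp : (n 0 : ℝ≥0∞) ≠ ⊤))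
    simpa using h2.add h3
  · exact exists_common_trace hΩ hLip hS hui hvi hv hgi hvS
  · have := hgradlim 0 (hW.2 0) g hg
    simpa only [hp0, ENNReal.ofReal_one] using this
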